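/- Let $N\ge 3$ be an integer, $\alpha_0,\gamma\in\mathbb R$, $b>0$, and let $\theta:(0,\infty)\to\mathbb R$ be an essentially bounded measurable function with $1-\frac rb\le\theta(r)\le 1+\frac rb$ for almost every $r>0$. Let $\mathfrak H_{N-1}=L^2(\mathbb R^3)\otimes L^2_s(\mathbb R^{3(N-2)})$ be the space of those complex-valued $\xi(\mathbf x_0,\mathbf x_1,\dots,\mathbf x_{N-2})$ in $L^2(\mathbb R^{3(N-1)})$ that are symmetric in the last $N-2$ variables $\mathbf x_1,\dots,\mathbf x_{N-2}\in\mathbb R^3$, and let $\hat\xi$ be the unitary Fourier transform of $\xi$. For $\lambda>0$ consider, on the domain $D=\mathfrak H_{N-1}\cap H^{1/2}(\mathbb R^{3(N-1)})$, $$\Phi^\lambda=4\pi N(N-1)\bigl(\Phi^\lambda_{\mathrm{diag}}+\Phi^\lambda_{\mathrm{off};0}+\Phi^\lambda_{\mathrm{off};1}+\Phi_{\mathrm{reg}}\bigr),$$ where $$\Phi^\lambda_{\mathrm{diag}}[\xi]=\tfrac1{\sqrt2}\int_{\mathbb R^{3(N-1)}}\sqrt{\tfrac12p^2+P^2+\lambda}\;|\hat\xi(\mathbf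 p,\mathbf P)|^2\,d\mathbf p\,d\mathbf P,$$ $$\Phi^\lambda_{\mathrm{off};0}[\xi]=-\tfrac{(N-2)(N-3)}{2\pi^2}\int_{\mathbb R^{3N}}\frac{\overline{\hat\xi(\mathbf p_3+\mathbf p_4,\mathbf p_1,\mathbf p_2,\mathbf P)}\;\hat\xi(\mathbf p_1+\mathbf p_2,\mathbf p_3,\mathbf p_4,\mathbf P)}{p_1^2+p_2^2+p_3^2+p_4^2+P^2+\lambda}\,d\mathbf p_1\cdots d\mathbf p_4\,d\mathbf P,$$ $$\Phi^\lambda_{\mathrm{off};1}[\xi]=-\tfrac{2(N-2)}{\pi^2}\int_{\mathbb R^{3N}}\frac{\overline{\hat\xi(\mathbf p_1+\mathbf p_2,\mathbf p_3,\mathbf P)}\;\hat\xi(\mathbf p_1+\mathbf p_3,\mathbf p_2,\mathbf P)}{p_1^2+p_2^2+p_3^2+P^2+\lambda}\,d\mathbf p_1d\mathbf p_2d\mathbf p_3\,d\mathbf P,$$ $$\Phi_{\mathrm{reg}}[\xi]=\alpha_0\|\xi\|^2+(N-2)\gamma\int_{\mathbb R^{3(N-1)}}\frac{\theta(|\mathbf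 x-\mathbf x'|)}{|\mathbf x-\mathbf x'|}|\xi(\mathbf x,\mathbf x',\mathbf X)|^2\,d\mathbf x\,d\mathbf x'\,d\mathbf X+\tfrac{(N-2)(N-3)}4\gamma\int_{\mathbb R^{3(N-1)}}\frac{\theta(|\mathbf x'-\mathbf x''|)}{|\mathbf x'-\mathbf x''|}|\xi(\mathbf x,\mathbf x',\mathbf x'',\mathbf X)|^2\,d\mathbf x\,d\mathbf x'\,d\mathbf x''\,d\mathbf X.$$ Here capital letters collect the remaining three-dimensional variables, and the terms with the factor $N-3$ are absent for $N=3$. Put $$\gamma_c=2-\frac1{\pi(N-2)\bigl(\frac1{\sqrt3}+\frac{N-3}8\bigr)},\qquad \Lambda_N=\max\Bigl\{0,\,1-(N-2)\pi\bigl(\tfrac1{\sqrt3}+\tfrac{N-3}8\bigr)(\gamma-\gamma_c)\Bigr\}$$ and assume $\gamma>\gamma_c$. Then $\Lambda_N\in[0,1)$, and: (i) for every $\lambda>0$ all the integrals above converge absolutely for $\xi\in D$, and $\Phi^\lambda$ is a hermitian quadratic form on $D$ that is bounded from below and closed in $\mathfrak H_{N-1}$; (ii) for every $\lambda>0$ and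 $\xi\in D$, $$\Phi^\lambda[\xi]\ge4\pi N(N-1)\Bigl[\sqrt{\tfrac\lambda2}\sqrt{1-\Lambda_N^2}+\alpha_0-\tfrac{(N+1)(N-2)\gamma}{4b}\Bigr]\|\xi\|^2;$$ (iii) for every $$\lambda>\lambda_0:=\frac{2\max\{0,\,-\alpha_0+(N+1)(N-2)\gamma/(4b)\}^2}{1-\Lambda_N^2}$$ the form $\Phi^\lambda$ is coercive: there is $c>0$ such that $\Phi^\lambda[\xi]\ge c\|\xi\|^2$ for all $\xi\in D$; moreover there is $c'>0$ such that $\Phi^\lambda[\xi]\ge c'\|\xi\|_{H^{1/2}}^2$ for all $\xi\in D$. -/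

import Mathlib

open MeasureTheory

namespace ZeroRangeBose

noncomputable section

open FourierTransform

/-! ## Closed and coercive hermitian forms in a Hilbert space -/

section Forms

variable {H : Type*} [NormedAddCommGroup H] [InnerProductSpace ℂ H]

/-- `q`, with domain `D`, is a hermitian quadratic form: it is `q[u] = B(u, u)` for a sesquilinear
form `B` on `D` (antilinear in the first argument) with `conj B(u, v) = B(v, u)`. In particular
`q` is real-valued on `D`. -/
def IsHermitianForm (D : Submodule ℂ H) (q : H → ℂ) : Prop :=
  ∃ B : D →ₗ⋆[ℂ] D →ₗ[ℂ] ℂ,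
    (∀ u v : D, (starRingEnd ℂ) (B u v) = B v u) ∧ ∀ u : D, q u = B u u

/-- A (hermitian) form `q` with domain `D` is closed if it is bounded from below and if, whenever
`u k ∈ D` converges to `ψ` in `H` and `q[u k - u l] → 0` as `k, l → ∞`, one has `ψ ∈ D` and
`q[u k - ψ] → 0`. -/
def IsClosedForm (D : Submodule ℂ H) (q : H → ℂ) : Prop :=
  (∃ m : ℝ, ∀ u ∈ D, m * ‖u‖ ^ 2 ≤ (q u).re) ∧
  ∀ (u : ℕ → H) (ψ : H), (∀ k, u k ∈ D) →
    Filter.Tendsto u Filter.atTop (nhds ψ) →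
    (∀ ε > 0, ∃ k₀ : ℕ, ∀ k ≥ k₀, ∀ l ≥ k₀, ‖q (u k - u l)‖ < ε) →
    ψ ∈ D ∧ Filter.Tendsto (fun k => q (u k - ψ)) Filter.atTop (nhds 0)

/-- A (hermitian) form `q` with domain `D` is coercive with respect to the squared norm `N2`. -/
def IsCoerciveForm (D : Submodule ℂ H) (N2 : H → ℝ) (q : H → ℂ) : Prop :=
  ∃ c > 0, ∀ u ∈ D, c * N2 u ≤ (q u).re

end Forms

/-! ## Charges of a system of `N = n + 3` bosons -/

/-- Three-dimensional Euclidean space. -/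
abbrev E3 : Type := EuclideanSpace ℝ (Fin 3)

/-- `ℝ^{3(N-1)}` with `N = n + 3`: the entry `0` is the distinguished variable (`ℝ³`), the entries
`1, …, N - 2` are the remaining ones (`ℝ^{3(N-2)}`). The norm is Euclidean. -/
abbrev Config (n : ℕ) : Type := PiLp 2 (fun _ : Fin (n + 2) => E3)

/-- `L²(ℝ^{3(N-1)})`. -/
abbrev L2 (n : ℕ) : Type := Lp ℂ 2 (volume : Measure (Config n))

/-- The permutation of the entries of a configuration, `(T_σ x) (σ i) = x i`. -/
abbrev permute (n : ℕ) (σ : Equiv.Perm (Fin (n + 2))) : Config n ≃ₗᵢ[ℝ] Config n :=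
  LinearIsometryEquiv.piLpCongrLeft 2 ℝ E3 σ

lemma quasi_permute (n : ℕ) (σ : Equiv.Perm (Fin (n + 2))) :
    Measure.QuasiMeasurePreserving (permute n σ) volume volume :=
  (permute n σ).measurePreserving.quasiMeasurePreserving

/-- `L²(ℝ³) ⊗ L²_s(ℝ^{3(N-2)})`: the square integrable functions on `ℝ^{3(N-1)}` that are invariant
under all permutations of the last `N - 2` variables. -/
def chargeSpace (n : ℕ) : Submodule ℂ (L2 n) where
  carrier := {ξ | ∀ σ : Equiv.Perm (Fin (n + 2)), σ 0 = 0 →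
    (fun x => ξ (permute n σ x)) =ᵐ[volume] ξ}
  zero_mem' := fun σ _ => by
    have h := Lp.coeFn_zero ℂ 2 (volume : Measure (Config n))
    have h' := (quasi_permute n σ).ae_eq_comp h
    filter_upwards [h, h'] with x h1 h2
    simp only [Function.comp_apply] at h2
    rw [h1, h2]
    rfl
  add_mem' := fun {ξ η} hξ hη σ hσ => by
    have h := Lp.coeFn_add ξ η
    have h' := (quasi_permute n σ).ae_eq_comp h
    filter_upwards [h, h', hξ σ hσ, hη σ hσ] with x h1 h2 h3 h4
    simp only [Function.comp_apply, Pi.add_apply] at h1 h2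
    rw [h1, h2, h3, h4]
  smul_mem' := fun c ξ hξ σ hσ => by
    have h := Lp.coeFn_smul c ξ
    have h' := (quasi_permute n σ).ae_eq_comp h
    filter_upwards [h, h', hξ σ hσ] with x h1 h2 h3
    simp only [Function.comp_apply, Pi.smul_apply] at h1 h2
    rw [h1, h2, h3]

/-- The form domain: the charges that belong to the Sobolev space `H^{1/2}(ℝ^{3(N-1)})`. -/
def formDomain (n : ℕ) : Submodule ℂ (chargeSpace n) where
  carrier := {ξ | TemperedDistribution.MemSobolev (1 / 2) 2 (Lp.toTemperedDistribution (ξ : L2 n))}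
  zero_mem' := by
    have := TemperedDistribution.memSobolev_fun_zero (Config n) ℂ (1 / 2) 2
    rw [← map_zero (Lp.toTemperedDistributionCLM ℂ (volume : Measure (Config n)) 2)] at this
    exact this
  add_mem' := fun {ξ η} hξ hη => by
    have := TemperedDistribution.MemSobolev.add hξ hη
    rw [← Lp.toTemperedDistributionCLM_apply, ← Lp.toTemperedDistributionCLM_apply,
      ← map_add] at this
    exact this
  smul_mem' := fun c ξ hξ => by
    have := TemperedDistribution.MemSobolev.smul c hξ
    rw [← Lp.toTemperedDistributionCLM_apply, ← map_smul] at this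
    exact this

/-- The unitary Fourier transform `ξ̂(p) = (2π)^{-3(N-1)/2} ∫ e^{-i p·x} ξ(x) dx` on
`L²(ℝ^{3(N-1)})`, expressed by Mathlib's one (whose kernel is `e^{-2πi p·x}`). -/
def hat {n : ℕ} (ξ : L2 n) (p : Config n) : ℂ :=
  (((2 * Real.pi) ^ (-(3 * ((n : ℝ) + 2) / 2)) : ℝ) : ℂ) *
    ((𝓕 ξ : L2 n) : Config n → ℂ) ((2 * Real.pi)⁻¹ • p)

/-- The squared norm of `H^{1/2}(ℝ^{3(N-1)})`. -/
def sobolevNormSq {n : ℕ} (ξ : L2 n) : ℝ :=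
  ∫ p : Config n, Real.sqrt (1 + ‖p‖ ^ 2) * ‖hat ξ p‖ ^ 2

/-- The configuration `(z, y, Y)`. -/
def cfg₁ {n : ℕ} (z y : E3) (Y : Fin n → E3) : Config n :=
  WithLp.toLp 2 (Fin.cons z (Fin.cons y Y : Fin (n + 1) → E3) : Fin (n + 2) → E3)

/-- The configuration `(z, y, y', Y)`. -/
def cfg₂ {m : ℕ} (z y y' : E3) (Y : Fin m → E3) : Config (m + 1) :=
  WithLp.toLp 2 (Fin.cons z (Fin.cons y (Fin.cons y' Y : Fin (m + 1) → E3) : Fin (m + 2) → E3) :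
    Fin (m + 3) → E3)

/-! ### The integrands -/

/-- `√(p²/2 + P² + λ) |ξ̂(p, P)|²`. -/
def diagIntegrand {n : ℕ} (lam : ℝ) (ξ : L2 n) (p : Config n) : ℝ :=
  Real.sqrt (1 / 2 * ‖p 0‖ ^ 2 + (∑ i : Fin (n + 1), ‖p i.succ‖ ^ 2) + lam) * ‖hat ξ p‖ ^ 2

/-- The integrand of the off-diagonal term of two pairs without common elements; the variables are
`(p₁, p₂, p₃, p₄, P)` in `ℝ^{3N}`, with `N = m + 4`. -/
def off0Integrand {m : ℕ} (lam : ℝ) (ξ : L2 (m + 1)) :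
    E3 × E3 × E3 × E3 × (Fin m → E3) → ℂ :=
  fun (p₁, p₂, p₃, p₄, P) =>
    (starRingEnd ℂ) (hat ξ (cfg₂ (p₃ + p₄) p₁ p₂ P)) * hat ξ (cfg₂ (p₁ + p₂) p₃ p₄ P) /
      ((‖p₁‖ ^ 2 + ‖p₂‖ ^ 2 + ‖p₃‖ ^ 2 + ‖p₄‖ ^ 2 + (∑ i, ‖P i‖ ^ 2) + lam : ℝ) : ℂ)

/-- The integrand of the off-diagonal term of two pairs with one common element; the variables are
`(p₁, p₂, p₃, P)` in `ℝ^{3N}`, with `N = n + 3`. -/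
def off1Integrand {n : ℕ} (lam : ℝ) (ξ : L2 n) : E3 × E3 × E3 × (Fin n → E3) → ℂ :=
  fun (p₁, p₂, p₃, P) =>
    (starRingEnd ℂ) (hat ξ (cfg₁ (p₁ + p₂) p₃ P)) * hat ξ (cfg₁ (p₁ + p₃) p₂ P) /
      ((‖p₁‖ ^ 2 + ‖p₂‖ ^ 2 + ‖p₃‖ ^ 2 + (∑ i, ‖P i‖ ^ 2) + lam : ℝ) : ℂ)

/-- `θ(|x - x'|) / |x - x'| · |ξ(x, x', X)|²`. -/
def reg3Integrand {n : ℕ} (θ : ℝ → ℝ) (ξ : L2 n) (x : Config n) : ℝ :=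
  θ ‖x 0 - x 1‖ / ‖x 0 - x 1‖ * ‖ξ x‖ ^ 2

/-- `θ(|x' - x''|) / |x' - x''| · |ξ(x, x', x'', X)|²`, for `N = m + 4`. -/
def reg4Integrand {m : ℕ} (θ : ℝ → ℝ) (ξ : L2 (m + 1)) (x : Config (m + 1)) : ℝ :=
  θ ‖x 1 - x 2‖ / ‖x 1 - x 2‖ * ‖ξ x‖ ^ 2

/-! ### The components of the form -/

/-- `Φ_diag[ξ]`. -/
def formDiag {n : ℕ} (lam : ℝ) (ξ : L2 n) : ℝ :=
  1 / Real.sqrt 2 * ∫ p, diagIntegrand lam ξ p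

/-- `Φ_{off;0}[ξ]`; it is absent for `N = 3`, and its coefficient is
`-(N - 2)(N - 3) / (2π²)` for `N = m + 4`. -/
def formOff0 : {n : ℕ} → (lam : ℝ) → (ξ : L2 n) → ℂ
  | 0, _, _ => 0
  | m + 1, lam, ξ =>
    ((-(((m : ℝ) + 2) * ((m : ℝ) + 1) / (2 * Real.pi ^ 2)) : ℝ) : ℂ) * ∫ p, off0Integrand lam ξ p

/-- `Φ_{off;1}[ξ]`, with the coefficient `-2(N - 2) / π²`, `N = n + 3`. -/
def formOff1 {n : ℕ} (lam : ℝ) (ξ : L2 n) : ℂ :=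
  ((-(2 * ((n : ℝ) + 1) / Real.pi ^ 2) : ℝ) : ℂ) * ∫ p, off1Integrand lam ξ p

/-- `Φ_reg^{(3)}[ξ]`, with the coefficient `(N - 2) γ`, `N = n + 3`. -/
def formReg3 {n : ℕ} (γ : ℝ) (θ : ℝ → ℝ) (ξ : L2 n) : ℝ :=
  ((n : ℝ) + 1) * γ * ∫ x, reg3Integrand θ ξ x

/-- `Φ_reg^{(4)}[ξ]`; it is absent for `N = 3`, and its coefficient is `(N - 2)(N - 3) γ / 4` for
`N = m + 4`. -/
def formReg4 : {n : ℕ} → (γ : ℝ) → (θ : ℝ → ℝ) → (ξ : L2 n) → ℝ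
  | 0, _, _, _ => 0
  | m + 1, γ, θ, ξ =>
    ((m : ℝ) + 2) * ((m : ℝ) + 1) / 4 * γ * ∫ x, reg4Integrand θ ξ x

/-- `Φ_reg[ξ]`. -/
def formReg {n : ℕ} (α₀ γ : ℝ) (θ : ℝ → ℝ) (ξ : L2 n) : ℝ :=
  α₀ * ‖ξ‖ ^ 2 + formReg3 γ θ ξ + formReg4 γ θ ξ

/-- The quadratic form of the charges `Φ^λ[ξ]` for `N = n + 3` bosons; the prefactor is
`4π N (N - 1)`. It is meant on `formDomain n`. -/
def chargeForm (n : ℕ) (α₀ γ : ℝ) (θ : ℝ → ℝ) (lam : ℝ) (ξ : chargeSpace n) : ℂ :=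
  ((4 * Real.pi * ((n : ℝ) + 3) * ((n : ℝ) + 2) : ℝ) : ℂ) *
    ((formDiag lam (ξ : L2 n) : ℂ) + formOff0 lam (ξ : L2 n) + formOff1 lam (ξ : L2 n) +
      (formReg α₀ γ θ (ξ : L2 n) : ℂ))

/-- The two integrals that are present only for `N ≥ 4` converge absolutely. -/
def FourBodyIntegrable : {n : ℕ} → (θ : ℝ → ℝ) → (lam : ℝ) → (ξ : L2 n) → Prop
  | 0, _, _, _ => True
  | _ + 1, θ, lam, ξ => Integrable (off0Integrand lam ξ) ∧ Integrable (reg4Integrand θ ξ)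

/-- All the integrals in the definition of `Φ^λ[ξ]` converge absolutely. -/
def FormIntegrable {n : ℕ} (θ : ℝ → ℝ) (lam : ℝ) (ξ : L2 n) : Prop :=
  Integrable (diagIntegrand lam ξ) ∧ Integrable (off1Integrand lam ξ) ∧
    Integrable (reg3Integrand θ ξ) ∧ FourBodyIntegrable θ lam ξ

/-! ### The constants -/

/-- The threshold `γ_c`. -/
def gammaC (N : ℕ) : ℝ :=
  2 - 1 / (Real.pi * ((N : ℝ) - 2) * (1 / Real.sqrt 3 + ((N : ℝ) - 3) / 8))

/-- `Λ_N`. -/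
def LambdaN (N : ℕ) (γ : ℝ) : ℝ :=
  max 0 (1 - ((N : ℝ) - 2) * Real.pi * (1 / Real.sqrt 3 + ((N : ℝ) - 3) / 8) * (γ - gammaC N))

/-- `λ₀`. -/
def lambdaZero (N : ℕ) (α₀ γ b : ℝ) : ℝ :=
  2 * (max 0 (-α₀ + ((N : ℝ) + 1) * ((N : ℝ) - 2) * γ / (4 * b))) ^ 2 / (1 - LambdaN N γ ^ 2)

end

end ZeroRangeBose

open ZeroRangeBose

open MeasureTheory

namespace ZeroRangeBose

open Set Real Filter Topology
open scoped FourierTransform SchwartzMap ContDiff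

/-! The off-diagonal terms are compared with the potentials 1/|x| of the regularization, and these
with the kinetic energy. Let T = ∫ √(p²/2 + P²) |ξ̂|² (`kineticEnergy`), and let R₁, R₂ be the
expectations of 1/|x - x'| and 1/|x' - x''| in ξ (`singularEnergy`).

Fix the total momentum of the three particles (or of each of the two pairs) and the other momenta.
In the remaining variables u, v ∈ ℝ³ the off-diagonal terms have the kernel 1/2 · 1/(u² + v² + β u·v
+ m) with m ≥ 0, where β = 1 for pairs with a common particle and β = 0 for disjoint pairs, while
1/|x| has the kernel 1/(2π²) · 1/|u - v|². The difference 1/|u - v|² - 1/(u² + v² + β u·v + m) is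
positive definite: by the Laplace representation it is a superposition over τ > 0 of e^{-τ(u² + v²)}
∑ₖ τᵏ/k! (2ᵏ - e^{-τm}(-β)ᵏ) (u·v)ᵏ, whose coefficients are nonnegative, and (u·v)ᵏ is a positive
definite kernel (`re_integral_gaussian_nonneg`, `re_integral_pairKernel_nonneg`). Hence Φ_{off;1} ≥
-2(N-2) R₁ by `re_integral_pairing_self_le`. For disjoint pairs the two factors are evaluated at
exchanged pair momenta; positivity of the kernel with β = 0 removes the exchange
(`re_integral_pairing_le_self`), and Φ_{off;0} ≥ -(N-2)(N-3)/2 · R₂.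

As θ(r)/r ≥ 1/r - 1/b and γ > γ_c > 0, the regularization gives back γ(N-2)(R₁ + (N-3)R₂/4) at the
cost (N+1)(N-2)γ/(4b) ‖ξ‖². There remains -(2-γ)(N-2)(R₁ + (N-3)R₂/4). Kato's inequality in the
variable u (`lintegral_kato`, `singular_potential_fibred`) yields R₁ ≤ (π/√3) T/√2 and R₂ ≤ (π/2)
T/√2, so the remainder is at least -Λ_N T/√2 (`re_reducedForm_ge`); Λ_N < 1 is equivalent to γ >
γ_c.

The pointwise bound √(A + λ) ≥ Λ√A + √λ √(1 - Λ²) then proves (ii). Keeping instead the fraction 1 -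
Λ_N of the diagonal term gives a Gårding inequality in H^{1/2}. Together with an upper bound by the
H^{1/2} norm, again from Kato's inequality, it implies closedness (`isClosedForm_of_bounds`). The
condition λ > λ₀ makes the constant in (ii) positive, and with the Gårding inequality this gives
coercivity in H^{1/2}. -/

/-! ### Laplace integrals on the half-line -/

lemma lintegral_exp_neg_mul {c : ℝ} (hc : 0 < c) :
    ∫⁻ a in Ioi (0 : ℝ), ENNReal.ofReal (exp (-(a * c))) = ENNReal.ofReal (1 / c) := by
  have h := Real.integral_rpow_mul_exp_neg_mul_Ioi (a := 1) one_pos hc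
  simp only [sub_self, rpow_zero, one_mul, rpow_one, Real.Gamma_one, mul_one] at h
  rw [← h, ofReal_integral_eq_lintegral_ofReal]
  · refine lintegral_congr fun a => ?_
    rw [mul_comm]
  -- A non-integrable function has integral 0 by convention, so a nonzero value proves
  -- integrability.
  · by_contra hn
    rw [integral_undef hn] at h
    exact (one_div_pos.2 hc).ne h
  · exact Eventually.of_forall fun a => (exp_pos _).le

lemma lintegral_rpow_neg_half_mul_exp_neg_mul {c : ℝ} (hc : 0 < c) :
    ∫⁻ a in Ioi (0 : ℝ), ENNReal.ofReal (a ^ (-(1 / 2) : ℝ) * exp (-(a * c))) =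
      ENNReal.ofReal (√π / √c) := by
  have h := Real.integral_rpow_mul_exp_neg_mul_Ioi (a := 1 / 2) (by norm_num) hc
  have h2 : (1 / c) ^ (1 / 2 : ℝ) * Real.Gamma (1 / 2) = √π / √c := by
    rw [Real.Gamma_one_half_eq, ← sqrt_eq_rpow, one_div, sqrt_inv]; field_simp
  rw [h2] at h
  rw [← h, ofReal_integral_eq_lintegral_ofReal]
  · refine lintegral_congr fun a => ?_
    norm_num
    rw [mul_comm c]
  · by_contra hn
    rw [integral_undef hn] at h
    have : 0 < √π / √c := by positivity
    exact this.ne h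
  · filter_upwards [ae_restrict_mem measurableSet_Ioi] with a ha
    have : (0:ℝ) < a := ha
    positivity

/-- The antiderivative is 2 arctan √c. This is the integral left over in the convolution of 1/|q|²
with itself. -/
lemma lintegral_inv_one_add_mul_sqrt :
    ∫⁻ c in Ioi (0 : ℝ), ENNReal.ofReal (1 / ((1 + c) * √c)) = ENNReal.ofReal π := by
  have hd : ∀ x ∈ Ioi (0 : ℝ), HasDerivAt (fun c => 2 * arctan (√c)) (1 / ((1 + x) * √x)) x := by
    intro x hx
    have hx : (0 : ℝ) < x := hx
    have h := ((hasDerivAt_arctan (√x)).comp x (hasDerivAt_sqrt hx.ne')).const_mul 2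
    have h0 : √x ≠ 0 := (sqrt_pos.2 hx).ne'
    have h1 : 2 * (1 / (1 + √x ^ 2) * (1 / (2 * √x))) = 1 / ((1 + x) * √x) := by
      rw [sq_sqrt hx.le]; field_simp
    rw [h1] at h
    exact h
  have hc : ContinuousWithinAt (fun c => 2 * arctan (√c)) (Ici 0) 0 := by
    apply Continuous.continuousWithinAt; fun_prop
  have hp : ∀ x ∈ Ioi (0 : ℝ), 0 ≤ 1 / ((1 + x) * √x) := fun x hx => by
    have hx : (0 : ℝ) < x := hx
    positivity
  have ht : Tendsto (fun c => 2 * arctan (√c)) atTop (𝓝 (2 * (π / 2))) := by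
    apply Tendsto.const_mul
    exact (tendsto_nhds_of_tendsto_nhdsWithin tendsto_arctan_atTop).comp tendsto_sqrt_atTop
  have h := integral_Ioi_of_hasDerivAt_of_nonneg hc hd hp ht
  have hi := integrableOn_Ioi_deriv_of_nonneg hc hd hp ht
  rw [← ofReal_integral_eq_lintegral_ofReal hi, h]
  · congr 1; simp; ring
  · filter_upwards [ae_restrict_mem measurableSet_Ioi] with a ha using hp a ha

/-! ### The convolution of 1/|q|² with itself in ℝ³ -/

/-- A Gaussian integral in three dimensions. -/
lemma lintegral_exp_neg_mul_norm_sq {κ : ℝ} (hκ : 0 < κ) (v : E3) :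
    ∫⁻ q : E3, ENNReal.ofReal (exp (-(κ * ‖q - v‖ ^ 2))) =
      ENNReal.ofReal ((π / κ) ^ (3 / 2 : ℝ)) := by
  rw [lintegral_sub_right_eq_self (fun q : E3 => ENNReal.ofReal (exp (-(κ * ‖q‖ ^ 2))))]
  have h := GaussianFourier.integral_rexp_neg_mul_sq_norm (V := E3) hκ
  have h3 : Module.finrank ℝ E3 = 3 := by simp
  rw [h3] at h
  norm_num at h
  have : ∫⁻ q : E3, ENNReal.ofReal (exp (-(κ * ‖q‖ ^ 2))) = ENNReal.ofReal (∫ q : E3, exp (-(κ * ‖q‖ ^ 2))) := by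
    rw [ofReal_integral_eq_lintegral_ofReal]
    · by_contra hn
      rw [integral_undef hn] at h
      have : 0 < (π / κ) ^ (3 / 2 : ℝ) := by positivity
      exact this.ne h
    · exact Eventually.of_forall fun a => (exp_pos _).le
  rw [this, h]

/-- The Laplace parameters of A and B are a and a c, the prefactor a being the Jacobian. With this
choice the integrals over q and a become explicit and leave a single integral in c. -/
lemma inv_mul_eq_lintegral {A B : ℝ} (hA : 0 < A) (hB : 0 < B) :
    ENNReal.ofReal (1 / (A * B)) = ∫⁻ c in Ioi (0 : ℝ), ∫⁻ a in Ioi (0 : ℝ),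
      ENNReal.ofReal (a * exp (-(a * (A + c * B)))) := by
  rw [lintegral_lintegral_swap (by fun_prop)]
  have h1 : ∀ a ∈ Ioi (0 : ℝ), ∫⁻ c in Ioi (0 : ℝ), ENNReal.ofReal (a * exp (-(a * (A + c * B))))
      = ENNReal.ofReal (1 / B) * ENNReal.ofReal (exp (-(a * A))) := by
    intro a ha
    have ha : (0 : ℝ) < a := ha
    have : ∀ c : ℝ, ENNReal.ofReal (a * exp (-(a * (A + c * B)))) =
        ENNReal.ofReal (a * exp (-(a * A))) * ENNReal.ofReal (exp (-(c * (a * B)))) := by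
      intro c
      rw [← ENNReal.ofReal_mul (by positivity), mul_assoc, ← exp_add]
      congr 3; ring
    simp_rw [this]
    rw [lintegral_const_mul _ (by fun_prop), lintegral_exp_neg_mul (by positivity),
      ← ENNReal.ofReal_mul (by positivity), ← ENNReal.ofReal_mul (by positivity)]
    congr 1; field_simp
  rw [setLIntegral_congr_fun measurableSet_Ioi h1, lintegral_const_mul _ (by fun_prop),
    lintegral_exp_neg_mul hA, ← ENNReal.ofReal_mul (by positivity)]
  congr 1; field_simp

/-- The convolution of `1 / |q|²` with itself in three dimensions is `π³ / |p|`. -/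
theorem lintegral_inv_norm_sq_mul_inv_norm_sub_sq {p : E3} (hp : p ≠ 0) :
    ∫⁻ q : E3, ENNReal.ofReal (1 / (‖q‖ ^ 2 * ‖p - q‖ ^ 2)) = ENNReal.ofReal (π ^ 3 / ‖p‖) := by
  have hp0 : 0 < ‖p‖ := norm_pos_iff.2 hp
  have hne : ∀ v : E3, ∀ᵐ q : E3, q ≠ v := fun v => by
    rw [ae_iff]; simp
  have h1 : ∫⁻ q : E3, ENNReal.ofReal (1 / (‖q‖ ^ 2 * ‖p - q‖ ^ 2)) =
      ∫⁻ q : E3, ∫⁻ c in Ioi (0 : ℝ), ∫⁻ a in Ioi (0 : ℝ),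
        ENNReal.ofReal (a * exp (-(a * (‖q‖ ^ 2 + c * ‖p - q‖ ^ 2)))) := by
    apply lintegral_congr_ae
    filter_upwards [hne 0, hne p] with q h0 h1
    exact inv_mul_eq_lintegral (by have := norm_pos_iff.2 h0; positivity)
      (by have := norm_pos_iff.2 (sub_ne_zero.2 h1.symm); positivity)
  have hm : Measurable fun z : E3 × ℝ × ℝ =>
      ENNReal.ofReal (z.2.2 * exp (-(z.2.2 * (‖z.1‖ ^ 2 + z.2.1 * ‖p - z.1‖ ^ 2)))) := by fun_prop
  have h2 : ∀ c ∈ Ioi (0 : ℝ), ∫⁻ q : E3, ∫⁻ a in Ioi (0 : ℝ),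
      ENNReal.ofReal (a * exp (-(a * (‖q‖ ^ 2 + c * ‖p - q‖ ^ 2)))) =
      ENNReal.ofReal (π ^ 2 / ‖p‖) * ENNReal.ofReal (1 / ((1 + c) * √c)) := by
    intro c hc
    have hc : (0 : ℝ) < c := hc
    rw [lintegral_lintegral_swap (by fun_prop)]
    have h3 : ∀ a ∈ Ioi (0 : ℝ), ∫⁻ q : E3,
        ENNReal.ofReal (a * exp (-(a * (‖q‖ ^ 2 + c * ‖p - q‖ ^ 2)))) =
        ENNReal.ofReal ((π / (1 + c)) ^ (3 / 2 : ℝ)) *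
          ENNReal.ofReal (a ^ (-(1 / 2) : ℝ) * exp (-(a * (c / (1 + c) * ‖p‖ ^ 2)))) := by
      intro a ha
      have ha : (0 : ℝ) < a := ha
      -- Completing the square: |q|² + c|p - q|² = (1 + c)|q - c p/(1 + c)|² + c|p|²/(1 + c).
      have h4 : ∀ q : E3, ENNReal.ofReal (a * exp (-(a * (‖q‖ ^ 2 + c * ‖p - q‖ ^ 2)))) =
          ENNReal.ofReal (a * exp (-(a * (c / (1 + c) * ‖p‖ ^ 2)))) *
            ENNReal.ofReal (exp (-(a * (1 + c) * ‖q - (c / (1 + c)) • p‖ ^ 2))) := by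
        intro q
        rw [← ENNReal.ofReal_mul (by positivity), mul_assoc, ← exp_add]
        congr 3
        rw [norm_sub_sq_real, norm_sub_sq_real, inner_smul_right, norm_smul, real_inner_comm,
          Real.norm_of_nonneg (by positivity)]
        field_simp
        ring
      simp_rw [h4]
      rw [lintegral_const_mul _ (by fun_prop), lintegral_exp_neg_mul_norm_sq (by positivity),
        ← ENNReal.ofReal_mul (by positivity), ← ENNReal.ofReal_mul (by positivity)]
      congr 1
      have h5 : (π / (a * (1 + c))) ^ (3 / 2 : ℝ) =
          (π / (1 + c)) ^ (3 / 2 : ℝ) * a ^ (-(3 / 2) : ℝ) := by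
        rw [rpow_neg ha.le, ← inv_rpow ha.le, ← mul_rpow (by positivity) (by positivity)]
        congr 1; field_simp
      have h6 : a ^ (-(1 / 2) : ℝ) = a * a ^ (-(3 / 2) : ℝ) := by
        nth_rw 2 [← rpow_one a]
        rw [← rpow_add ha]; norm_num
      rw [h5, h6]; ring
    rw [setLIntegral_congr_fun measurableSet_Ioi h3, lintegral_const_mul _ (by fun_prop),
      lintegral_rpow_neg_half_mul_exp_neg_mul (by positivity),
      ← ENNReal.ofReal_mul (by positivity), ← ENNReal.ofReal_mul (by positivity)]
    congr 1
    have h7 : (π / (1 + c)) ^ (3 / 2 : ℝ) = (π / (1 + c)) * (√π / √(1 + c)) := by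
      rw [← sqrt_div pi_pos.le, sqrt_eq_rpow]
      nth_rw 2 [← rpow_one (π / (1 + c))]
      rw [← rpow_add (by positivity)]; norm_num
    rw [h7, sqrt_mul (by positivity), sqrt_div hc.le, sqrt_sq hp0.le]
    have := sq_sqrt pi_pos.le
    field_simp
    rw [this]
  rw [h1, lintegral_lintegral_swap (by
    exact (Measurable.lintegral_prod_right' (ν := volume.restrict (Ioi (0:ℝ)))
      (f := fun z : (E3 × ℝ) × ℝ => ENNReal.ofReal (z.2 * exp (-(z.2 * (‖z.1.1‖ ^ 2 + z.1.2 * ‖p - z.1.1‖ ^ 2)))))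
      (by fun_prop)).aemeasurable), setLIntegral_congr_fun measurableSet_Ioi h2,
    lintegral_const_mul _ (by fun_prop), lintegral_inv_one_add_mul_sqrt,
    ← ENNReal.ofReal_mul (by positivity)]
  congr 1; field_simp

/-! ### Kato's inequality by a weighted Schur test, also along fibrations -/

lemma ae_ne_E3 (v : E3) : ∀ᵐ q : E3, q ≠ v := by
  rw [ae_iff]; simp

lemma mul_le_half_sq_div_add {x y r : ℝ} (hr : 0 < r) :
    x * y ≤ x ^ 2 * r / 2 + y ^ 2 / r / 2 := by
  have h : x ^ 2 * r / 2 + y ^ 2 / r / 2 - x * y = (x * r - y) ^ 2 / (2 * r) := by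
    field_simp; ring
  have : 0 ≤ (x * r - y) ^ 2 / (2 * r) := by positivity
  linarith

/-- The weight |u|²/|v|² makes the inner integral a convolution of 1/|v|² with itself, equal to
π³/|u|. -/
lemma lintegral_schur_half (φ : E3 → ℂ) :
    ∫⁻ u, ∫⁻ v, ENNReal.ofReal (‖φ u‖ ^ 2 * (‖u‖ ^ 2 / (‖v‖ ^ 2 * ‖u - v‖ ^ 2)) / 2) =
      ENNReal.ofReal (π ^ 3 / 2) * ∫⁻ u : E3, ENNReal.ofReal (‖u‖ * ‖φ u‖ ^ 2) := by
  rw [← lintegral_const_mul' _ _ ENNReal.ofReal_ne_top]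
  apply lintegral_congr_ae
  filter_upwards [ae_ne_E3 0] with u hu
  have hu0 : 0 < ‖u‖ := norm_pos_iff.2 hu
  have : ∀ v : E3, ENNReal.ofReal (‖φ u‖ ^ 2 * (‖u‖ ^ 2 / (‖v‖ ^ 2 * ‖u - v‖ ^ 2)) / 2) =
      ENNReal.ofReal (‖φ u‖ ^ 2 * ‖u‖ ^ 2 / 2) * ENNReal.ofReal (1 / (‖v‖ ^ 2 * ‖u - v‖ ^ 2)) := by
    intro v
    rw [← ENNReal.ofReal_mul (by positivity)]
    congr 1; ring
  simp_rw [this]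
  rw [lintegral_const_mul' _ _ ENNReal.ofReal_ne_top, lintegral_inv_norm_sq_mul_inv_norm_sub_sq hu,
    ← ENNReal.ofReal_mul (by positivity), ← ENNReal.ofReal_mul (by positivity)]
  congr 1; field_simp

/-- The Kato (Herbst) inequality in momentum space, with its sharp constant. -/
lemma lintegral_kato {φ ψ : E3 → ℂ} (hφ : Measurable φ) (hψ : Measurable ψ) :
    ∫⁻ u, ∫⁻ v, ENNReal.ofReal (‖φ u‖ * ‖ψ v‖ * (1 / ‖u - v‖ ^ 2)) ≤
      ENNReal.ofReal (π ^ 3 / 2) * ((∫⁻ u : E3, ENNReal.ofReal (‖u‖ * ‖φ u‖ ^ 2)) +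
        ∫⁻ u : E3, ENNReal.ofReal (‖u‖ * ‖ψ u‖ ^ 2)) := by
  have hle : ∫⁻ u, ∫⁻ v, ENNReal.ofReal (‖φ u‖ * ‖ψ v‖ * (1 / ‖u - v‖ ^ 2)) ≤
      ∫⁻ u, ∫⁻ v, (ENNReal.ofReal (‖φ u‖ ^ 2 * (‖u‖ ^ 2 / (‖v‖ ^ 2 * ‖u - v‖ ^ 2)) / 2) +
        ENNReal.ofReal (‖ψ v‖ ^ 2 * (‖v‖ ^ 2 / (‖u‖ ^ 2 * ‖v - u‖ ^ 2)) / 2)) := by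
    apply lintegral_mono_ae
    filter_upwards [ae_ne_E3 0] with u hu
    apply lintegral_mono_ae
    filter_upwards [ae_ne_E3 0] with v hv
    have hu0 : 0 < ‖u‖ := norm_pos_iff.2 hu
    have hv0 : 0 < ‖v‖ := norm_pos_iff.2 hv
    rw [← ENNReal.ofReal_add (by positivity) (by positivity)]
    apply ENNReal.ofReal_le_ofReal
    -- Schur test with the test function |u|⁻².
    have h := mul_le_half_sq_div_add (x := ‖φ u‖) (y := ‖ψ v‖) (r := ‖u‖ ^ 2 / ‖v‖ ^ 2)
      (by positivity)
    have h2 := mul_le_mul_of_nonneg_right h (show 0 ≤ 1 / ‖u - v‖ ^ 2 by positivity)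
    refine h2.trans (le_of_eq ?_)
    rw [norm_sub_rev v u]
    field_simp
  refine hle.trans ?_
  have hadd : ∀ u : E3, ∫⁻ v, (ENNReal.ofReal (‖φ u‖ ^ 2 * (‖u‖ ^ 2 / (‖v‖ ^ 2 * ‖u - v‖ ^ 2)) / 2) +
        ENNReal.ofReal (‖ψ v‖ ^ 2 * (‖v‖ ^ 2 / (‖u‖ ^ 2 * ‖v - u‖ ^ 2)) / 2)) =
      (∫⁻ v, ENNReal.ofReal (‖φ u‖ ^ 2 * (‖u‖ ^ 2 / (‖v‖ ^ 2 * ‖u - v‖ ^ 2)) / 2)) +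
        ∫⁻ v, ENNReal.ofReal (‖ψ v‖ ^ 2 * (‖v‖ ^ 2 / (‖u‖ ^ 2 * ‖v - u‖ ^ 2)) / 2) :=
    fun u => lintegral_add_left (by fun_prop) _
  simp_rw [hadd]
  rw [lintegral_add_left, mul_add, lintegral_schur_half, lintegral_lintegral_swap (by fun_prop), lintegral_schur_half]
  exact Measurable.lintegral_prod_right' (f := fun z : E3 × E3 =>
    ENNReal.ofReal (‖φ z.1‖ ^ 2 * (‖z.1‖ ^ 2 / (‖z.2‖ ^ 2 * ‖z.1 - z.2‖ ^ 2)) / 2)) (by fun_prop)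

section Fibred

variable {Y : Type*} [MeasurableSpace Y] {ν : Measure Y}

lemma lintegral_kato_fibred {a b : Y × E3 → ℂ} (ha : Measurable a) (hb : Measurable b) :
    ∫⁻ z : Y × (E3 × E3), ENNReal.ofReal
        (‖a (z.1, z.2.1)‖ * ‖b (z.1, z.2.2)‖ * (1 / ‖z.2.1 - z.2.2‖ ^ 2)) ∂ν.prod volume ≤
      ENNReal.ofReal (π ^ 3 / 2) * ((∫⁻ z : Y × E3, ENNReal.ofReal (‖z.2‖ * ‖a z‖ ^ 2) ∂ν.prod volume) +
        ∫⁻ z : Y × E3, ENNReal.ofReal (‖z.2‖ * ‖b z‖ ^ 2) ∂ν.prod volume) := by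
  rw [lintegral_prod _ (by fun_prop), lintegral_prod _ (by fun_prop), lintegral_prod _ (by fun_prop),
    ← lintegral_add_left, ← lintegral_const_mul']
  · refine lintegral_mono fun y => ?_
    rw [Measure.volume_eq_prod, lintegral_prod _ (by fun_prop)]
    exact lintegral_kato (by fun_prop) (by fun_prop)
  · exact ENNReal.ofReal_ne_top
  · exact Measurable.lintegral_prod_right' (f := fun z : Y × E3 =>
      ENNReal.ofReal (‖z.2‖ * ‖a z‖ ^ 2)) (by fun_prop)

lemma lintegral_ofReal_lt_top_of_integrable {X : Type*} [MeasurableSpace X] {μ : Measure X}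
    {f : X → ℝ} (hf : Integrable f μ) : ∫⁻ x, ENNReal.ofReal (f x) ∂μ < ⊤ := by
  refine lt_of_le_of_lt (lintegral_mono fun x => ?_) hf.2
  exact Real.ofReal_le_enorm _

/-- Sesquilinear expressions whose kernel is dominated by `1 / |u - v|²`. -/
theorem integrable_kato_fibred [SFinite ν] {a b : Y × E3 → ℂ} (ha : Measurable a) (hb : Measurable b)
    {w : Y × (E3 × E3) → ℝ} (hw : Measurable w) {C : ℝ} (hC : 0 ≤ C)
    (hwC : ∀ z, |w z| ≤ C * (1 / ‖z.2.1 - z.2.2‖ ^ 2) ∨ z.2.1 = z.2.2)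
    (hai : Integrable (fun z : Y × E3 => ‖z.2‖ * ‖a z‖ ^ 2) (ν.prod volume))
    (hbi : Integrable (fun z : Y × E3 => ‖z.2‖ * ‖b z‖ ^ 2) (ν.prod volume)) :
    Integrable (fun z : Y × (E3 × E3) => (starRingEnd ℂ) (a (z.1, z.2.1)) * b (z.1, z.2.2) * (w z : ℂ))
      (ν.prod volume) ∧
    ‖∫ z : Y × (E3 × E3), (starRingEnd ℂ) (a (z.1, z.2.1)) * b (z.1, z.2.2) * (w z : ℂ) ∂ν.prod volume‖ ≤
      C * (π ^ 3 / 2) * ((∫ z : Y × E3, ‖z.2‖ * ‖a z‖ ^ 2 ∂ν.prod volume) +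
        ∫ z : Y × E3, ‖z.2‖ * ‖b z‖ ^ 2 ∂ν.prod volume) := by
  set A := ∫ z : Y × E3, ‖z.2‖ * ‖a z‖ ^ 2 ∂ν.prod volume
  set B := ∫ z : Y × E3, ‖z.2‖ * ‖b z‖ ^ 2 ∂ν.prod volume
  have hA : ∫⁻ z : Y × E3, ENNReal.ofReal (‖z.2‖ * ‖a z‖ ^ 2) ∂ν.prod volume = ENNReal.ofReal A :=
    (ofReal_integral_eq_lintegral_ofReal hai (Eventually.of_forall fun z => by positivity)).symm
  have hB : ∫⁻ z : Y × E3, ENNReal.ofReal (‖z.2‖ * ‖b z‖ ^ 2) ∂ν.prod volume = ENNReal.ofReal B :=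
    (ofReal_integral_eq_lintegral_ofReal hbi (Eventually.of_forall fun z => by positivity)).symm
  have hA0 : 0 ≤ A := integral_nonneg fun z => by positivity
  have hB0 : 0 ≤ B := integral_nonneg fun z => by positivity
  have hk := lintegral_kato_fibred (ν := ν) ha hb
  rw [hA, hB, ← ENNReal.ofReal_add hA0 hB0, ← ENNReal.ofReal_mul (by positivity)] at hk
  -- For u = v the quotient 1/‖u - v‖² is 0 by convention, so the bound on `w` is available only off
  -- the diagonal, which is a null set.
  have hdiag : ∀ᵐ z : Y × (E3 × E3) ∂ν.prod volume, z.2.1 ≠ z.2.2 := by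
    rw [Measure.ae_prod_iff_ae_ae]
    · refine Eventually.of_forall fun y => ?_
      rw [Measure.volume_eq_prod, Measure.ae_prod_iff_ae_ae]
      · exact Eventually.of_forall fun u => (ae_ne_E3 u).mono fun v hv => hv.symm
      · exact (measurableSet_eq_fun measurable_fst measurable_snd).compl
    · exact (measurableSet_eq_fun (by fun_prop) (by fun_prop)).compl
  have hlin : ∫⁻ z : Y × (E3 × E3), ‖(starRingEnd ℂ) (a (z.1, z.2.1)) * b (z.1, z.2.2) * (w z : ℂ)‖ₑ ∂ν.prod volume ≤
      ENNReal.ofReal (C * (π ^ 3 / 2) * (A + B)) := by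
    calc _ ≤ ∫⁻ z : Y × (E3 × E3), ENNReal.ofReal C * ENNReal.ofReal
              (‖a (z.1, z.2.1)‖ * ‖b (z.1, z.2.2)‖ * (1 / ‖z.2.1 - z.2.2‖ ^ 2)) ∂ν.prod volume := by
          apply lintegral_mono_ae
          filter_upwards [hdiag] with z hz
          rw [← ofReal_norm, ← ENNReal.ofReal_mul hC]
          apply ENNReal.ofReal_le_ofReal
          rw [norm_mul, norm_mul, RCLike.norm_conj, Complex.norm_real, Real.norm_eq_abs]
          have := (hwC z).resolve_right hz
          calc _ ≤ ‖a (z.1, z.2.1)‖ * ‖b (z.1, z.2.2)‖ * (C * (1 / ‖z.2.1 - z.2.2‖ ^ 2)) := by gcongr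
            _ = _ := by ring
      _ ≤ _ := by
          rw [lintegral_const_mul' _ _ ENNReal.ofReal_ne_top, mul_assoc, ENNReal.ofReal_mul hC]
          gcongr
  have hint : Integrable (fun z : Y × (E3 × E3) => (starRingEnd ℂ) (a (z.1, z.2.1)) * b (z.1, z.2.2) * (w z : ℂ))
      (ν.prod volume) := by
    refine ⟨?_, lt_of_le_of_lt hlin ENNReal.ofReal_lt_top⟩
    have h1 : Measurable fun z : Y × (E3 × E3) => (starRingEnd ℂ) (a (z.1, z.2.1)) :=
      Complex.continuous_conj.measurable.comp (by fun_prop)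
    exact ((h1.mul (by fun_prop)).mul (Complex.measurable_ofReal.comp hw)).aestronglyMeasurable
  refine ⟨hint, ?_⟩
  have := norm_integral_le_lintegral_norm (μ := ν.prod volume) (fun z : Y × (E3 × E3) => (starRingEnd ℂ) (a (z.1, z.2.1)) * b (z.1, z.2.2) * (w z : ℂ))
  simp_rw [ofReal_norm] at this
  refine this.trans ?_
  exact ENNReal.toReal_le_of_le_ofReal (by positivity) hlin

end Fibred

/-! ### Positive definite kernels through Laplace representations -/

lemma integrable_exp_neg_mul_norm_sq {κ : ℝ} (hκ : 0 < κ) :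
    Integrable (fun q : E3 => exp (-(κ * ‖q‖ ^ 2))) := by
  have h := GaussianFourier.integral_rexp_neg_mul_sq_norm (V := E3) hκ
  by_contra hn
  simp only [neg_mul] at h
  rw [integral_undef hn] at h
  have : 0 < (π / κ) ^ (Module.finrank ℝ E3 / 2 : ℝ) := by positivity
  exact this.ne h

/-- Integration against a positive mixture of kernels. -/
lemma integrable_mixture {X : Type*} [MeasurableSpace X] {μ : Measure X} [SFinite μ]
    {g : X → ℂ} {κ : X × ℝ → ℝ} {W : X → ℝ} (hg : Measurable g) (hκ : Measurable κ)
    (hpos : ∀ z, 0 ≤ κ z)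
    (hW : ∀ᵐ x ∂μ, IntegrableOn (fun τ => κ (x, τ)) (Ioi 0) ∧ ∫ τ in Ioi (0 : ℝ), κ (x, τ) = W x)
    (hi : Integrable (fun x => g x * (W x : ℂ)) μ) :
    Integrable (fun z : X × ℝ => g z.1 * (κ z : ℂ)) (μ.prod (volume.restrict (Ioi 0))) ∧
    ∀ᵐ x ∂μ, ∫ τ in Ioi (0 : ℝ), g x * (κ (x, τ) : ℂ) = g x * (W x : ℂ) := by
  refine ⟨?_, ?_⟩
  · rw [integrable_prod_iff]
    · refine ⟨?_, ?_⟩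
      · filter_upwards [hW] with x hx
        exact (hx.1.ofReal (𝕜 := ℂ)).const_mul (g x)
      · refine hi.norm.congr ?_
        filter_upwards [hW] with x hx
        have h0 : 0 ≤ W x := hx.2 ▸ integral_nonneg fun τ => hpos _
        simp only [norm_mul, Complex.norm_real, Real.norm_eq_abs]
        rw [integral_const_mul, abs_of_nonneg h0]
        simp_rw [fun τ => abs_of_nonneg (hpos (x, τ))]
        rw [hx.2]
    · exact ((hg.comp measurable_fst).mul (Complex.measurable_ofReal.comp hκ)).aestronglyMeasurable
  · filter_upwards [hW] with x hx
    rw [integral_const_mul, integral_complex_ofReal, hx.2]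

/-- The Laplace representation `g / A = ∫ g e^{-τA} dτ` is absolutely convergent. -/
lemma integrable_laplace {X : Type*} [MeasurableSpace X] {μ : Measure X} [SFinite μ]
    {g : X → ℂ} {A : X → ℝ} (hg : Measurable g) (hA : Measurable A) (hpos : ∀ᵐ x ∂μ, 0 < A x)
    (hi : Integrable (fun x => g x * ((1 / A x : ℝ) : ℂ)) μ) :
    Integrable (fun z : X × ℝ => g z.1 * ((exp (-(z.2 * A z.1)) : ℝ) : ℂ))
      (μ.prod (volume.restrict (Ioi 0))) ∧
    ∀ᵐ x ∂μ, ∫ τ in Ioi (0 : ℝ), g x * ((exp (-(τ * A x)) : ℝ) : ℂ) =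
      g x * ((1 / A x : ℝ) : ℂ) := by
  refine integrable_mixture (κ := fun z => exp (-(z.2 * A z.1))) hg (by fun_prop)
    (fun z => (exp_pos _).le) ?_ hi
  filter_upwards [hpos] with x hx
  have h1 : IntegrableOn (fun τ : ℝ => exp (-(τ * A x))) (Ioi 0) := by
    simpa [mul_comm] using exp_neg_integrableOn_Ioi 0 hx
  refine ⟨h1, ?_⟩
  have h := lintegral_exp_neg_mul hx
  rw [← ofReal_integral_eq_lintegral_ofReal h1 (Eventually.of_forall fun a => (exp_pos _).le)] at h
  rwa [ENNReal.ofReal_eq_ofReal_iff (integral_nonneg fun a => (exp_pos _).le) (by positivity)] at h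

/-- The product |φ(u)||φ(v)| is at most |φ(u)|² + |φ(v)|², and for each summand the Gaussian is
integrable in the other variable. -/
lemma integrable_mul_gaussian_sub {φ : E3 → ℂ} (hφ : Measurable φ)
    (hi : Integrable fun u => ‖φ u‖ ^ 2) {τ : ℝ} (hτ : 0 < τ) :
    Integrable (fun z : E3 × E3 => ‖φ z.1‖ * ‖φ z.2‖ * exp (-(τ * ‖z.1 - z.2‖ ^ 2))) := by
  have h1 : Integrable (fun z : E3 × E3 => ‖φ z.1‖ ^ 2 * exp (-(τ * ‖z.1 - z.2‖ ^ 2))) := by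
    have h := hi.mul_prod (integrable_exp_neg_mul_norm_sq hτ)
    have hmp : MeasurePreserving (fun z : E3 × E3 => (z.1, z.2 - z.1))
      ((volume : Measure E3).prod volume) ((volume : Measure E3).prod volume) := by
      convert measurePreserving_prod_neg_add (volume : Measure E3) (volume : Measure E3) using 3
      abel
    refine (hmp.integrable_comp_of_integrable h).congr (Eventually.of_forall fun z => ?_)
    simp only [Function.comp, norm_sub_rev z.2 z.1]
  have h2 : Integrable (fun z : E3 × E3 => ‖φ z.2‖ ^ 2 * exp (-(τ * ‖z.1 - z.2‖ ^ 2))) := by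
    refine h1.swap.congr (Eventually.of_forall fun z => ?_)
    simp only [Function.comp, Prod.fst_swap, Prod.snd_swap, norm_sub_rev z.2 z.1]
  refine (h1.add h2).mono' (by fun_prop) (Eventually.of_forall fun z => ?_)
  rw [Real.norm_of_nonneg (by positivity)]
  simp only [Pi.add_apply]
  rw [← add_mul]
  gcongr
  nlinarith [sq_nonneg (‖φ z.1‖ - ‖φ z.2‖), sq_nonneg (‖φ z.1‖), sq_nonneg (‖φ z.2‖)]

lemma integrable_mul_gaussian_add {φ : E3 → ℂ} (hφ : Measurable φ)
    (hi : Integrable fun u => ‖φ u‖ ^ 2) {τ : ℝ} (hτ : 0 < τ) :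
    Integrable (fun z : E3 × E3 => ‖φ z.1‖ * ‖φ z.2‖ * exp (-(τ * ‖z.1 + z.2‖ ^ 2))) := by
  have h1 : Integrable (fun z : E3 × E3 => ‖φ z.1‖ ^ 2 * exp (-(τ * ‖z.1 + z.2‖ ^ 2))) := by
    have h := hi.mul_prod (integrable_exp_neg_mul_norm_sq hτ)
    have hmp := measurePreserving_prod_add (volume : Measure E3) (volume : Measure E3)
    exact hmp.integrable_comp_of_integrable h
  have h2 : Integrable (fun z : E3 × E3 => ‖φ z.2‖ ^ 2 * exp (-(τ * ‖z.1 + z.2‖ ^ 2))) := by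
    refine h1.swap.congr (Eventually.of_forall fun z => ?_)
    simp only [Function.comp, Prod.fst_swap, Prod.snd_swap, add_comm z.2 z.1]
  refine (h1.add h2).mono' (by fun_prop) (Eventually.of_forall fun z => ?_)
  rw [Real.norm_of_nonneg (by positivity)]
  simp only [Pi.add_apply]
  rw [← add_mul]
  gcongr
  nlinarith [sq_nonneg (‖φ z.1‖ - ‖φ z.2‖), sq_nonneg (‖φ z.1‖), sq_nonneg (‖φ z.2‖)]

/-- Half of the Gaussian absorbs the power, by yᵏ/k! ≤ e^y at y = τx²/2. -/
lemma pow_mul_exp_neg_le {τ x : ℝ} (hτ : 0 < τ) (k : ℕ) :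
    x ^ k * exp (-(τ * x ^ 2)) ≤ (1 + (2 / τ) ^ k * k.factorial) * exp (-(τ / 2 * x ^ 2)) := by
  have h1 : (τ / 2 * x ^ 2) ^ k / k.factorial ≤ exp (τ / 2 * x ^ 2) :=
    Real.pow_div_factorial_le_exp _ (by positivity) k
  have h2 : x ^ k ≤ 1 + (x ^ 2) ^ k := by
    rw [← pow_mul, mul_comm, pow_mul]
    nlinarith [sq_nonneg (x ^ k - 1)]
  have h3 : (x ^ 2) ^ k ≤ (2 / τ) ^ k * k.factorial * exp (τ / 2 * x ^ 2) := by
    rw [div_le_iff₀ (by positivity)] at h1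
    calc (x ^ 2) ^ k = (2 / τ) ^ k * (τ / 2 * x ^ 2) ^ k := by
          rw [← mul_pow]; congr 1; field_simp
      _ ≤ (2 / τ) ^ k * (exp (τ / 2 * x ^ 2) * k.factorial) := by gcongr
      _ = _ := by ring
  have h4 : 1 ≤ exp (τ / 2 * x ^ 2) := one_le_exp (by positivity)
  have h5 : exp (-(τ / 2 * x ^ 2)) = exp (τ / 2 * x ^ 2) * exp (-(τ * x ^ 2)) := by
    rw [← exp_add]; congr 1; ring
  rw [h5, ← mul_assoc]
  gcongr
  linarith

lemma integrable_mul_pow_mul_exp {φ : E3 → ℂ} (hφ : Measurable φ)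
    (hi : Integrable fun u => ‖φ u‖ ^ 2) {τ : ℝ} (hτ : 0 < τ) (k : ℕ) :
    Integrable fun u : E3 => ‖φ u‖ * (‖u‖ ^ k * exp (-(τ * ‖u‖ ^ 2))) := by
  set C : ℝ := 1 + (2 / τ) ^ k * k.factorial
  have hC : 0 ≤ C := by positivity
  refine (hi.add ((integrable_exp_neg_mul_norm_sq hτ).const_mul (C ^ 2))).mono' (by fun_prop)
    (Eventually.of_forall fun u => ?_)
  rw [Real.norm_of_nonneg (by positivity)]
  have h := pow_mul_exp_neg_le (x := ‖u‖) hτ k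
  have h5 : exp (-(τ / 2 * ‖u‖ ^ 2)) ^ 2 = exp (-(τ * ‖u‖ ^ 2)) := by
    rw [sq, ← exp_add]; congr 1; ring
  simp only [Pi.add_apply]
  calc _ ≤ ‖φ u‖ * (C * exp (-(τ / 2 * ‖u‖ ^ 2))) := by gcongr
    _ ≤ ‖φ u‖ ^ 2 + (C * exp (-(τ / 2 * ‖u‖ ^ 2))) ^ 2 := by
      nlinarith [sq_nonneg (‖φ u‖ - C * exp (-(τ / 2 * ‖u‖ ^ 2))), sq_nonneg (‖φ u‖),
        sq_nonneg (C * exp (-(τ / 2 * ‖u‖ ^ 2)))]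
    _ = _ := by rw [mul_pow, h5]

/-- A sum of products f(u) f(v) with real f: this is what makes (u·v)ᵏ a positive definite kernel.
-/
lemma inner_E3_pow (u v : E3) (k : ℕ) :
    (inner ℝ u v : ℝ) ^ k = ∑ p : Fin k → Fin 3, (∏ j, u (p j)) * ∏ j, v (p j) := by
  have : (inner ℝ u v : ℝ) = ∑ i, u i * v i := by
    rw [PiLp.inner_apply]; simp [mul_comm]
  rw [this, Fintype.sum_pow]
  simp_rw [Finset.prod_mul_distrib]

/-- The kernel `(u · v)^k` with Gaussian cut-offs is positive definite. -/
lemma re_integral_inner_pow_nonneg {φ : E3 → ℂ} (hφ : Measurable φ)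
    (hi : Integrable fun u => ‖φ u‖ ^ 2) {τ : ℝ} (hτ : 0 < τ) (k : ℕ) :
    0 ≤ (∫ z : E3 × E3, (starRingEnd ℂ) (φ z.1) * φ z.2 *
      ((exp (-(τ * (‖z.1‖ ^ 2 + ‖z.2‖ ^ 2))) * (inner ℝ z.1 z.2 : ℝ) ^ k : ℝ) : ℂ)).re := by
  set h : (Fin k → Fin 3) → E3 → ℂ := fun p u =>
    φ u * (((∏ j, u (p j)) * exp (-(τ * ‖u‖ ^ 2)) : ℝ) : ℂ) with hh
  have hint : ∀ p, Integrable (h p) := by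
    intro p
    refine (integrable_mul_pow_mul_exp hφ hi hτ k).mono' ?_ (Eventually.of_forall fun u => ?_)
    · refine (hφ.mul (Complex.measurable_ofReal.comp ?_)).aestronglyMeasurable
      refine Measurable.mul ?_ (by fun_prop)
      exact Finset.measurable_fun_prod _ fun j _ => by fun_prop
    · simp only [hh, norm_mul, Complex.norm_real, Real.norm_eq_abs, abs_of_pos (exp_pos _)]
      gcongr
      rw [Finset.abs_prod]
      calc ∏ j, |u (p j)| ≤ ∏ _j : Fin k, ‖u‖ :=
            Finset.prod_le_prod (fun _ _ => abs_nonneg _) fun j _ => PiLp.norm_apply_le u (p j)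
        _ = ‖u‖ ^ k := by simp
  have heq : ∀ z : E3 × E3, (starRingEnd ℂ) (φ z.1) * φ z.2 *
      ((exp (-(τ * (‖z.1‖ ^ 2 + ‖z.2‖ ^ 2))) * (inner ℝ z.1 z.2 : ℝ) ^ k : ℝ) : ℂ) =
      ∑ p, (starRingEnd ℂ) (h p z.1) * h p z.2 := by
    intro z
    rw [inner_E3_pow, mul_add, neg_add, exp_add, Finset.mul_sum, Complex.ofReal_sum, Finset.mul_sum]
    refine Finset.sum_congr rfl fun p _ => ?_
    simp only [hh, map_mul, Complex.conj_ofReal]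
    push_cast
    ring
  simp_rw [heq]
  have hconj : ∀ p, Integrable fun u => (starRingEnd ℂ) (h p u) := fun p =>
    Complex.conjCLE.toContinuousLinearMap.integrable_comp (hint p)
  rw [Measure.volume_eq_prod, integral_finsetSum _ fun p _ => (hconj p).mul_prod (hint p),
    Complex.re_sum]
  refine Finset.sum_nonneg fun p _ => ?_
  -- Each term of the sum is |∫ h_p|².
  rw [integral_prod_mul (fun u => (starRingEnd ℂ) (h p u)) (h p),
    integral_conj, ← Complex.normSq_eq_conj_mul_self, Complex.ofReal_re]
  exact Complex.normSq_nonneg _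

lemma two_mul_abs_inner_le (u v : E3) : 2 * |(inner ℝ u v : ℝ)| ≤ ‖u‖ ^ 2 + ‖v‖ ^ 2 := by
  nlinarith [abs_real_inner_le_norm u v, sq_nonneg (‖u‖ - ‖v‖)]

/-- For |β| ≤ 1 the form u² + v² + β u·v is at least (u² + v²)/2, while |u - v|² ≤ 2(u² + v²). So
the off-diagonal kernels are dominated by the Kato kernel. -/
lemma norm_sub_sq_le_four_mul {β : ℝ} (hβ : |β| ≤ 1) (u v : E3) :
    ‖u - v‖ ^ 2 ≤ 4 * (‖u‖ ^ 2 + ‖v‖ ^ 2 + β * (inner ℝ u v : ℝ)) := by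
  have h1 := two_mul_abs_inner_le u v
  have h2 : |β * (inner ℝ u v : ℝ)| ≤ |(inner ℝ u v : ℝ)| := by
    rw [abs_mul]; nlinarith [abs_nonneg (inner ℝ u v : ℝ)]
  rw [norm_sub_sq_real]
  have h3 := neg_abs_le (β * (inner ℝ u v : ℝ))
  have h4 := neg_abs_le (inner ℝ u v : ℝ)
  linarith

lemma exp_hasSum (x : ℝ) : HasSum (fun k : ℕ => x ^ k / k.factorial) (exp x) := by
  rw [Real.exp_eq_exp_ℝ]; exact NormedSpace.expSeries_div_hasSum_exp x

/-- Positivity of a power series in `u · v` with Gaussian cut-offs. -/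
lemma re_integral_gaussian_nonneg {φ : E3 → ℂ} (hφ : Measurable φ)
    (hi : Integrable fun u => ‖φ u‖ ^ 2) {τ α c β : ℝ} (hτ : 0 < τ) (hβ : |β| ≤ 1)
    (hk : ∀ k : ℕ, 0 ≤ α * 2 ^ k + c * (-β) ^ k) :
    0 ≤ (∫ z : E3 × E3, (starRingEnd ℂ) (φ z.1) * φ z.2 *
      ((α * exp (-(τ * ‖z.1 - z.2‖ ^ 2)) +
        c * exp (-(τ * (‖z.1‖ ^ 2 + ‖z.2‖ ^ 2 + β * (inner ℝ z.1 z.2 : ℝ)))) : ℝ) : ℂ)).re := by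
  set E : E3 × E3 → ℝ := fun z => exp (-(τ * (‖z.1‖ ^ 2 + ‖z.2‖ ^ 2))) with hE
  set t : E3 × E3 → ℝ := fun z => inner ℝ z.1 z.2 with ht
  -- The coefficient of (u·v)ᵏ once e^{-τ(u² + v²)} is factored out: the two exponentials become
  -- e^{2τ u·v} and e^{-βτ u·v}.
  set d : ℕ → ℝ := fun k => τ ^ k / k.factorial * (α * 2 ^ k + c * (-β) ^ k) with hd
  set g : E3 × E3 → ℂ := fun z => (starRingEnd ℂ) (φ z.1) * φ z.2 with hg
  have hgm : Measurable g := by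
    have h1 : Measurable fun z : E3 × E3 => (starRingEnd ℂ) (φ z.1) :=
      Complex.continuous_conj.measurable.comp (by fun_prop)
    exact h1.mul (by fun_prop)
  have hgn : ∀ z, ‖g z‖ = ‖φ z.1‖ * ‖φ z.2‖ := fun z => by simp [hg]
  have htm : Measurable t := by simp only [ht]; fun_prop
  have hEm : Measurable E := by simp only [hE]; fun_prop
  set F : ℕ → E3 × E3 → ℂ := fun k z => (d k : ℂ) * (g z * ((E z * t z ^ k : ℝ) : ℂ)) with hF
  set bd : ℕ → E3 × E3 → ℝ := fun k z =>
    (|α| + |c|) * (‖g z‖ * E z) * ((2 * τ * |t z|) ^ k / k.factorial) with hbd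
  have hE0 : ∀ z, 0 < E z := fun z => exp_pos _
  have hbound : ∀ k z, ‖F k z‖ ≤ bd k z := by
    intro k z
    simp only [hF, hbd, norm_mul, Complex.norm_real, Real.norm_eq_abs, abs_pow,
      abs_of_pos (hE0 z), hd, abs_div, abs_of_pos hτ, Nat.abs_cast]
    have h1 : |α * 2 ^ k + c * (-β) ^ k| ≤ (|α| + |c|) * 2 ^ k := by
      refine (abs_add_le _ _).trans ?_
      rw [abs_mul, abs_mul, abs_pow, abs_pow, abs_neg, add_mul, abs_of_pos (two_pos (α := ℝ))]
      gcongr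
      linarith
    calc _ ≤ τ ^ k / k.factorial * ((|α| + |c|) * 2 ^ k) * (‖g z‖ * (E z * |t z| ^ k)) := by gcongr
      _ = _ := by rw [mul_pow, mul_pow]; ring
  have hbs : ∀ z, HasSum (fun k => bd k z) ((|α| + |c|) * (‖g z‖ * E z) * exp (2 * τ * |t z|)) :=
    fun z => (exp_hasSum _).mul_left _
  have hlim : ∀ z, HasSum (fun k => F k z) (g z *
      ((α * exp (-(τ * ‖z.1 - z.2‖ ^ 2)) +
        c * exp (-(τ * (‖z.1‖ ^ 2 + ‖z.2‖ ^ 2 + β * (inner ℝ z.1 z.2 : ℝ)))) : ℝ) : ℂ)) := by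
    intro z
    have h1 := ((exp_hasSum (2 * τ * t z)).mul_left α).add
      ((exp_hasSum (-β * τ * t z)).mul_left c)
    have h2 := (h1.mul_left (E z))
    have h3 := (Complex.hasSum_ofReal.2 h2).mul_left (g z)
    have e1 : exp (-(τ * ‖z.1 - z.2‖ ^ 2)) = E z * exp (2 * τ * t z) := by
      rw [hE, ← exp_add, norm_sub_sq_real]; congr 1; ring
    have e2 : exp (-(τ * (‖z.1‖ ^ 2 + ‖z.2‖ ^ 2 + β * (inner ℝ z.1 z.2 : ℝ)))) =
        E z * exp (-β * τ * t z) := by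
      rw [hE, ← exp_add]; congr 1; ring
    have e3 : α * (E z * exp (2 * τ * t z)) + c * (E z * exp (-β * τ * t z)) =
        E z * (α * exp (2 * τ * t z) + c * exp (-β * τ * t z)) := by ring
    rw [e1, e2, e3]
    refine h3.congr_fun ?_
    intro k
    simp only [hF, hd, mul_pow]
    push_cast
    ring
  -- The majorants sum to a multiple of ‖g‖ E e^{2τ|t|}, and e^{2τ|t|} ≤ e^{2τt} + e^{-2τt} leads
  -- back to the Gaussians in u - v and u + v.
  have hbi : Integrable fun z => ∑' k, bd k z := by
    simp_rw [fun z => (hbs z).tsum_eq]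
    refine (((integrable_mul_gaussian_sub hφ hi hτ).add
      (integrable_mul_gaussian_add hφ hi hτ)).const_mul (|α| + |c|)).mono'
      (by fun_prop) (Eventually.of_forall fun z => ?_)
    have := hE0 z
    rw [Real.norm_of_nonneg (by positivity), hgn, mul_assoc]
    simp only [Pi.add_apply]
    rw [← mul_add, mul_assoc (‖φ z.1‖ * ‖φ z.2‖)]
    gcongr
    have e1 : exp (-(τ * ‖z.1 - z.2‖ ^ 2)) = E z * exp (2 * τ * t z) := by
      rw [hE, ← exp_add, norm_sub_sq_real]; congr 1; ring
    have e2 : exp (-(τ * ‖z.1 + z.2‖ ^ 2)) = E z * exp (2 * τ * (-t z)) := by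
      rw [hE, ← exp_add, norm_add_sq_real]; congr 1; ring
    rw [e1, e2, ← mul_add]
    gcongr
    rcases abs_choice (t z) with h | h <;> rw [h]
    · linarith [exp_pos (2 * τ * (-t z))]
    · linarith [exp_pos (2 * τ * (t z))]
  have hsum := hasSum_integral_of_dominated_convergence (μ := volume) (F := F) bd
    (fun k => by
      refine Measurable.aestronglyMeasurable ?_
      exact (hgm.mul (Complex.measurable_ofReal.comp (hEm.mul (htm.pow_const k)))).const_mul _)
    (fun k => Eventually.of_forall (hbound k)) (Eventually.of_forall fun z => (hbs z).summable)
    hbi (Eventually.of_forall hlim)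
  refine (Complex.reCLM.hasSum hsum).nonneg fun k => ?_
  simp only [Complex.reCLM_apply, hF]
  rw [integral_const_mul, Complex.re_ofReal_mul]
  refine mul_nonneg ?_ (re_integral_inner_pow_nonneg hφ hi hτ k)
  exact mul_nonneg (by positivity) (hk k)

lemma ae_fst_ne_snd : ∀ᵐ z : E3 × E3, z.1 ≠ z.2 := by
  rw [Measure.volume_eq_prod, Measure.ae_prod_iff_ae_ae]
  · exact Eventually.of_forall fun u => (ae_ne_E3 u).mono fun v hv => hv.symm
  · exact (measurableSet_eq_fun measurable_fst measurable_snd).compl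

/-- Kernels `α / |u - v|² + d / (u² + v² + β u · v + m)`. -/
noncomputable def pairKernel (α d β m : ℝ) (z : E3 × E3) : ℝ :=
  α * (1 / ‖z.1 - z.2‖ ^ 2) +
    d * (1 / (‖z.1‖ ^ 2 + ‖z.2‖ ^ 2 + β * (inner ℝ z.1 z.2 : ℝ) + m))

lemma inv_le_four_mul_inv {β m : ℝ} (hβ : |β| ≤ 1) (hm : 0 ≤ m) {u v : E3} (huv : u ≠ v) :
    1 / (‖u‖ ^ 2 + ‖v‖ ^ 2 + β * (inner ℝ u v : ℝ) + m) ≤ 4 * (1 / ‖u - v‖ ^ 2) := by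
  have h := norm_sub_sq_le_four_mul hβ u v
  have h0 : 0 < ‖u - v‖ := norm_pos_iff.2 (sub_ne_zero.2 huv)
  rw [mul_one_div, div_le_div_iff₀ (by nlinarith) (by positivity)]
  linarith

lemma inv_pairKernel_nonneg {β m : ℝ} (hβ : |β| ≤ 1) (hm : 0 ≤ m) (u v : E3) :
    0 ≤ 1 / (‖u‖ ^ 2 + ‖v‖ ^ 2 + β * (inner ℝ u v : ℝ) + m) := by
  have h := norm_sub_sq_le_four_mul hβ u v
  have : 0 ≤ ‖u - v‖ ^ 2 := by positivity
  exact one_div_nonneg.2 (by linarith)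

/-- Both fractions are Laplace integrals over the same τ. For fixed τ the mass contributes only the
factor c = e^{-τm} ∈ (0, 1], which is why `hk` is required for all such c, and
`re_integral_gaussian_nonneg` applies. -/
lemma re_integral_pairKernel_nonneg {φ : E3 → ℂ} (hφ : Measurable φ)
    (hi : Integrable fun u => ‖φ u‖ ^ 2) (hi1 : Integrable fun u : E3 => ‖u‖ * ‖φ u‖ ^ 2)
    {α d β m : ℝ} (hm : 0 ≤ m) (hβ : |β| ≤ 1)
    (hk : ∀ c : ℝ, 0 < c → c ≤ 1 → ∀ k : ℕ, 0 ≤ α * 2 ^ k + d * c * (-β) ^ k) :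
    0 ≤ (∫ z : E3 × E3, (starRingEnd ℂ) (φ z.1) * φ z.2 * (pairKernel α d β m z : ℂ)).re := by
  set g : E3 × E3 → ℂ := fun z => (starRingEnd ℂ) (φ z.1) * φ z.2 with hg
  have hgm : Measurable g := by
    have h1 : Measurable fun z : E3 × E3 => (starRingEnd ℂ) (φ z.1) :=
      Complex.continuous_conj.measurable.comp (by fun_prop)
    exact h1.mul (by fun_prop)
  set A : E3 × E3 → ℝ := fun z => ‖z.1 - z.2‖ ^ 2 with hA
  set B : E3 × E3 → ℝ := fun z => ‖z.1‖ ^ 2 + ‖z.2‖ ^ 2 + β * (inner ℝ z.1 z.2 : ℝ) + m with hB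
  have hAm : Measurable A := by simp only [hA]; fun_prop
  have hBm : Measurable B := by simp only [hB]; fun_prop
  have hkA : Integrable (fun z => g z * ((1 / A z : ℝ) : ℂ)) := by
    have hk := lintegral_kato hφ hφ
    have hmA : Measurable fun z => g z * ((1 / A z : ℝ) : ℂ) :=
      hgm.mul (Complex.measurable_ofReal.comp (by fun_prop))
    refine ⟨hmA.aestronglyMeasurable, ?_⟩
    rw [HasFiniteIntegral, Measure.volume_eq_prod, lintegral_prod _ hmA.enorm.aemeasurable]
    refine lt_of_le_of_lt (le_trans (le_of_eq ?_) hk) ?_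
    · refine lintegral_congr fun u => lintegral_congr fun v => ?_
      rw [← ofReal_norm]
      congr 1
      simp only [hg, hA, norm_mul, RCLike.norm_conj, Complex.norm_real]
      rw [Real.norm_of_nonneg (by positivity)]
    · have := lintegral_ofReal_lt_top_of_integrable hi1
      exact ENNReal.mul_lt_top ENNReal.ofReal_lt_top (ENNReal.add_lt_top.2 ⟨this, this⟩)
  have hApos : ∀ᵐ z, 0 < A z := ae_fst_ne_snd.mono fun z hz => by
    have := norm_pos_iff.2 (sub_ne_zero.2 hz)
    simp only [hA]; positivity
  have hBpos : ∀ᵐ z, 0 < B z := hApos.mono fun z hz => by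
    have h := norm_sub_sq_le_four_mul hβ z.1 z.2
    simp only [hA] at hz
    simp only [hB]; linarith
  have hkB : Integrable (fun z => g z * ((1 / B z : ℝ) : ℂ)) := by
    refine (hkA.norm.const_mul 4).mono'
      ((hgm.mul (Complex.measurable_ofReal.comp (by fun_prop))).aestronglyMeasurable) ?_
    filter_upwards [hApos, hBpos, ae_fst_ne_snd] with z hz1 hz2 hz3
    rw [norm_mul (g z), norm_mul (g z), Complex.norm_real, Complex.norm_real,
      Real.norm_of_nonneg (by positivity), Real.norm_of_nonneg (by positivity)]
    have := inv_le_four_mul_inv hβ hm hz3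
    calc ‖g z‖ * (1 / B z) ≤ ‖g z‖ * (4 * (1 / A z)) := by gcongr
      _ = _ := by ring
  obtain ⟨hLA, hLA'⟩ := integrable_laplace hgm hAm hApos hkA
  obtain ⟨hLB, hLB'⟩ := integrable_laplace hgm hBm hBpos hkB
  have hsplit : ∀ z : E3 × E3, (starRingEnd ℂ) (φ z.1) * φ z.2 * (pairKernel α d β m z : ℂ) =
      α * (g z * ((1 / A z : ℝ) : ℂ)) + d * (g z * ((1 / B z : ℝ) : ℂ)) := by
    intro z
    simp only [pairKernel, hg, hA, hB]
    push_cast; ring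
  have hL : Integrable (fun z : (E3 × E3) × ℝ => (α : ℂ) * (g z.1 * ((exp (-(z.2 * A z.1)) : ℝ) : ℂ)) +
      d * (g z.1 * ((exp (-(z.2 * B z.1)) : ℝ) : ℂ)))
      (volume.prod (volume.restrict (Ioi 0))) := (hLA.const_mul (α : ℂ)).add (hLB.const_mul (d : ℂ))
  have hint : ∫ z : E3 × E3, (starRingEnd ℂ) (φ z.1) * φ z.2 * (pairKernel α d β m z : ℂ) =
      ∫ τ in Ioi (0 : ℝ), ∫ z : E3 × E3, ((α : ℂ) * (g z * ((exp (-(τ * A z)) : ℝ) : ℂ)) +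
      d * (g z * ((exp (-(τ * B z)) : ℝ) : ℂ))) := by
    rw [← integral_integral_swap (f := fun z τ => (α : ℂ) * (g z * ((exp (-(τ * A z)) : ℝ) : ℂ)) +
      d * (g z * ((exp (-(τ * B z)) : ℝ) : ℂ))) hL]
    apply integral_congr_ae
    filter_upwards [hLA', hLB', hLA.prod_right_ae, hLB.prod_right_ae] with z h1 h2 h3 h4
    rw [hsplit, integral_add (h3.const_mul _) (h4.const_mul _), integral_const_mul (α : ℂ),
      integral_const_mul (d : ℂ), h1, h2]
  have hre : Integrable (fun τ => ∫ z : E3 × E3, ((α : ℂ) * (g z * ((exp (-(τ * A z)) : ℝ) : ℂ)) +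
      d * (g z * ((exp (-(τ * B z)) : ℝ) : ℂ)))) (volume.restrict (Ioi 0)) := hL.integral_prod_right
  rw [hint, ← Complex.reCLM_apply, ← Complex.reCLM.integral_comp_comm hre]
  refine setIntegral_nonneg measurableSet_Ioi fun τ hτ => ?_
  have hτ : (0 : ℝ) < τ := hτ
  have hpos := re_integral_gaussian_nonneg hφ hi (α := α) (c := d * exp (-(τ * m))) hτ hβ
    (hk _ (exp_pos _) (exp_le_one_iff.2 (by have := mul_nonneg hτ.le hm; linarith)))
  rw [Complex.reCLM_apply]
  convert hpos using 4 with z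
  have : exp (-(τ * B z)) = exp (-(τ * m)) *
      exp (-(τ * (‖z.1‖ ^ 2 + ‖z.2‖ ^ 2 + β * (inner ℝ z.1 z.2 : ℝ)))) := by
    rw [← exp_add, hB]; congr 1; ring
  rw [this]
  simp only [hA, hg]
  push_cast
  ring

section Fibred

variable {Y : Type*} [MeasurableSpace Y] {ν : Measure Y} [SFinite ν]

/-- Bounds and measurability of the kernel along a fibration. -/
lemma measurable_pairKernel {m : Y → ℝ} (hm : Measurable m) (α d β : ℝ) :
    Measurable fun z : Y × (E3 × E3) => pairKernel α d β (m z.1) z.2 := by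
  unfold pairKernel; fun_prop

lemma abs_pairKernel_le {α d β m : ℝ} (hβ : |β| ≤ 1) (hm : 0 ≤ m) (z : E3 × E3) :
    |pairKernel α d β m z| ≤ (|α| + 4 * |d|) * (1 / ‖z.1 - z.2‖ ^ 2) ∨ z.1 = z.2 := by
  by_cases hz : z.1 = z.2
  · exact Or.inr hz
  left
  have h1 := inv_le_four_mul_inv hβ hm hz
  have h2 := inv_pairKernel_nonneg hβ hm z.1 z.2
  unfold pairKernel
  refine (abs_add_le _ _).trans ?_
  rw [abs_mul, abs_mul, abs_of_nonneg h2, abs_of_nonneg (show 0 ≤ 1 / ‖z.1 - z.2‖ ^ 2 by positivity)]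
  nlinarith [abs_nonneg d]

theorem re_integral_pairKernel_fibred_nonneg {a : Y × E3 → ℂ} (ha : Measurable a)
    (hi : Integrable (fun z => ‖a z‖ ^ 2) (ν.prod volume))
    (hi1 : Integrable (fun z : Y × E3 => ‖z.2‖ * ‖a z‖ ^ 2) (ν.prod volume))
    {α d β : ℝ} {m : Y → ℝ} (hmm : Measurable m) (hm : ∀ y, 0 ≤ m y) (hβ : |β| ≤ 1)
    (hk : ∀ c : ℝ, 0 < c → c ≤ 1 → ∀ k : ℕ, 0 ≤ α * 2 ^ k + d * c * (-β) ^ k) :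
    0 ≤ (∫ z : Y × (E3 × E3), (starRingEnd ℂ) (a (z.1, z.2.1)) * a (z.1, z.2.2) *
      (pairKernel α d β (m z.1) z.2 : ℂ) ∂ν.prod volume).re := by
  have hint := (integrable_kato_fibred ha ha (measurable_pairKernel hmm α d β) (C := |α| + 4 * |d|)
    (by positivity) (fun z => abs_pairKernel_le hβ (hm z.1) z.2) hi1 hi1).1
  rw [integral_prod _ hint, ← Complex.reCLM_apply, ← Complex.reCLM.integral_comp_comm hint.integral_prod_left]
  apply integral_nonneg_of_ae
  filter_upwards [hi.prod_right_ae, hi1.prod_right_ae] with y h1 h2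
  exact re_integral_pairKernel_nonneg (φ := fun u => a (y, u)) (by fun_prop) h1 h2 (hm y) hβ hk

end Fibred

/-! ### The Fourier transform on L²: translations, autocorrelation, Sobolev spaces -/

section General

variable {V : Type*} [NormedAddCommGroup V] [InnerProductSpace ℝ V] [FiniteDimensional ℝ V]
  [MeasurableSpace V] [BorelSpace V]

lemma integral_conj_mul_eq_inner {X : Type*} [MeasurableSpace X] {μ : Measure X} (F G : Lp ℂ 2 μ) :
    ∫ x, (starRingEnd ℂ) (F x) * G x ∂μ = inner ℂ F G := by
  rw [L2.inner_def]
  refine integral_congr_ae (Eventually.of_forall fun x => ?_)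
  simp [mul_comm]

lemma integrable_norm_sq_Lp {X : Type*} [MeasurableSpace X] {μ : Measure X} (F : Lp ℂ 2 μ) :
    Integrable (fun x => ‖F x‖ ^ 2) μ :=
  (memLp_two_iff_integrable_sq_norm (Lp.aestronglyMeasurable F)).1 (Lp.memLp F)

lemma integral_norm_sq_Lp {X : Type*} [MeasurableSpace X] {μ : Measure X} (F : Lp ℂ 2 μ) :
    ∫ x, ‖F x‖ ^ 2 ∂μ = ‖F‖ ^ 2 := by
  have h := integral_conj_mul_eq_inner F F
  rw [inner_self_eq_norm_sq_to_K] at h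
  have h2 : ∫ x, (starRingEnd ℂ) (F x) * F x ∂μ = ∫ x, ((‖F x‖ ^ 2 : ℝ) : ℂ) ∂μ := by
    refine integral_congr_ae (Eventually.of_forall fun x => ?_)
    simp only
    rw [mul_comm, Complex.mul_conj, Complex.normSq_eq_norm_sq]
  rw [h2, integral_complex_ofReal] at h
  exact Complex.ofReal_injective (h.trans (by norm_num))

/-- The character `x ↦ e^{2πi⟨x, h⟩}`. -/
noncomputable def charFn (h : V) (x : V) : ℂ := Complex.exp (((2 * π * inner ℝ x h : ℝ) : ℂ) * Complex.I)

omit [FiniteDimensional ℝ V] [MeasurableSpace V] [BorelSpace V] in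
lemma norm_charFn (h x : V) : ‖charFn h x‖ = 1 := Complex.norm_exp_ofReal_mul_I _

lemma memLp_charFn (h : V) : MemLp (charFn h) ⊤ (volume : Measure V) := by
  refine memLp_top_of_bound ?_ 1 (Eventually.of_forall fun x => (norm_charFn h x).le)
  refine Measurable.aestronglyMeasurable ?_
  unfold charFn
  exact Complex.measurable_exp.comp ((Complex.measurable_ofReal.comp (by fun_prop)).mul_const _)

/-- Translations of `L²` functions. -/
noncomputable def translateLp (h : V) : Lp ℂ 2 (volume : Measure V) →ₗᵢ[ℂ] Lp ℂ 2 (volume : Measure V) :=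
  Lp.compMeasurePreservingₗᵢ ℂ (fun x => x - h) (measurePreserving_sub_right volume h)

lemma coeFn_translateLp (h : V) (F : Lp ℂ 2 (volume : Measure V)) :
    translateLp h F =ᵐ[volume] fun x => F (x - h) :=
  Lp.coeFn_compMeasurePreserving F (measurePreserving_sub_right volume h)

lemma continuous_charFn_smul (h : V) :
    Continuous fun F : Lp ℂ 2 (volume : Measure V) =>
      ((memLp_charFn h).toLp _ • F : Lp ℂ 2 (volume : Measure V)) := by
  let L : Lp ℂ 2 (volume : Measure V) →+ Lp ℂ 2 (volume : Measure V) :=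
    { toFun := fun F => (memLp_charFn h).toLp _ • F
      map_zero' := Lp.smul_zero _ _ _
      map_add' := fun F G => Lp.add_smul _ _ _ }
  exact AddMonoidHomClass.continuous_of_bound L ‖(memLp_charFn h).toLp (charFn h)‖
    fun F => Lp.norm_smul_le _ _

lemma fourierInv_schwartz_translate (h : V) (φ : 𝓢(V, ℂ)) (x : V) :
    𝓕⁻ (φ.compSubConstCLM ℂ h) x = charFn h x * 𝓕⁻ φ x := by
  rw [SchwartzMap.fourierInv_coe, SchwartzMap.fourierInv_coe, Real.fourierInv_eq', Real.fourierInv_eq',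
    ← integral_const_mul, ← integral_add_right_eq_self _ h]
  refine integral_congr_ae (Eventually.of_forall fun v => ?_)
  simp only [SchwartzMap.compSubConstCLM_apply, add_sub_cancel_right, charFn, smul_eq_mul]
  rw [← mul_assoc, ← Complex.exp_add, inner_add_left, real_inner_comm h x]
  congr 2
  push_cast; ring

/-- Translation in momentum space is multiplication by a character in position space. -/
theorem fourierInv_translateLp (h : V) (F : Lp ℂ 2 (volume : Measure V)) :
    𝓕⁻ (translateLp h F) = ((memLp_charFn h).toLp _ • (𝓕⁻ F : Lp ℂ 2 (volume : Measure V)) :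
      Lp ℂ 2 (volume : Measure V)) := by
  refine DenseRange.induction_on (p := fun F => 𝓕⁻ (translateLp h F) =
      ((memLp_charFn h).toLp _ • (𝓕⁻ F : Lp ℂ 2 (volume : Measure V)) : Lp ℂ 2 (volume : Measure V)))
    (SchwartzMap.denseRange_toLpCLM (p := 2) ENNReal.ofNat_ne_top) F ?_ ?_
  · apply isClosed_eq
    · exact (FourierTransform.fourierInvCLM ℂ (Lp ℂ 2 (volume : Measure V))).continuous.comp (translateLp h).continuous
    · exact (continuous_charFn_smul h).comp (FourierTransform.fourierInvCLM ℂ (Lp ℂ 2 (volume : Measure V))).continuous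
  · intro φ
    rw [SchwartzMap.toLpCLM_apply]
    have h1 : translateLp h (φ.toLp 2) = (φ.compSubConstCLM ℂ h).toLp 2 := by
      refine Lp.ext ?_
      have h2 := (measurePreserving_sub_right volume h).quasiMeasurePreserving.ae_eq_comp
        (φ.coeFn_toLp 2 volume)
      filter_upwards [coeFn_translateLp h (φ.toLp 2), h2,
        (φ.compSubConstCLM ℂ h).coeFn_toLp 2 volume] with x e1 e2 e3
      rw [e1, e3]
      simpa using e2
    rw [h1, SchwartzMap.toLp_fourierInv_eq, SchwartzMap.toLp_fourierInv_eq]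
    refine Lp.ext ?_
    filter_upwards [(𝓕⁻ (φ.compSubConstCLM ℂ h)).coeFn_toLp 2 volume, (𝓕⁻ φ).coeFn_toLp 2 volume,
      Lp.coeFn_lpSMul (r := 2) ((memLp_charFn h).toLp _) ((𝓕⁻ φ).toLp 2 volume),
      (memLp_charFn h).coeFn_toLp] with x e1 e2 e3 e4
    rw [e1, e3, fourierInv_schwartz_translate]
    simp [e2, e4]

/-- The autocorrelation of the Fourier transform is the Fourier transform of `|ξ|²`. -/
theorem integral_conj_fourier_mul_translate (ξ : Lp ℂ 2 (volume : Measure V)) (h : V) :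
    ∫ p, (starRingEnd ℂ) ((𝓕 ξ : Lp ℂ 2 (volume : Measure V)) p) * (𝓕 ξ : Lp ℂ 2 (volume : Measure V)) (p - h) =
      ∫ x, charFn h x * ((‖ξ x‖ ^ 2 : ℝ) : ℂ) := by
  set G : Lp ℂ 2 (volume : Measure V) := 𝓕 ξ with hG
  have h1 : ∫ p, (starRingEnd ℂ) (G p) * G (p - h) = inner ℂ G (translateLp h G) := by
    rw [← integral_conj_mul_eq_inner]
    refine integral_congr_ae ?_
    filter_upwards [coeFn_translateLp h G] with p hp
    rw [hp]
  have h2 : (inner ℂ (𝓕⁻ G : Lp ℂ 2 (volume : Measure V)) (𝓕⁻ (translateLp h G) : Lp ℂ 2 (volume : Measure V)) : ℂ) =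
      inner ℂ G (translateLp h G) :=
    (Lp.fourierTransformₗᵢ V ℂ).symm.inner_map_map _ _
  have h3 : (𝓕⁻ G : Lp ℂ 2 (volume : Measure V)) = ξ := FourierTransform.fourierInv_fourier_eq ξ
  rw [h1, ← h2, fourierInv_translateLp, h3, ← integral_conj_mul_eq_inner]
  refine integral_congr_ae ?_
  filter_upwards [Lp.coeFn_lpSMul (r := 2) ((memLp_charFn h).toLp _) ξ, (memLp_charFn h).coeFn_toLp] with x e3 e4
  rw [e3]
  simp only [Pi.smul_apply', e4, smul_eq_mul]
  rw [mul_left_comm, mul_comm _ (ξ x), Complex.mul_conj, Complex.normSq_eq_norm_sq]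

/-- `H^{s}` for `p = 2` in terms of the `L²` Fourier transform. -/
theorem memSobolev_iff_memLp_fourier {s : ℝ} (hs : 0 ≤ s) (ξ : Lp ℂ 2 (volume : Measure V)) :
    TemperedDistribution.MemSobolev s 2 (Lp.toTemperedDistribution ξ) ↔
      MemLp (fun p => (((1 + ‖p‖ ^ 2) ^ (s / 2) : ℝ) : ℂ) * (𝓕 ξ : Lp ℂ 2 (volume : Measure V)) p) 2 := by
  rw [TemperedDistribution.memSobolev_iff_exists_smulLeftCLM_fourier,
    Lp.fourier_toTemperedDistribution_eq]
  set G : Lp ℂ 2 (volume : Measure V) := 𝓕 ξ with hG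
  have hw : Function.HasTemperateGrowth (fun x : V => (((1 + ‖x‖ ^ 2) ^ (s / 2) : ℝ) : ℂ)) := by fun_prop
  constructor
  · rintro ⟨f', hf'⟩
    -- The inverse weight is bounded because s ≥ 0, so g f' is in L²; injectivity of the embedding
    -- of L² into the distributions then identifies it with G.
    set g : V → ℂ := fun x => (((1 + ‖x‖ ^ 2) ^ (-s / 2) : ℝ) : ℂ) with hg
    have hgt : Function.HasTemperateGrowth g := by simp only [hg]; fun_prop
    have hgm : MemLp g ⊤ (volume : Measure V) := by
      refine memLp_top_of_bound hgt.1.continuous.aestronglyMeasurable 1 (Eventually.of_forall fun x => ?_)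
      rw [Complex.norm_real, Real.norm_of_nonneg (by positivity)]
      exact Real.rpow_le_one_of_one_le_of_nonpos (by nlinarith [sq_nonneg ‖x‖]) (by linarith)
    have h1 : Lp.toTemperedDistribution G =
        Lp.toTemperedDistribution (hgm.toLp _ • f' : Lp ℂ 2 (volume : Measure V)) := by
      rw [Lp.toTemperedDistribution_smul_eq hgt hgm, ← hf',
        TemperedDistribution.smulLeftCLM_smulLeftCLM_apply hw hgt]
      have : ((fun x : V => (((1 + ‖x‖ ^ 2) ^ (s / 2) : ℝ) : ℂ)) * g) = fun _ => (1 : ℂ) := by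
        funext x
        simp only [hg, Pi.mul_apply]
        rw [← Complex.ofReal_mul, ← Real.rpow_add (by positivity)]
        ring_nf
        simp
      rw [this, TemperedDistribution.smulLeftCLM_const, one_smul]
    have h2 : G = (hgm.toLp _ • f' : Lp ℂ 2 (volume : Measure V)) := by
      have h3 := LinearMap.ker_eq_bot.1 (Lp.ker_toTemperedDistributionCLM_eq_bot (F := ℂ)
        (μ := (volume : Measure V)) (p := 2))
      exact h3 h1
    refine (memLp_congr_ae ?_).2 (Lp.memLp f')
    rw [h2]
    filter_upwards [Lp.coeFn_lpSMul (r := 2) (hgm.toLp _) f', hgm.coeFn_toLp] with x e1 e2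
    rw [e1, Pi.smul_apply', e2]
    simp only [smul_eq_mul, hg]
    rw [← mul_assoc, ← Complex.ofReal_mul, ← Real.rpow_add (by positivity)]
    ring_nf
    simp
  · intro hm
    refine ⟨hm.toLp _, ?_⟩
    ext u
    rw [TemperedDistribution.smulLeftCLM_apply_apply, Lp.toTemperedDistribution_apply,
      Lp.toTemperedDistribution_apply]
    refine integral_congr_ae ?_
    filter_upwards [hm.coeFn_toLp] with x hx
    rw [hx, SchwartzMap.smulLeftCLM_apply_apply hw]
    simp only [smul_eq_mul]
    ring

end General

/-! Properties of the unitary Fourier transform -/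

lemma finrank_Config (n : ℕ) : Module.finrank ℝ (Config n) = 3 * (n + 2) := by
  rw [(WithLp.linearEquiv 2 ℝ (Fin (n + 2) → E3)).finrank_eq, Module.finrank_pi_fintype]
  simp [mul_comm]

/-- The normalization constant of the unitary Fourier transform. -/
noncomputable def hatConst (n : ℕ) : ℝ := (2 * π) ^ (-(3 * ((n : ℝ) + 2) / 2))

/-- The square of the constant cancels the Jacobian of p ↦ p/(2π) in dimension 3(n + 2); this makes
`hat` unitary. -/
lemma hatConst_sq (n : ℕ) : hatConst n ^ 2 * (2 * π) ^ (3 * (n + 2)) = 1 := by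
  unfold hatConst
  rw [← rpow_natCast, ← rpow_natCast, ← rpow_mul (by positivity), ← rpow_add (by positivity)]
  push_cast
  ring_nf
  simp

variable {n : ℕ}

lemma hat_eq (ξ : L2 n) (p : Config n) :
    hat ξ p = (hatConst n : ℂ) * ((𝓕 ξ : L2 n) : Config n → ℂ) ((2 * π)⁻¹ • p) := rfl

lemma measurable_hat (ξ : L2 n) : Measurable (hat ξ) := by
  have h : Measurable ((𝓕 ξ : L2 n) : Config n → ℂ) := (Lp.stronglyMeasurable _).measurable
  exact (h.comp (measurable_const_smul _)).const_mul _

lemma quasi_smul_Config : Measure.QuasiMeasurePreserving (fun p : Config n => (2 * π)⁻¹ • p)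
    volume volume := by
  refine ⟨measurable_const_smul _, ?_⟩
  rw [Measure.map_addHaar_smul _ (by positivity)]
  exact Measure.smul_absolutelyContinuous

lemma hat_add (ξ η : L2 n) : hat (ξ + η) =ᵐ[volume] fun p => hat ξ p + hat η p := by
  have h := quasi_smul_Config.ae_eq_comp (Lp.coeFn_add (𝓕 ξ : L2 n) (𝓕 η : L2 n))
  have h2 : (𝓕 (ξ + η) : L2 n) = 𝓕 ξ + 𝓕 η := (Lp.fourierTransformₗᵢ (Config n) ℂ).map_add ξ η
  filter_upwards [h] with p hp
  simp only [Function.comp, Pi.add_apply] at hp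
  rw [hat_eq, hat_eq, hat_eq, h2, hp, mul_add]

lemma hat_smul (c : ℂ) (ξ : L2 n) : hat (c • ξ) =ᵐ[volume] fun p => c * hat ξ p := by
  have h := quasi_smul_Config.ae_eq_comp (Lp.coeFn_smul c (𝓕 ξ : L2 n))
  have h2 : (𝓕 (c • ξ) : L2 n) = c • 𝓕 ξ := (Lp.fourierTransformₗᵢ (Config n) ℂ).map_smul c ξ
  filter_upwards [h] with p hp
  simp only [Function.comp, Pi.smul_apply, smul_eq_mul] at hp
  rw [hat_eq, hat_eq, h2, hp]; ring

lemma integral_comp_rescale {F : Type*} [NormedAddCommGroup F] [NormedSpace ℝ F] (f : Config n → F) :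
    ∫ p, hatConst n ^ 2 • f ((2 * π)⁻¹ • p) = ∫ p, f p := by
  rw [integral_smul, Measure.integral_comp_inv_smul, smul_smul, finrank_Config,
    abs_of_pos (by positivity), hatConst_sq, one_smul]

lemma integrable_norm_sq_hat (ξ : L2 n) : Integrable fun p => ‖hat ξ p‖ ^ 2 := by
  have h := ((integrable_norm_sq_Lp (𝓕 ξ : L2 n)).comp_smul (R := (2 * π)⁻¹) (by positivity)).const_mul (hatConst n ^ 2)
  refine h.congr (Eventually.of_forall fun p => ?_)
  simp only [hat_eq, norm_mul, mul_pow, Complex.norm_real, Real.norm_eq_abs, sq_abs]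

/-- Plancherel's theorem. -/
lemma integral_norm_sq_hat (ξ : L2 n) : ∫ p, ‖hat ξ p‖ ^ 2 = ‖ξ‖ ^ 2 := by
  have h : ‖(𝓕 ξ : L2 n)‖ = ‖ξ‖ := (Lp.fourierTransformₗᵢ (Config n) ℂ).norm_map ξ
  rw [← h, ← integral_norm_sq_Lp, ← integral_comp_rescale (fun p => ‖(𝓕 ξ : L2 n) p‖ ^ 2)]
  refine integral_congr_ae (Eventually.of_forall fun p => ?_)
  simp only [hat_eq, norm_mul, mul_pow, Complex.norm_real, Real.norm_eq_abs, sq_abs, smul_eq_mul]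

theorem integral_conj_hat_mul_translate (ξ : L2 n) (h : Config n) :
    ∫ p, (starRingEnd ℂ) (hat ξ p) * hat ξ (p - h) =
      ∫ x, Complex.exp (((inner ℝ x h : ℝ) : ℂ) * Complex.I) * ((‖ξ x‖ ^ 2 : ℝ) : ℂ) := by
  have h1 := integral_conj_fourier_mul_translate ξ ((2 * π)⁻¹ • h)
  have h2 : ∀ x, charFn ((2 * π)⁻¹ • h) x = Complex.exp (((inner ℝ x h : ℝ) : ℂ) * Complex.I) := by
    intro x
    unfold charFn
    rw [inner_smul_right, ← mul_assoc, mul_inv_cancel₀ (by positivity), one_mul]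
  simp_rw [h2] at h1
  rw [← h1, ← integral_comp_rescale (fun p => (starRingEnd ℂ) ((𝓕 ξ : L2 n) p) *
    (𝓕 ξ : L2 n) (p - (2 * π)⁻¹ • h))]
  refine integral_congr_ae (Eventually.of_forall fun p => ?_)
  simp only [hat_eq, map_mul, Complex.conj_ofReal, smul_sub, Complex.real_smul]
  push_cast
  ring

/-- The distributional definition weighs the frequency p/(2π) instead of the momentum p; the two
weights are comparable up to the factor 2π. -/
lemma mem_formDomain_iff (ξ : chargeSpace n) :
    ξ ∈ formDomain n ↔ Integrable fun p => √(1 + ‖p‖ ^ 2) * ‖hat (ξ : L2 n) p‖ ^ 2 := by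
  have h0 : ξ ∈ formDomain n ↔
    TemperedDistribution.MemSobolev (1 / 2) 2 (Lp.toTemperedDistribution (ξ : L2 n)) := Iff.rfl
  set G : Config n → ℂ := ((𝓕 (ξ : L2 n) : L2 n) : Config n → ℂ) with hG
  have hGm : Measurable G := (Lp.stronglyMeasurable _).measurable
  have hm : Measurable fun p : Config n => (((1 + ‖p‖ ^ 2) ^ ((1 / 2 : ℝ) / 2) : ℝ) : ℂ) * G p :=
    (Complex.measurable_ofReal.comp (by fun_prop)).mul hGm
  rw [h0, memSobolev_iff_memLp_fourier (by norm_num),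
    memLp_two_iff_integrable_sq_norm hm.aestronglyMeasurable]
  have h1 : ∀ p : Config n, ‖(((1 + ‖p‖ ^ 2) ^ ((1 / 2 : ℝ) / 2) : ℝ) : ℂ) * G p‖ ^ 2 =
      √(1 + ‖p‖ ^ 2) * ‖G p‖ ^ 2 := by
    intro p
    rw [norm_mul, mul_pow, Complex.norm_real, Real.norm_of_nonneg (by positivity), sqrt_eq_rpow,
      ← rpow_natCast, ← rpow_mul (by positivity)]
    norm_num
  simp_rw [h1]
  have h2 : (Integrable fun p : Config n => √(1 + ‖p‖ ^ 2) * ‖hat (ξ : L2 n) p‖ ^ 2) ↔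
      Integrable fun p : Config n => √(1 + ‖p‖ ^ 2) * ‖G ((2 * π)⁻¹ • p)‖ ^ 2 := by
    have hc : hatConst n ^ 2 ≠ 0 := by unfold hatConst; positivity
    rw [← integrable_const_mul_iff (c := hatConst n ^ 2) hc.isUnit (fun p : Config n => √(1 + ‖p‖ ^ 2) * ‖G ((2 * π)⁻¹ • p)‖ ^ 2)]
    refine integrable_congr (Eventually.of_forall fun p => ?_)
    simp only [hat_eq, norm_mul, mul_pow, Complex.norm_real, Real.norm_eq_abs, sq_abs]
    rw [← hG]; ring
  rw [h2, ← integrable_comp_smul_iff volume (fun p : Config n => √(1 + ‖p‖ ^ 2) * ‖G p‖ ^ 2)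
    (R := (2 * π)⁻¹) (by positivity)]
  have hpi : 1 ≤ 2 * π := by linarith [pi_gt_three]
  have hGs : Measurable fun p : Config n => G ((2 * π)⁻¹ • p) := hGm.comp (measurable_const_smul _)
  have hs : Measurable fun p : Config n => √(1 + ‖p‖ ^ 2) := by fun_prop
  have hs' : Measurable fun p : Config n => √(1 + ‖(2 * π)⁻¹ • p‖ ^ 2) :=
    hs.comp (measurable_const_smul _)
  have hn : ∀ p : Config n, ‖(2 * π)⁻¹ • p‖ = (2 * π)⁻¹ * ‖p‖ := fun p => by
    rw [norm_smul, Real.norm_of_nonneg (by positivity)]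
  constructor
  · intro h
    refine (h.const_mul (2 * π)).mono' (hs.mul (hGs.norm.pow_const 2)).aestronglyMeasurable
      (Eventually.of_forall fun p => ?_)
    rw [Real.norm_of_nonneg (by positivity), ← mul_assoc]
    refine mul_le_mul_of_nonneg_right ?_ (by positivity)
    rw [sqrt_le_left (by positivity), mul_pow, sq_sqrt (by positivity), hn, mul_add, ← mul_pow,
      ← mul_assoc, mul_inv_cancel₀ (by positivity), one_mul]
    nlinarith
  · intro h
    refine h.mono' (hs'.mul (hGs.norm.pow_const 2)).aestronglyMeasurable
      (Eventually.of_forall fun p => ?_)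
    rw [Real.norm_of_nonneg (by positivity)]
    refine mul_le_mul_of_nonneg_right (sqrt_le_sqrt ?_) (by positivity)
    have := mul_le_of_le_one_left (norm_nonneg p) (inv_le_one_of_one_le₀ hpi)
    rw [hn]
    gcongr

/-! ### Measure-preserving changes of the momenta -/

/-- The product measure and the Euclidean volume are Haar measures, hence proportional. The factor
is 1 because e^{-|x|²} has the integral π^{3k/2} for both. -/
lemma measurePreserving_toLp (k : ℕ) :
    MeasurePreserving (WithLp.toLp 2 : (Fin k → E3) → PiLp 2 (fun _ : Fin k => E3)) := by
  let e : (Fin k → E3) ≃L[ℝ] PiLp 2 (fun _ : Fin k => E3) :=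
    (PiLp.continuousLinearEquiv 2 ℝ (fun _ : Fin k => E3)).symm
  have he : Measurable (WithLp.toLp 2 : (Fin k → E3) → PiLp 2 (fun _ : Fin k => E3)) :=
    e.continuous.measurable
  refine ⟨he, ?_⟩
  set μ := Measure.map (WithLp.toLp 2 : (Fin k → E3) → PiLp 2 (fun _ : Fin k => E3)) volume with hμ
  have : μ.IsAddHaarMeasure := e.isAddHaarMeasure_map volume
  have h1 := Measure.isAddLeftInvariant_eq_smul μ (volume : Measure (PiLp 2 (fun _ : Fin k => E3)))
  have hG : ∫ x : PiLp 2 (fun _ : Fin k => E3), exp (-(1 * ‖x‖ ^ 2)) = (π / 1) ^ ((3 * k : ℕ) / 2 : ℝ) := by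
    have h := GaussianFourier.integral_rexp_neg_mul_sq_norm (V := PiLp 2 (fun _ : Fin k => E3)) one_pos
    have hf : Module.finrank ℝ (PiLp 2 (fun _ : Fin k => E3)) = 3 * k := by
      rw [(WithLp.linearEquiv 2 ℝ (Fin k → E3)).finrank_eq, Module.finrank_pi_fintype]
      simp [mul_comm]
    rw [hf] at h
    simpa only [neg_mul] using h
  have hE : ∫ x : E3, exp (-(1 * ‖x‖ ^ 2)) = (π / 1) ^ (3 / 2 : ℝ) := by
    have h := GaussianFourier.integral_rexp_neg_mul_sq_norm (V := E3) one_pos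
    simpa using h
  have h2 : ∫ x, exp (-(1 * ‖x‖ ^ 2)) ∂μ = (π / 1) ^ ((3 * k : ℕ) / 2 : ℝ) := by
    rw [hμ, integral_map he.aemeasurable (Continuous.aestronglyMeasurable (by fun_prop))]
    have : ∀ x : Fin k → E3, exp (-(1 * ‖(WithLp.toLp 2 x : PiLp 2 (fun _ : Fin k => E3))‖ ^ 2)) =
        ∏ i, exp (-(1 * ‖x i‖ ^ 2)) := by
      intro x
      rw [← exp_sum, PiLp.norm_sq_eq_of_L2, Finset.sum_neg_distrib, ← Finset.mul_sum]
    simp_rw [this]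
    rw [integral_fintype_prod_volume_eq_prod (fun (_ : Fin k) (x : E3) => exp (-(1 * ‖x‖ ^ 2)))]
    simp only [hE, Finset.prod_const, Finset.card_univ, Fintype.card_fin]
    rw [← rpow_natCast, ← rpow_mul (by positivity)]
    congr 1
    push_cast; ring
  have h3 : Measure.addHaarScalarFactor μ (volume : Measure (PiLp 2 (fun _ : Fin k => E3))) = 1 := by
    rw [h1, integral_smul_nnreal_measure, hG] at h2
    have hpos : 0 < (π / 1) ^ ((3 * k : ℕ) / 2 : ℝ) := by positivity
    have h4 := mul_right_cancel₀ hpos.ne' ((show _ = _ from h2).trans (one_mul _).symm)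
    exact_mod_cast h4
  rw [h1, h3, one_smul]

lemma measurePreserving_cons (k : ℕ) :
    MeasurePreserving (fun z : E3 × (Fin k → E3) => (Fin.cons z.1 z.2 : Fin (k + 1) → E3)) := by
  have h := (volume_preserving_piFinSuccAbove (fun _ : Fin (k + 1) => E3) 0).symm
  refine (congrArg (fun f => MeasurePreserving f volume volume) ?_).mp h
  funext z
  exact Fin.insertNth_zero' z.1 z.2

section Reorder

variable {X Y Z : Type*} [MeasurableSpace X] [MeasurableSpace Y] [MeasurableSpace Z]
  {μ : Measure X} {ν : Measure Y} {ρ : Measure Z} [SFinite ν] [SFinite ρ]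

lemma measurePreserving_assoc :
    MeasurePreserving (fun z : (X × Y) × Z => (z.1.1, z.1.2, z.2)) ((μ.prod ν).prod ρ)
      (μ.prod (ν.prod ρ)) := measurePreserving_prodAssoc μ ν ρ

lemma measurePreserving_assoc_symm :
    MeasurePreserving (fun z : X × Y × Z => ((z.1, z.2.1), z.2.2)) (μ.prod (ν.prod ρ))
      ((μ.prod ν).prod ρ) := (measurePreserving_prodAssoc μ ν ρ).symm

lemma measurePreserving_right_comm [SFinite μ] :
    MeasurePreserving (fun z : (X × Y) × Z => ((z.1.1, z.2), z.1.2)) ((μ.prod ν).prod ρ)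
      ((μ.prod ρ).prod ν) :=
  measurePreserving_assoc_symm.comp
    (((MeasurePreserving.id μ).prod Measure.measurePreserving_swap).comp measurePreserving_assoc)

/-- The linear changes of momenta behind `fib₁`, `fib₂`, `pts₁` and `pts₂` are compositions of such
shears with swaps and reassociations, so no determinant has to be computed. -/
lemma measurePreserving_shear [SFinite μ] {g : X → E3} (hg : Measurable g) :
    MeasurePreserving (fun z : X × E3 => (z.1, z.2 + g z.1)) (μ.prod volume) (μ.prod volume) :=
  (MeasurePreserving.id μ).skew_product (g := fun x e => e + g x) (by fun_prop)
    (Eventually.of_forall fun x => (measurePreserving_add_right volume (g x)).map_eq)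

end Reorder

lemma measurePreserving_pair_half :
    MeasurePreserving (fun z : E3 × E3 => ((1 / 2 : ℝ) • z.1 + z.2, (1 / 2 : ℝ) • z.1 - z.2)) := by
  have h1 := measurePreserving_shear (μ := (volume : Measure E3)) (g := fun x => (1 / 2 : ℝ) • x) (by fun_prop)
  have h2 := measurePreserving_shear (μ := (volume : Measure E3)) (g := fun x => - x) (by fun_prop)
  have h := h2.comp ((Measure.measurePreserving_swap (μ := (volume : Measure E3)) (ν := volume)).comp h1)
  have e : (fun z : E3 × E3 => ((1 / 2 : ℝ) • z.1 + z.2, (1 / 2 : ℝ) • z.1 - z.2)) =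
      (fun z : E3 × E3 => (z.1, z.2 + -z.1)) ∘ Prod.swap ∘ fun z : E3 × E3 => (z.1, z.2 + (1 / 2 : ℝ) • z.1) := by
    funext z
    refine Prod.ext ?_ ?_ <;> simp only [Function.comp, Prod.swap] <;> module
  rw [e]; exact h

lemma measurePreserving_pair_third :
    MeasurePreserving (fun z : E3 × E3 => ((2 / 3 : ℝ) • z.1 - z.2, z.2 + (1 / 3 : ℝ) • z.1)) := by
  have h1 := measurePreserving_shear (μ := (volume : Measure E3)) (g := fun x => (1 / 3 : ℝ) • x) (by fun_prop)
  have h2 := measurePreserving_shear (μ := (volume : Measure E3)) (g := fun x => - x) (by fun_prop)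
  have hs := Measure.measurePreserving_swap (μ := (volume : Measure E3)) (ν := (volume : Measure E3))
  have h := hs.comp (h2.comp (hs.comp h1))
  have e : (fun z : E3 × E3 => ((2 / 3 : ℝ) • z.1 - z.2, z.2 + (1 / 3 : ℝ) • z.1)) =
      Prod.swap ∘ (fun z : E3 × E3 => (z.1, z.2 + -z.1)) ∘ Prod.swap ∘ fun z : E3 × E3 => (z.1, z.2 + (1 / 3 : ℝ) • z.1) := by
    funext z
    refine Prod.ext ?_ ?_ <;> simp only [Function.comp, Prod.swap] <;> module
  rw [e]; exact h

lemma measurePreserving_triple_third :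
    MeasurePreserving (fun z : E3 × E3 × E3 =>
      ((1 / 3 : ℝ) • z.1 - z.2.1 - z.2.2, z.2.2 + (1 / 3 : ℝ) • z.1, z.2.1 + (1 / 3 : ℝ) • z.1)) := by
  have h1 := measurePreserving_assoc_symm (μ := (volume : Measure E3)) (ν := (volume : Measure E3)) (ρ := (volume : Measure E3))
  have h2 := measurePreserving_shear (μ := (volume : Measure (E3 × E3))) (g := fun x => (1 / 3 : ℝ) • x.1) (by fun_prop)
  have h3 := measurePreserving_pair_third.prod (MeasurePreserving.id (volume : Measure E3))
  have h4 := measurePreserving_assoc (μ := (volume : Measure E3)) (ν := (volume : Measure E3)) (ρ := (volume : Measure E3))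
  have h5 := Measure.measurePreserving_swap (μ := (volume : Measure E3)) (ν := (volume : Measure (E3 × E3)))
  have h6 := measurePreserving_shear (μ := (volume : Measure (E3 × E3))) (g := fun x => -x.2) (by fun_prop)
  have h7 := Measure.measurePreserving_swap (μ := (volume : Measure (E3 × E3))) (ν := (volume : Measure E3))
  have h8 := (MeasurePreserving.id (volume : Measure E3)).prod (Measure.measurePreserving_swap (μ := (volume : Measure E3)) (ν := (volume : Measure E3)))
  have h := h8.comp (h7.comp (h6.comp (h5.comp (h4.comp (h3.comp (h2.comp h1))))))
  refine (congrArg (fun f => MeasurePreserving f volume volume) ?_).mp h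
  funext z
  refine Prod.ext ?_ (Prod.ext ?_ ?_) <;> simp only [Function.comp, Prod.swap, Prod.map, id] <;> module

/-- Total momentum of three particles and the other momenta. -/
abbrev Base₁ (n : ℕ) : Type := E3 × (Fin n → E3)

/-- Momenta of two pairs and the other momenta. -/
abbrev Base₂ (m : ℕ) : Type := E3 × E3 × (Fin m → E3)

/-- Three-body coordinates. -/
noncomputable def fib₁ {n : ℕ} (z : Base₁ n × E3) : Config n :=
  cfg₁ ((2 / 3 : ℝ) • z.1.1 - z.2) (z.2 + (1 / 3 : ℝ) • z.1.1) z.1.2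

/-- Four-body coordinates. -/
noncomputable def fib₂ {m : ℕ} (z : Base₂ m × E3) : Config (m + 1) :=
  cfg₂ z.1.1 ((1 / 2 : ℝ) • z.1.2.1 + z.2) ((1 / 2 : ℝ) • z.1.2.1 - z.2) z.1.2.2

lemma measurePreserving_cfg₁ (n : ℕ) :
    MeasurePreserving (fun z : E3 × E3 × (Fin n → E3) => (cfg₁ z.1 z.2.1 z.2.2 : Config n)) :=
  (measurePreserving_toLp (n + 2)).comp ((measurePreserving_cons (n + 1)).comp
    ((MeasurePreserving.id volume).prod (measurePreserving_cons n)))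

lemma measurePreserving_cfg₂ (m : ℕ) :
    MeasurePreserving (fun z : E3 × E3 × E3 × (Fin m → E3) =>
      (cfg₂ z.1 z.2.1 z.2.2.1 z.2.2.2 : Config (m + 1))) :=
  (measurePreserving_toLp (m + 3)).comp ((measurePreserving_cons (m + 2)).comp
    ((MeasurePreserving.id volume).prod ((measurePreserving_cons (m + 1)).comp
      ((MeasurePreserving.id volume).prod (measurePreserving_cons m)))))

lemma measurePreserving_fib₁ (n : ℕ) :
    MeasurePreserving (fib₁ : Base₁ n × E3 → Config n) := by
  have h1 := measurePreserving_right_comm (μ := (volume : Measure E3)) (ν := (volume : Measure (Fin n → E3))) (ρ := (volume : Measure E3))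
  have h2 := measurePreserving_pair_third.prod (MeasurePreserving.id (volume : Measure (Fin n → E3)))
  have h3 := measurePreserving_assoc (μ := (volume : Measure E3)) (ν := (volume : Measure E3)) (ρ := (volume : Measure (Fin n → E3)))
  exact (measurePreserving_cfg₁ n).comp (h3.comp (h2.comp h1))

lemma measurePreserving_fib₂ (m : ℕ) :
    MeasurePreserving (fib₂ : Base₂ m × E3 → Config (m + 1)) := by
  have h1 := measurePreserving_assoc (μ := (volume : Measure E3)) (ν := (volume : Measure (E3 × (Fin m → E3)))) (ρ := (volume : Measure E3))
  have h2 := measurePreserving_right_comm (μ := (volume : Measure E3)) (ν := (volume : Measure (Fin m → E3))) (ρ := (volume : Measure E3))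
  have h3 := measurePreserving_pair_half.prod (MeasurePreserving.id (volume : Measure (Fin m → E3)))
  have h4 := measurePreserving_assoc (μ := (volume : Measure E3)) (ν := (volume : Measure E3)) (ρ := (volume : Measure (Fin m → E3)))
  exact (measurePreserving_cfg₂ m).comp
    (((MeasurePreserving.id (volume : Measure E3)).prod (h4.comp (h3.comp h2))).comp h1)

/-- The integration variables of the three-body off-diagonal term. -/
noncomputable def pts₁ {n : ℕ} (z : Base₁ n × (E3 × E3)) : E3 × E3 × E3 × (Fin n → E3) :=
  ((1 / 3 : ℝ) • z.1.1 - z.2.1 - z.2.2, z.2.2 + (1 / 3 : ℝ) • z.1.1, z.2.1 + (1 / 3 : ℝ) • z.1.1, z.1.2)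

/-- The integration variables of the four-body off-diagonal term. -/
noncomputable def pts₂ {m : ℕ} (z : Base₂ m × (E3 × E3)) : E3 × E3 × E3 × E3 × (Fin m → E3) :=
  ((1 / 2 : ℝ) • z.1.2.1 + z.2.1, (1 / 2 : ℝ) • z.1.2.1 - z.2.1,
    (1 / 2 : ℝ) • z.1.1 + z.2.2, (1 / 2 : ℝ) • z.1.1 - z.2.2, z.1.2.2)

lemma measurePreserving_pts₁ (n : ℕ) :
    MeasurePreserving (pts₁ : Base₁ n × (E3 × E3) → E3 × E3 × E3 × (Fin n → E3)) := by
  have h1 := measurePreserving_right_comm (μ := (volume : Measure E3)) (ν := (volume : Measure (Fin n → E3))) (ρ := (volume : Measure (E3 × E3)))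
  have h2 := measurePreserving_triple_third.prod (MeasurePreserving.id (volume : Measure (Fin n → E3)))
  have h3 := measurePreserving_assoc (μ := (volume : Measure E3)) (ν := (volume : Measure (E3 × E3))) (ρ := (volume : Measure (Fin n → E3)))
  have h4 := (MeasurePreserving.id (volume : Measure E3)).prod (measurePreserving_assoc (μ := (volume : Measure E3)) (ν := (volume : Measure E3)) (ρ := (volume : Measure (Fin n → E3))))
  exact h4.comp (h3.comp (h2.comp h1))

lemma measurePreserving_pts₂ (m : ℕ) :
    MeasurePreserving (pts₂ : Base₂ m × (E3 × E3) → E3 × E3 × E3 × E3 × (Fin m → E3)) := by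
  have hE : MeasurePreserving (fun z : (E3 × E3 × (Fin m → E3)) × (E3 × E3) =>
      ((z.1.2.1, z.2.1), ((z.1.1, z.2.2), z.1.2.2))) := by
    have a1 := measurePreserving_assoc_symm (μ := (volume : Measure E3)) (ν := (volume : Measure E3)) (ρ := (volume : Measure (Fin m → E3)))
    have a2 := measurePreserving_right_comm (μ := (volume : Measure (E3 × E3))) (ν := (volume : Measure (Fin m → E3))) (ρ := (volume : Measure (E3 × E3)))
    have a3 := Measure.measurePreserving_swap (μ := (volume : Measure E3)) (ν := (volume : Measure E3))
    have a4 := measurePreserving_assoc_symm (μ := (volume : Measure (E3 × E3))) (ν := (volume : Measure E3)) (ρ := (volume : Measure E3))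
    have a5 := measurePreserving_assoc (μ := (volume : Measure E3)) (ν := (volume : Measure E3)) (ρ := (volume : Measure E3))
    have a6 := Measure.measurePreserving_swap (μ := (volume : Measure E3)) (ν := (volume : Measure (E3 × E3)))
    have a7 := measurePreserving_right_comm (μ := (volume : Measure E3)) (ν := (volume : Measure E3)) (ρ := (volume : Measure E3))
    -- `((Q, R), (k, l)) ↦ ((R, k), (Q, l))`
    have b1 : MeasurePreserving (fun z : (E3 × E3) × (E3 × E3) => ((z.1.2, z.2.1), (z.1.1, z.2.2))) := by
      have c1 := ((a3.prod (MeasurePreserving.id (volume : Measure E3))).prod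
        (MeasurePreserving.id (volume : Measure E3))).comp a4
      have c2 := (a7.prod (MeasurePreserving.id (volume : Measure E3))).comp c1
      exact (measurePreserving_assoc (μ := (volume : Measure (E3 × E3))) (ν := (volume : Measure E3)) (ρ := (volume : Measure E3))).comp c2
    have b2 := a2.comp (a1.prod (MeasurePreserving.id (volume : Measure (E3 × E3))))
    have b3 := (b1.prod (MeasurePreserving.id (volume : Measure (Fin m → E3)))).comp b2
    exact (measurePreserving_assoc (μ := (volume : Measure (E3 × E3))) (ν := (volume : Measure (E3 × E3))) (ρ := (volume : Measure (Fin m → E3)))).comp b3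
  have h2 := measurePreserving_pair_half.prod (measurePreserving_pair_half.prod (MeasurePreserving.id (volume : Measure (Fin m → E3))))
  have h3 := measurePreserving_assoc (μ := (volume : Measure E3)) (ν := (volume : Measure E3)) (ρ := (volume : Measure (Fin m → E3)))
  have h4 := measurePreserving_assoc (μ := (volume : Measure E3)) (ν := (volume : Measure E3)) (ρ := (volume : Measure (E3 × E3 × (Fin m → E3))))
  exact h4.comp (((MeasurePreserving.id (volume : Measure (E3 × E3))).prod h3).comp (h2.comp hE))

/-! ### The Fourier representation of 1/|l x| -/

/-- The antiderivative is e^{-c/σ}/c, extended by 0 to σ ≤ 0. With c = |k|²/4 this writes 1/|k|² as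
a mixture of the Gaussians e^{-|k|²/(4σ)}. -/
lemma integral_inv_sq_mul_exp {c : ℝ} (hc : 0 < c) :
    IntegrableOn (fun σ : ℝ => 1 / σ ^ 2 * exp (-(c / σ))) (Ioi 0) ∧
    ∫ σ in Ioi (0 : ℝ), 1 / σ ^ 2 * exp (-(c / σ)) = 1 / c := by
  set F : ℝ → ℝ := fun σ => if σ ≤ 0 then 0 else 1 / c * exp (-(c / σ)) with hF
  have hd : ∀ x ∈ Ioi (0 : ℝ), HasDerivAt F (1 / x ^ 2 * exp (-(c / x))) x := by
    intro x hx
    have hx : (0 : ℝ) < x := hx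
    have h := (((hasDerivAt_inv hx.ne').const_mul (-c)).exp).const_mul (1 / c)
    have h1 : 1 / c * (exp (-c * x⁻¹) * (-c * -(x ^ 2)⁻¹)) = 1 / x ^ 2 * exp (-(c / x)) := by
      rw [show -c * x⁻¹ = -(c / x) by ring]; field_simp
    rw [h1] at h
    refine h.congr_of_eventuallyEq ?_
    filter_upwards [lt_mem_nhds hx] with y hy
    simp only [hF, if_neg (not_le.2 hy)]
    congr 2; ring
  have hinv : Tendsto (fun σ : ℝ => -(c / σ)) (𝓝[>] 0) atBot := by
    refine tendsto_neg_atTop_atBot.comp ?_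
    refine (tendsto_inv_nhdsGT_zero.const_mul_atTop hc).congr fun σ => ?_
    rw [div_eq_mul_inv]
  have hcont : ContinuousWithinAt F (Ici 0) 0 := by
    rw [← continuousWithinAt_Ioi_iff_Ici]
    have h0 : F 0 = 0 := by simp [hF]
    unfold ContinuousWithinAt
    rw [h0]
    have h2 : Tendsto (fun σ : ℝ => 1 / c * exp (-(c / σ))) (𝓝[>] 0) (𝓝 0) := by
      have := (tendsto_exp_atBot.comp hinv).const_mul (1 / c)
      simpa using this
    refine h2.congr' ?_
    filter_upwards [self_mem_nhdsWithin] with y hy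
    have hy : (0 : ℝ) < y := hy
    simp only [hF, if_neg (not_le.2 hy)]
  have hp : ∀ x ∈ Ioi (0 : ℝ), 0 ≤ 1 / x ^ 2 * exp (-(c / x)) := fun x hx => by positivity
  have ht : Tendsto F atTop (𝓝 (1 / c)) := by
    have h1 : Tendsto (fun σ : ℝ => -(c / σ)) atTop (𝓝 0) := by
      simpa using (tendsto_const_nhds.div_atTop tendsto_id : Tendsto (fun σ : ℝ => c / σ) atTop (𝓝 0)).neg
    have h2 : Tendsto (fun σ : ℝ => 1 / c * exp (-(c / σ))) atTop (𝓝 (1 / c)) := by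
      have := ((continuous_exp.tendsto 0).comp h1).const_mul (1 / c)
      simpa using this
    refine h2.congr' ?_
    filter_upwards [eventually_gt_atTop 0] with y hy
    simp only [hF, if_neg (not_le.2 hy)]
  refine ⟨integrableOn_Ioi_deriv_of_nonneg hcont hd hp ht, ?_⟩
  rw [integral_Ioi_of_hasDerivAt_of_nonneg hcont hd hp ht]
  simp [hF]

variable {n : ℕ}

lemma measurable_autocorrelation (ξ : L2 n) {ι : E3 → Config n} (hι : Measurable ι) :
    Measurable fun z : Config n × E3 => (starRingEnd ℂ) (hat ξ z.1) * hat ξ (z.1 - ι z.2) := by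
  have h1 : Measurable fun z : Config n × E3 => hat ξ z.1 := (measurable_hat ξ).comp measurable_fst
  have h2 : Measurable fun z : Config n × E3 => hat ξ (z.1 - ι z.2) :=
    (measurable_hat ξ).comp (measurable_fst.sub (hι.comp measurable_snd))
  exact (Complex.continuous_conj.measurable.comp h1).mul h2

lemma measurePreserving_sub_embed {ι : E3 → Config n} (hι : Measurable ι) :
    MeasurePreserving (fun z : Config n × E3 => (z.1 - ι z.2, z.2))
      (volume.prod volume) (volume.prod volume) := by
  have h := (MeasurePreserving.id (volume : Measure E3)).skew_product
    (μa := volume) (μc := (volume : Measure (Config n))) (μd := (volume : Measure (Config n)))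
    (g := fun k p => p - ι k) (by
      exact measurable_snd.sub (hι.comp measurable_fst))
    (Eventually.of_forall fun k => (measurePreserving_sub_right volume (ι k)).map_eq)
  exact (Measure.measurePreserving_swap.comp (h.comp Measure.measurePreserving_swap))

/-- Gaussian regularization of the Fourier representation of `1 / |ℓ x|`. -/
lemma integral_gaussian_mul_autocorrelation (ξ : L2 n) {ι : E3 → Config n} (hι : Measurable ι)
    {l : Config n → E3} (hl : Measurable l) (hlι : ∀ x k, (inner ℝ x (ι k) : ℝ) = inner ℝ (l x) k)
    {σ : ℝ} (hσ : 0 < σ) :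
    ∫ z : Config n × E3, (starRingEnd ℂ) (hat ξ z.1) * hat ξ (z.1 - ι z.2) *
        ((exp (-(‖z.2‖ ^ 2 / (4 * σ))) : ℝ) : ℂ) ∂volume.prod volume =
      (((4 * π * σ) ^ (3 / 2 : ℝ) * ∫ x, exp (-(σ * ‖l x‖ ^ 2)) * ‖ξ x‖ ^ 2 : ℝ) : ℂ) := by
  have hg : Integrable fun k : E3 => exp (-(‖k‖ ^ 2 / (4 * σ))) := by
    refine (integrable_exp_neg_mul_norm_sq (κ := 1 / (4 * σ)) (by positivity)).congr
      (Eventually.of_forall fun k => ?_)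
    simp only; congr 2; ring
  set J : Config n × E3 → ℂ := fun z => (starRingEnd ℂ) (hat ξ z.1) * hat ξ (z.1 - ι z.2) with hJ
  have hJm : Measurable J := measurable_autocorrelation ξ hι
  have hJi : Integrable (fun z => J z * ((exp (-(‖z.2‖ ^ 2 / (4 * σ))) : ℝ) : ℂ)) (volume.prod volume) := by
    have h1 := (integrable_norm_sq_hat ξ).mul_prod hg
    have h2 := (measurePreserving_sub_embed hι).integrable_comp_of_integrable h1
    refine (h1.add h2).mono' (hJm.mul (Complex.measurable_ofReal.comp (by fun_prop))).aestronglyMeasurable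
      (Eventually.of_forall fun z => ?_)
    simp only [hJ, norm_mul, RCLike.norm_conj, Complex.norm_real, Pi.add_apply, Function.comp]
    rw [Real.norm_of_nonneg (exp_pos _).le, ← add_mul]
    gcongr
    nlinarith [sq_nonneg (‖hat ξ z.1‖ - ‖hat ξ (z.1 - ι z.2)‖), sq_nonneg (‖hat ξ z.1‖),
      sq_nonneg (‖hat ξ (z.1 - ι z.2)‖)]
  have hxi : Integrable (fun x => ((‖ξ x‖ ^ 2 : ℝ) : ℂ)) := (integrable_norm_sq_Lp ξ).ofReal
  have hξm : Measurable ξ := (Lp.stronglyMeasurable ξ).measurable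
  have hEi : Integrable (fun z : E3 × Config n => ((exp (-(‖z.1‖ ^ 2 / (4 * σ))) : ℝ) : ℂ) *
      (Complex.exp (((inner ℝ (l z.2) z.1 : ℝ) : ℂ) * Complex.I) * ((‖ξ z.2‖ ^ 2 : ℝ) : ℂ)))
      (volume.prod volume) := by
    have h1 := (hg.ofReal (𝕜 := ℂ)).mul_prod hxi
    refine h1.mono ?_ (Eventually.of_forall fun z => ?_)
    · refine Measurable.aestronglyMeasurable ?_
      refine (Complex.measurable_ofReal.comp (by fun_prop)).mul (Measurable.mul ?_ (Complex.measurable_ofReal.comp (by fun_prop)))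
      exact Complex.measurable_exp.comp ((Complex.measurable_ofReal.comp (by fun_prop)).mul_const _)
    · rw [norm_mul, norm_mul, Complex.norm_exp_ofReal_mul_I, one_mul, norm_mul]
      rfl
  rw [integral_prod_symm _ hJi]
  have h1 : ∀ k : E3, ∫ p, J (p, k) * ((exp (-(‖k‖ ^ 2 / (4 * σ))) : ℝ) : ℂ) =
      ∫ x, ((exp (-(‖k‖ ^ 2 / (4 * σ))) : ℝ) : ℂ) *
        (Complex.exp (((inner ℝ (l x) k : ℝ) : ℂ) * Complex.I) * ((‖ξ x‖ ^ 2 : ℝ) : ℂ)) := by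
    intro k
    have h := integral_conj_hat_mul_translate ξ (ι k)
    simp_rw [hlι] at h
    rw [integral_mul_const, integral_const_mul, mul_comm, ← h]
  simp_rw [h1]
  rw [integral_integral_swap hEi]
  have h2 : ∀ x, ∫ k : E3, ((exp (-(‖k‖ ^ 2 / (4 * σ))) : ℝ) : ℂ) *
        (Complex.exp (((inner ℝ (l x) k : ℝ) : ℂ) * Complex.I) * ((‖ξ x‖ ^ 2 : ℝ) : ℂ)) =
      (((4 * π * σ) ^ (3 / 2 : ℝ) * (exp (-(σ * ‖l x‖ ^ 2)) * ‖ξ x‖ ^ 2) : ℝ) : ℂ) := by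
    intro x
    have h := GaussianFourier.integral_cexp_neg_mul_sq_norm_add (V := E3)
      (b := ((1 / (4 * σ) : ℝ) : ℂ)) (by rw [Complex.ofReal_re]; positivity) Complex.I (l x)
    simp_rw [← mul_assoc]
    rw [integral_mul_const]
    have h3 : ∫ k : E3, ((exp (-(‖k‖ ^ 2 / (4 * σ))) : ℝ) : ℂ) *
        Complex.exp (((inner ℝ (l x) k : ℝ) : ℂ) * Complex.I) =
        (((4 * π * σ) ^ (3 / 2 : ℝ) * exp (-(σ * ‖l x‖ ^ 2)) : ℝ) : ℂ) := by
      have h4 : ∀ k : E3, ((exp (-(‖k‖ ^ 2 / (4 * σ))) : ℝ) : ℂ) *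
          Complex.exp (((inner ℝ (l x) k : ℝ) : ℂ) * Complex.I) =
          Complex.exp (-((1 / (4 * σ) : ℝ) : ℂ) * (‖k‖ : ℂ) ^ 2 + Complex.I * ((inner ℝ (l x) k : ℝ) : ℂ)) := by
        intro k
        rw [Complex.ofReal_exp, ← Complex.exp_add]
        congr 1
        push_cast; ring
      simp_rw [h4]
      rw [h]
      have h5 : (π : ℂ) / ((1 / (4 * σ) : ℝ) : ℂ) = ((4 * π * σ : ℝ) : ℂ) := by
        have : (σ : ℂ) ≠ 0 := by exact_mod_cast hσ.ne'
        push_cast; field_simp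
      have h6 : ((Module.finrank ℝ E3 : ℂ) / 2) = ((3 / 2 : ℝ) : ℂ) := by simp
      rw [h5, h6, ← Complex.ofReal_cpow (by positivity), Complex.ofReal_mul, Complex.ofReal_exp]
      congr 2
      have : (σ : ℂ) ≠ 0 := by exact_mod_cast hσ.ne'
      rw [Complex.I_sq]
      push_cast; field_simp
    rw [h3]
    push_cast; ring
  simp_rw [h2]
  rw [integral_complex_ofReal, integral_const_mul]

/-- The Fourier representation of the multiplication by `1 / |ℓ x|`. -/
theorem integral_inv_norm_mul_norm_sq (ξ : L2 n) {ι : E3 → Config n} (hι : Measurable ι)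
    {l : Config n → E3} (hl : Measurable l) (hlι : ∀ x k, (inner ℝ x (ι k) : ℝ) = inner ℝ (l x) k)
    (hl0 : ∀ᵐ x, l x ≠ 0)
    (hi : Integrable (fun z : Config n × E3 => (starRingEnd ℂ) (hat ξ z.1) * hat ξ (z.1 - ι z.2) *
      ((1 / ‖z.2‖ ^ 2 : ℝ) : ℂ)) (volume.prod volume)) :
    Integrable (fun x => 1 / ‖l x‖ * ‖ξ x‖ ^ 2) ∧
    ((∫ x, 1 / ‖l x‖ * ‖ξ x‖ ^ 2 : ℝ) : ℂ) = ((1 / (2 * π ^ 2) : ℝ) : ℂ) *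
      ∫ z : Config n × E3, (starRingEnd ℂ) (hat ξ z.1) * hat ξ (z.1 - ι z.2) *
        ((1 / ‖z.2‖ ^ 2 : ℝ) : ℂ) ∂volume.prod volume := by
  set J : Config n × E3 → ℂ := fun z => (starRingEnd ℂ) (hat ξ z.1) * hat ξ (z.1 - ι z.2) with hJ
  have hJm : Measurable J := measurable_autocorrelation ξ hι
  have hξm : Measurable ξ := (Lp.stronglyMeasurable ξ).measurable
  -- The integral of κ over σ is 1/(2π²|k|²). Transforming the Gaussian in k gives the factor
  -- (4πσ)^{3/2}, so in position space the mixture becomes π^{-1/2} σ^{-1/2} e^{-σ|l x|²}, whose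
  -- integral over σ is 1/|l x|.
  set κ : (Config n × E3) × ℝ → ℝ := fun z =>
    1 / (8 * π ^ 2) * (1 / z.2 ^ 2 * exp (-(‖z.1.2‖ ^ 2 / 4 / z.2))) with hκ
  have hk0 : ∀ᵐ z : Config n × E3 ∂volume.prod volume, z.2 ≠ 0 := by
    rw [Measure.ae_prod_iff_ae_ae]
    · exact Eventually.of_forall fun p => ae_ne_E3 0
    · exact (measurableSet_eq_fun measurable_snd measurable_const).compl
  obtain ⟨hL, hL'⟩ := integrable_mixture (μ := (volume : Measure (Config n)).prod (volume : Measure E3)) (g := J) (κ := κ)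
    (W := fun z => 1 / (2 * π ^ 2) * (1 / ‖z.2‖ ^ 2)) hJm (by fun_prop) (fun z => by positivity)
    (by
      filter_upwards [hk0] with z hz
      have hz0 : 0 < ‖z.2‖ := norm_pos_iff.2 hz
      obtain ⟨h1, h2⟩ := integral_inv_sq_mul_exp (c := ‖z.2‖ ^ 2 / 4) (by positivity)
      refine ⟨h1.const_mul _, ?_⟩
      simp only [hκ]
      rw [integral_const_mul, h2]
      field_simp; norm_num)
    (by
      refine (hi.const_mul ((1 / (2 * π ^ 2) : ℝ) : ℂ)).congr (Eventually.of_forall fun z => ?_)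
      simp only [hJ]; push_cast; ring)
  have hσ : ∀ σ ∈ Ioi (0 : ℝ), ∫ z, J z * (κ (z, σ) : ℂ) ∂volume.prod volume =
      ((∫ x, 1 / √π * (σ ^ (-(1 / 2) : ℝ) * exp (-(σ * ‖l x‖ ^ 2))) * ‖ξ x‖ ^ 2 : ℝ) : ℂ) := by
    intro σ hσ
    have hσ : (0 : ℝ) < σ := hσ
    have h := integral_gaussian_mul_autocorrelation ξ hι hl hlι hσ
    have h1 : ∀ z, J z * (κ (z, σ) : ℂ) = ((1 / (8 * π ^ 2) * (1 / σ ^ 2) : ℝ) : ℂ) *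
        (J z * ((exp (-(‖z.2‖ ^ 2 / (4 * σ))) : ℝ) : ℂ)) := by
      intro z
      simp only [hκ]
      rw [div_div]
      push_cast; ring
    simp_rw [h1]
    rw [integral_const_mul, h, ← Complex.ofReal_mul, ← mul_assoc]
    congr 1
    have h2 : 1 / (8 * π ^ 2) * (1 / σ ^ 2) * (4 * π * σ) ^ (3 / 2 : ℝ) =
        1 / √π * σ ^ (-(1 / 2) : ℝ) := by
      have e1 : (4 * π * σ) ^ (3 / 2 : ℝ) = 8 * (π * √π) * (σ * √σ) := by
        rw [show (3 / 2 : ℝ) = 1 + 1 / 2 by norm_num, rpow_add (by positivity), rpow_one,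
          ← sqrt_eq_rpow, mul_assoc 4, sqrt_mul (by norm_num), sqrt_mul pi_pos.le,
          show (4 : ℝ) = 2 ^ 2 by norm_num, sqrt_sq (by norm_num)]
        ring
      have e2 : σ ^ (-(1 / 2) : ℝ) = 1 / √σ := by
        rw [rpow_neg hσ.le, ← sqrt_eq_rpow, one_div]
      rw [e1, e2]
      have e3 := sq_sqrt pi_pos.le
      have e4 := sq_sqrt hσ.le
      field_simp
      rw [e3, e4]
    rw [h2, ← integral_const_mul]
    refine integral_congr_ae (Eventually.of_forall fun x => ?_)
    simp only; ring
  have hnn : ∀ (σ : ℝ), 0 < σ → ∀ x, 0 ≤ 1 / √π * (σ ^ (-(1 / 2) : ℝ) * exp (-(σ * ‖l x‖ ^ 2))) * ‖ξ x‖ ^ 2 :=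
    fun σ hσ x => by positivity
  have hP : Integrable (fun z : Config n × ℝ => 1 / √π * (z.2 ^ (-(1 / 2) : ℝ) * exp (-(z.2 * ‖l z.1‖ ^ 2))) * ‖ξ z.1‖ ^ 2)
      (volume.prod (volume.restrict (Ioi 0))) := by
    rw [integrable_prod_iff' (Measurable.aestronglyMeasurable (by fun_prop))]
    refine ⟨?_, ?_⟩
    · filter_upwards [ae_restrict_mem measurableSet_Ioi] with σ hσ0
      have hσ0 : (0 : ℝ) < σ := hσ0
      refine ((integrable_norm_sq_Lp ξ).const_mul (1 / √π * σ ^ (-(1 / 2) : ℝ))).mono'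
        (Measurable.aestronglyMeasurable (by fun_prop)) (Eventually.of_forall fun x => ?_)
      rw [Real.norm_of_nonneg (hnn σ hσ0 x)]
      gcongr
      refine mul_le_of_le_one_right (by positivity) (exp_le_one_iff.2 ?_)
      have : 0 ≤ σ * ‖l x‖ ^ 2 := by positivity
      linarith
    -- For each σ the position integral equals the momentum integral, which is integrable in σ.
    -- Since the position integrand is nonnegative, its joint integrability follows.
    · have h := hL.integral_prod_right.re
      refine h.congr ?_
      filter_upwards [ae_restrict_mem measurableSet_Ioi] with σ hσ0
      rw [hσ σ hσ0]
      simp only [RCLike.re_eq_complex_re, Complex.ofReal_re]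
      refine integral_congr_ae (Eventually.of_forall fun x => ?_)
      simp only
      rw [Real.norm_of_nonneg (hnn σ hσ0 x)]
  have hx : ∀ᵐ x, ∫ σ in Ioi (0 : ℝ), 1 / √π * (σ ^ (-(1 / 2) : ℝ) * exp (-(σ * ‖l x‖ ^ 2))) * ‖ξ x‖ ^ 2 =
      1 / ‖l x‖ * ‖ξ x‖ ^ 2 := by
    filter_upwards [hl0] with x hx
    have h0 : 0 < ‖l x‖ := norm_pos_iff.2 hx
    rw [integral_mul_const, integral_const_mul]
    have h := lintegral_rpow_neg_half_mul_exp_neg_mul (c := ‖l x‖ ^ 2) (by positivity)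
    have hnn' : ∀ᵐ σ ∂volume.restrict (Ioi (0 : ℝ)), 0 ≤ σ ^ (-(1 / 2) : ℝ) * exp (-(σ * ‖l x‖ ^ 2)) := by
      filter_upwards [ae_restrict_mem measurableSet_Ioi] with σ hσ0
      have hσ0 : (0 : ℝ) < σ := hσ0
      positivity
    rw [integral_eq_lintegral_of_nonneg_ae hnn' (Measurable.aestronglyMeasurable (by fun_prop)), h,
      ENNReal.toReal_ofReal (by positivity), sqrt_sq h0.le]
    have : √π ≠ 0 := by positivity
    field_simp
  refine ⟨hP.integral_prod_left.congr hx, ?_⟩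
  rw [← integral_congr_ae hx, integral_integral_swap hP, ← integral_complex_ofReal,
    ← setIntegral_congr_fun measurableSet_Ioi hσ, ← integral_integral_swap hL, integral_congr_ae hL',
    ← integral_const_mul]
  refine integral_congr_ae (Eventually.of_forall fun z => ?_)
  simp only [hJ]; push_cast; ring

/-! ### Radial null sets -/

/-- In polar coordinates the indicator function of a null set of radii has integral 0. This is
needed because θ is controlled only for almost every r. -/
lemma ae_norm_of_ae_Ioi {p : ℝ → Prop} (h : ∀ᵐ r ∂(volume.restrict (Ioi (0 : ℝ))), p r) :
    ∀ᵐ x : E3, p ‖x‖ := by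
  obtain ⟨N, hN, hNm, hN0⟩ := exists_measurable_superset_of_null (ae_iff.1 h)
  set f : ℝ → ℝ := N.indicator 1 with hf
  have hf0 : f =ᵐ[volume.restrict (Ioi (0 : ℝ))] 0 := by
    have : ∀ᵐ r ∂(volume.restrict (Ioi (0 : ℝ))), r ∉ N := by rw [ae_iff]; simpa using hN0
    filter_upwards [this] with r hr
    simp [hf, hr]
  have hi : IntegrableOn (fun y : ℝ => y ^ (Module.finrank ℝ E3 - 1) • f y) (Ioi 0) := by
    refine (integrable_zero ℝ ℝ _).congr ?_
    filter_upwards [hf0] with r hr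
    rw [hr]; simp
  have hi2 : Integrable (fun x : E3 => f ‖x‖) := (integrable_fun_norm_addHaar volume).2 hi
  have h0 : ∫ x : E3, f ‖x‖ = 0 := by
    rw [integral_fun_norm_addHaar]
    have : ∫ y in Ioi (0 : ℝ), y ^ (Module.finrank ℝ E3 - 1) • f y = 0 := by
      refine integral_eq_zero_of_ae ?_
      filter_upwards [hf0] with r hr
      rw [hr]; simp
    rw [this]; simp
  have hnn : ∀ r, 0 ≤ f r := fun r => indicator_nonneg (fun _ _ => zero_le_one) r
  have h1 := (integral_eq_zero_iff_of_nonneg (fun x : E3 => hnn ‖x‖) hi2).1 h0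
  filter_upwards [h1] with x hx
  by_contra hp
  have hxN : ‖x‖ ∈ N := hN hp
  simp [hf, hxN] at hx

lemma ae_norm_linear_of_ae_Ioi {n : ℕ} {L : Config n →ₗ[ℝ] E3} (hL : Function.Surjective L)
    {p : ℝ → Prop} (h : ∀ᵐ r ∂(volume.restrict (Ioi (0 : ℝ))), p r) :
    ∀ᵐ x : Config n, p ‖L x‖ := by
  have h1 := ae_norm_of_ae_Ioi h
  obtain ⟨N, hN, hNm, hN0⟩ := exists_measurable_superset_of_null (ae_iff.1 h1)
  have h2 : ∀ᵐ y : E3, y ∈ Nᶜ := by rw [ae_iff]; simpa using hN0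
  filter_upwards [(ae_comp_linearMap_mem_iff L (volume : Measure (Config n)) volume hL hNm.compl).2 h2] with x hx
  by_contra hp
  exact hx (hN hp)

lemma ae_linear_ne_zero {n : ℕ} {L : Config n →ₗ[ℝ] E3} (hL : Function.Surjective L) :
    ∀ᵐ x : Config n, L x ≠ 0 := by
  have := (ae_comp_linearMap_mem_iff L (volume : Measure (Config n)) (volume : Measure E3) hL
    (measurableSet_singleton (0 : E3)).compl).2 (by simpa using ae_ne_E3 0)
  exact this

/-! ### The two families of coordinates -/

section Coordinates

variable {n m : ℕ}

lemma inner_Config (x y : Config n) :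
    (inner ℝ x y : ℝ) = inner ℝ (x 0) (y 0) + ∑ i : Fin (n + 1), inner ℝ (x i.succ) (y i.succ) := by
  rw [PiLp.inner_apply, Fin.sum_univ_succ]

lemma norm_sq_Config (x : Config n) : ‖x‖ ^ 2 = ‖x 0‖ ^ 2 + ∑ i : Fin (n + 1), ‖x i.succ‖ ^ 2 := by
  rw [PiLp.norm_sq_eq_of_L2, Fin.sum_univ_succ]

/-- `p² / 2 + P²`. -/
noncomputable def kinetic (p : Config n) : ℝ := 1 / 2 * ‖p 0‖ ^ 2 + ∑ i : Fin (n + 1), ‖p i.succ‖ ^ 2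

lemma kinetic_nonneg (p : Config n) : 0 ≤ kinetic p := by unfold kinetic; positivity

lemma kinetic_le (p : Config n) : kinetic p ≤ ‖p‖ ^ 2 := by
  rw [norm_sq_Config]; unfold kinetic; nlinarith [sq_nonneg ‖p 0‖]

lemma le_kinetic (p : Config n) : ‖p‖ ^ 2 ≤ 2 * kinetic p := by
  rw [norm_sq_Config]; unfold kinetic
  have : 0 ≤ ∑ i : Fin (n + 1), ‖p i.succ‖ ^ 2 := Finset.sum_nonneg fun _ _ => by positivity
  linarith

lemma measurable_kinetic : Measurable (kinetic : Config n → ℝ) := by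
  unfold kinetic; fun_prop

/-- The weights 2/3 and 1/3 in `fib₁` remove the cross term. The coefficient 3/2 of the fibre
variable decides the Kato bound for R₁, as the coefficient 2 in `kinetic_fib₂` does for R₂. -/
lemma kinetic_fib₁ (z : Base₁ n × E3) :
    kinetic (fib₁ z) = 1 / 3 * ‖z.1.1‖ ^ 2 + 3 / 2 * ‖z.2‖ ^ 2 + ∑ i, ‖z.1.2 i‖ ^ 2 := by
  unfold kinetic
  rw [Fin.sum_univ_succ]
  have e0 : (fib₁ z : Config n) 0 = (2 / 3 : ℝ) • z.1.1 - z.2 := rfl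
  have e1 : (fib₁ z : Config n) (Fin.succ 0) = z.2 + (1 / 3 : ℝ) • z.1.1 := rfl
  have e2 : ∀ i : Fin n, (fib₁ z : Config n) (Fin.succ (Fin.succ i)) = z.1.2 i := fun i => rfl
  rw [e0, e1]
  simp_rw [e2]
  rw [norm_sub_sq_real, norm_add_sq_real, norm_smul, norm_smul, inner_smul_left, inner_smul_right,
    real_inner_comm z.2 z.1.1]
  simp
  ring

lemma kinetic_fib₂ (z : Base₂ m × E3) :
    kinetic (fib₂ z) = 1 / 2 * ‖z.1.1‖ ^ 2 + 1 / 2 * ‖z.1.2.1‖ ^ 2 + 2 * ‖z.2‖ ^ 2 +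
      ∑ i, ‖z.1.2.2 i‖ ^ 2 := by
  unfold kinetic
  rw [Fin.sum_univ_succ, Fin.sum_univ_succ]
  have e0 : (fib₂ z : Config (m + 1)) 0 = z.1.1 := rfl
  have e1 : (fib₂ z : Config (m + 1)) (Fin.succ 0) = (1 / 2 : ℝ) • z.1.2.1 + z.2 := rfl
  have e2 : (fib₂ z : Config (m + 1)) (Fin.succ (Fin.succ 0)) = (1 / 2 : ℝ) • z.1.2.1 - z.2 := rfl
  have e3 : ∀ i : Fin m, (fib₂ z : Config (m + 1)) (Fin.succ (Fin.succ (Fin.succ i))) = z.1.2.2 i :=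
    fun i => rfl
  rw [e0, e1, e2]
  simp_rw [e3]
  rw [norm_sub_sq_real, norm_add_sq_real, norm_smul]
  simp
  ring

/-- The direction of the relative momentum of the entries `0` and `1`. -/
noncomputable def dir₁ (k : E3) : Config n := cfg₁ (-k) k 0

/-- The direction of the relative momentum of the entries `1` and `2`. -/
noncomputable def dir₂ (k : E3) : Config (m + 1) := cfg₂ 0 k (-k) 0

/-- The relative position of the entries `0` and `1`. -/
noncomputable def rel₁ : Config n →ₗ[ℝ] E3 where
  toFun x := x 1 - x 0
  map_add' x y := by simp only [PiLp.add_apply]; abel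
  map_smul' c x := by simp [smul_sub]

/-- The relative position of the entries `1` and `2`. -/
noncomputable def rel₂ : Config (m + 1) →ₗ[ℝ] E3 where
  toFun x := x 1 - x 2
  map_add' x y := by simp only [PiLp.add_apply]; abel
  map_smul' c x := by simp [smul_sub]

lemma rel₁_surjective : Function.Surjective (rel₁ : Config n →ₗ[ℝ] E3) := fun k =>
  ⟨cfg₁ 0 k 0, by change k - 0 = k; simp⟩

lemma rel₂_surjective : Function.Surjective (rel₂ : Config (m + 1) →ₗ[ℝ] E3) := fun k =>
  ⟨cfg₂ 0 k 0 0, by change k - 0 = k; simp⟩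

lemma inner_dir₁ (x : Config n) (k : E3) : (inner ℝ x (dir₁ k) : ℝ) = inner ℝ (rel₁ x) k := by
  rw [inner_Config, Fin.sum_univ_succ]
  have e0 : (dir₁ k : Config n) 0 = -k := rfl
  have e1 : (dir₁ k : Config n) (Fin.succ 0) = k := rfl
  have e2 : ∀ i : Fin n, (dir₁ k : Config n) (Fin.succ (Fin.succ i)) = 0 := fun i => rfl
  have e3 : rel₁ x = x 1 - x 0 := rfl
  rw [e0, e1, e3]
  simp_rw [e2]
  rw [inner_neg_right, inner_sub_left]
  simp
  ring

lemma inner_dir₂ (x : Config (m + 1)) (k : E3) : (inner ℝ x (dir₂ k) : ℝ) = inner ℝ (rel₂ x) k := by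
  rw [inner_Config, Fin.sum_univ_succ, Fin.sum_univ_succ]
  have e0 : (dir₂ k : Config (m + 1)) 0 = 0 := rfl
  have e1 : (dir₂ k : Config (m + 1)) (Fin.succ 0) = k := rfl
  have e1' : (dir₂ k : Config (m + 1)) (Fin.succ (Fin.succ 0)) = -k := rfl
  have e2 : ∀ i : Fin m, (dir₂ k : Config (m + 1)) (Fin.succ (Fin.succ (Fin.succ i))) = 0 := fun i => rfl
  have e3 : rel₂ x = x 1 - x 2 := rfl
  rw [e0, e1, e1', e3]
  simp_rw [e2]
  rw [inner_neg_right, inner_sub_left]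
  simp
  rfl

lemma measurable_dir₁ : Measurable (dir₁ : E3 → Config n) := by
  unfold dir₁
  exact (measurePreserving_cfg₁ n).measurable.comp (by fun_prop : Measurable fun k : E3 => (-k, k, (0 : Fin n → E3)))

lemma measurable_dir₂ : Measurable (dir₂ : E3 → Config (m + 1)) := by
  unfold dir₂
  exact (measurePreserving_cfg₂ m).measurable.comp
    (by fun_prop : Measurable fun k : E3 => ((0 : E3), k, -k, (0 : Fin m → E3)))

lemma measurable_rel₁ : Measurable (rel₁ : Config n →ₗ[ℝ] E3) :=
  (by fun_prop : Measurable fun x : Config n => x 1 - x 0)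

lemma measurable_rel₂ : Measurable (rel₂ : Config (m + 1) →ₗ[ℝ] E3) :=
  (by fun_prop : Measurable fun x : Config (m + 1) => x 1 - x 2)

/-- Moving in the fibre is a translation along `dir₁`, which is dual to the relative position
`rel₁`; this connects the fibre integrals with the potential 1/|x - x'|. -/
lemma fib₁_sub (y : Base₁ n) (u v : E3) : (fib₁ (y, v) : Config n) = fib₁ (y, u) - dir₁ (u - v) := by
  refine PiLp.ext fun i => ?_
  refine Fin.cases ?_ (fun i => Fin.cases ?_ (fun i => ?_) i) i
  · change (2 / 3 : ℝ) • y.1 - v = (2 / 3 : ℝ) • y.1 - u - -(u - v)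
    abel
  · change v + (1 / 3 : ℝ) • y.1 = u + (1 / 3 : ℝ) • y.1 - (u - v)
    abel
  · change y.2 i = y.2 i - 0
    simp

lemma fib₂_sub (y : Base₂ m) (u v : E3) : (fib₂ (y, v) : Config (m + 1)) = fib₂ (y, u) - dir₂ (u - v) := by
  refine PiLp.ext fun i => ?_
  refine Fin.cases ?_ (fun i => Fin.cases ?_ (fun i => Fin.cases ?_ (fun i => ?_) i) i) i
  · change y.1 = y.1 - 0
    simp
  · change (1 / 2 : ℝ) • y.2.1 + v = (1 / 2 : ℝ) • y.2.1 + u - (u - v)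
    abel
  · change (1 / 2 : ℝ) • y.2.1 - v = (1 / 2 : ℝ) • y.2.1 - u - -(u - v)
    abel
  · change y.2.2 i = y.2.2 i - 0
    simp

end Coordinates

/-! ### The singular potential in fibred coordinates -/

section Fibration

variable {n : ℕ} {Y : Type*} [MeasurableSpace Y] {ν : Measure Y} {Ψ : Y × E3 → Config n}

/-- Finiteness of the `H^{1/2}` norm. -/
def SobolevHalf (ξ : L2 n) : Prop := Integrable fun p => √(1 + ‖p‖ ^ 2) * ‖hat ξ p‖ ^ 2

/-- Passes from two points u, v of a fibre to a configuration and the transferred momentum u - v,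
the variables of `integral_inv_norm_mul_norm_sq`. -/
lemma measurePreserving_fibre_diff [SFinite ν] (hΨ : MeasurePreserving Ψ (ν.prod volume) volume) :
    MeasurePreserving (fun z : Y × (E3 × E3) => (Ψ (z.1, z.2.1), z.2.1 - z.2.2))
      (ν.prod volume) (volume.prod volume) := by
  have h1 := measurePreserving_assoc_symm (μ := ν) (ν := (volume : Measure E3)) (ρ := (volume : Measure E3))
  have h2 : MeasurePreserving (fun z : (Y × E3) × E3 => (z.1, z.1.2 - z.2))
      ((ν.prod volume).prod volume) ((ν.prod volume).prod volume) :=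
    (MeasurePreserving.id (ν.prod volume)).skew_product (g := fun x e => x.2 - e) (by fun_prop)
      (Eventually.of_forall fun x => (Measure.measurePreserving_sub_left volume x.2).map_eq)
  exact (hΨ.prod (MeasurePreserving.id (volume : Measure E3))).comp (h2.comp h1)

lemma integrable_norm_mul_fibre {ξ : L2 n} (hξ : SobolevHalf ξ)
    (hΨ : MeasurePreserving Ψ (ν.prod volume) volume) {c : ℝ} (hc : 0 ≤ c)
    (hu : ∀ z : Y × E3, ‖z.2‖ ≤ c * √(kinetic (Ψ z))) :
    Integrable (fun z : Y × E3 => ‖z.2‖ * ‖hat ξ (Ψ z)‖ ^ 2) (ν.prod volume) := by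
  have h := (hΨ.integrable_comp_of_integrable hξ).const_mul c
  have hm : Measurable fun z : Y × E3 => hat ξ (Ψ z) := (measurable_hat ξ).comp hΨ.measurable
  refine h.mono' (Measurable.aestronglyMeasurable (by fun_prop)) (Eventually.of_forall fun z => ?_)
  rw [Real.norm_of_nonneg (by positivity)]
  simp only [Function.comp]
  rw [← mul_assoc]
  gcongr
  refine (hu z).trans ?_
  gcongr
  linarith [kinetic_le (Ψ z)]

/-- Multiplication by 1/|L x| is a convolution that acts on the fibre variable alone, so Kato's
inequality applies fibrewise; the constant is 1/(2π²) · (π³/2) · 2 = π/2. -/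
theorem singular_potential_fibred [SFinite ν] {ι : E3 → Config n} (hιm : Measurable ι) {L : Config n →ₗ[ℝ] E3}
    (hL : Function.Surjective L) (hLm : Measurable L) (hLι : ∀ x k, (inner ℝ x (ι k) : ℝ) = inner ℝ (L x) k)
    (hΨ : MeasurePreserving Ψ (ν.prod volume) volume)
    (hι : ∀ y u v, Ψ (y, v) = Ψ (y, u) - ι (u - v)) {ξ : L2 n}
    (hi : Integrable (fun z : Y × E3 => ‖z.2‖ * ‖hat ξ (Ψ z)‖ ^ 2) (ν.prod volume)) :
    Integrable (fun x => 1 / ‖L x‖ * ‖ξ x‖ ^ 2) ∧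
    ((∫ x, 1 / ‖L x‖ * ‖ξ x‖ ^ 2 : ℝ) : ℂ) = ((1 / (2 * π ^ 2) : ℝ) : ℂ) *
      ∫ z : Y × (E3 × E3), (starRingEnd ℂ) (hat ξ (Ψ (z.1, z.2.1))) * hat ξ (Ψ (z.1, z.2.2)) *
        ((1 / ‖z.2.1 - z.2.2‖ ^ 2 : ℝ) : ℂ) ∂ν.prod volume ∧
    ∫ x, 1 / ‖L x‖ * ‖ξ x‖ ^ 2 ≤ π / 2 * ∫ z : Y × E3, ‖z.2‖ * ‖hat ξ (Ψ z)‖ ^ 2 ∂ν.prod volume := by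
  have hm : Measurable fun z : Y × E3 => hat ξ (Ψ z) := (measurable_hat ξ).comp hΨ.measurable
  have hT := measurePreserving_fibre_diff hΨ
  obtain ⟨hk1, hk2⟩ := integrable_kato_fibred (ν := ν) hm hm
    (w := fun z : Y × (E3 × E3) => 1 / ‖z.2.1 - z.2.2‖ ^ 2) (by fun_prop) zero_le_one
    (fun z => Or.inl (by rw [abs_of_nonneg (by positivity), one_mul])) hi hi
  set F : Config n × E3 → ℂ := fun z => (starRingEnd ℂ) (hat ξ z.1) * hat ξ (z.1 - ι z.2) *
      ((1 / ‖z.2‖ ^ 2 : ℝ) : ℂ) with hF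
  have hFm : Measurable F := (measurable_autocorrelation ξ hιm).mul
    (Complex.measurable_ofReal.comp (by fun_prop))
  have hFT : ∀ z : Y × (E3 × E3), F (Ψ (z.1, z.2.1), z.2.1 - z.2.2) =
      (starRingEnd ℂ) (hat ξ (Ψ (z.1, z.2.1))) * hat ξ (Ψ (z.1, z.2.2)) *
        ((1 / ‖z.2.1 - z.2.2‖ ^ 2 : ℝ) : ℂ) := by
    intro z
    simp only [hF, ← hι]
  have hFi : Integrable F (volume.prod volume) := by
    rw [← hT.integrable_comp hFm.aestronglyMeasurable]
    exact hk1.congr (Eventually.of_forall fun z => (hFT z).symm)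
  obtain ⟨h1, h2⟩ := integral_inv_norm_mul_norm_sq ξ hιm hLm hLι (ae_linear_ne_zero hL) hFi
  have h3 : ∫ z, F z ∂volume.prod volume = ∫ z : Y × (E3 × E3),
      (starRingEnd ℂ) (hat ξ (Ψ (z.1, z.2.1))) * hat ξ (Ψ (z.1, z.2.2)) *
        ((1 / ‖z.2.1 - z.2.2‖ ^ 2 : ℝ) : ℂ) ∂ν.prod volume := by
    rw [← hT.map_eq, integral_map hT.measurable.aemeasurable
      (by rw [hT.map_eq]; exact hFm.aestronglyMeasurable)]
    exact integral_congr_ae (Eventually.of_forall hFT)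
  refine ⟨h1, h2.trans (by rw [h3]), ?_⟩
  have h4 : ‖((∫ x, 1 / ‖L x‖ * ‖ξ x‖ ^ 2 : ℝ) : ℂ)‖ ≤ 1 / (2 * π ^ 2) * (1 * (π ^ 3 / 2) *
      ((∫ z : Y × E3, ‖z.2‖ * ‖hat ξ (Ψ z)‖ ^ 2 ∂ν.prod volume) +
        ∫ z : Y × E3, ‖z.2‖ * ‖hat ξ (Ψ z)‖ ^ 2 ∂ν.prod volume)) := by
    rw [h2, h3, norm_mul, Complex.norm_real, Real.norm_of_nonneg (by positivity)]
    gcongr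
  rw [Complex.norm_real] at h4
  refine (Real.le_norm_self _).trans (h4.trans (le_of_eq ?_))
  field_simp
  ring

end Fibration

/-! ### Hermitian forms -/

section Hermitian

variable {H : Type*} [NormedAddCommGroup H] [InnerProductSpace ℂ H] {D : Submodule ℂ H}

lemma IsHermitianForm.add {p q : H → ℂ} (hp : IsHermitianForm D p) (hq : IsHermitianForm D q) :
    IsHermitianForm D (fun u => p u + q u) := by
  obtain ⟨A, hA, hA'⟩ := hp
  obtain ⟨B, hB, hB'⟩ := hq
  refine ⟨A + B, fun u v => ?_, fun u => ?_⟩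
  · simp [hA, hB]
  · simp [hA', hB']

lemma IsHermitianForm.const_mul {q : H → ℂ} (hq : IsHermitianForm D q) (c : ℝ) :
    IsHermitianForm D (fun u => (c : ℂ) * q u) := by
  obtain ⟨B, hB, hB'⟩ := hq
  refine ⟨(c : ℂ) • B, fun u v => ?_, fun u => ?_⟩
  · simp [hB]
  · simp [hB']

lemma isHermitianForm_zero : IsHermitianForm D (fun _ => 0) :=
  ⟨0, fun u v => by simp, fun u => by simp⟩

lemma IsHermitianForm.congr {p q : H → ℂ} (hp : IsHermitianForm D p) (h : ∀ u ∈ D, q u = p u) :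
    IsHermitianForm D q := by
  obtain ⟨A, hA, hA'⟩ := hp
  exact ⟨A, hA, fun u => (h u u.2).trans (hA' u)⟩

variable {Z : Type*} [MeasurableSpace Z] {μ : Measure Z} {a : H → Z → ℂ}

/-- The involution J interchanges the two factors, and the substitution z ↦ J z gives the hermitian
symmetry. For the off-diagonal terms J swaps u and v and, for disjoint pairs, the two pair momenta.
-/
lemma isHermitianForm_integral {J : Z → Z} {w : Z → ℝ}
    (hadd : ∀ u v, a (u + v) =ᵐ[μ] fun z => a u z + a v z)
    (hsmul : ∀ (c : ℂ) u, a (c • u) =ᵐ[μ] fun z => c * a u z)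
    (hJ : MeasurePreserving J μ μ) (hJJ : ∀ z, J (J z) = z) (hw : ∀ z, w (J z) = w z)
    (hi : ∀ u ∈ D, ∀ v ∈ D,
      Integrable (fun z => (starRingEnd ℂ) (a u z) * a v (J z) * (w z : ℂ)) μ) :
    IsHermitianForm D (fun u => ∫ z, (starRingEnd ℂ) (a u z) * a u (J z) * (w z : ℂ) ∂μ) := by
  have hadd' : ∀ u v, (fun z => a (u + v) (J z)) =ᵐ[μ] fun z => a u (J z) + a v (J z) :=
    fun u v => hJ.quasiMeasurePreserving.ae_eq_comp (hadd u v)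
  have hsmul' : ∀ (c : ℂ) u, (fun z => a (c • u) (J z)) =ᵐ[μ] fun z => c * a u (J z) :=
    fun c u => hJ.quasiMeasurePreserving.ae_eq_comp (hsmul c u)
  refine ⟨LinearMap.mk₂'ₛₗ (starRingEnd ℂ) (RingHom.id ℂ)
    (fun u v : D => ∫ z, (starRingEnd ℂ) (a u z) * a v (J z) * (w z : ℂ) ∂μ)
    (fun u u' v => ?_) (fun c u v => ?_) (fun u v v' => ?_) (fun c u v => ?_),
    fun u v => ?_, fun u => rfl⟩
  · rw [← integral_add (hi u u.2 v v.2) (hi u' u'.2 v v.2)]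
    refine integral_congr_ae ?_
    filter_upwards [hadd u u'] with z hz
    rw [Submodule.coe_add, hz, map_add]
    ring
  · rw [smul_eq_mul, ← integral_const_mul]
    refine integral_congr_ae ?_
    filter_upwards [hsmul c u] with z hz
    rw [Submodule.coe_smul, hz, map_mul]
    ring
  · rw [← integral_add (hi u u.2 v v.2) (hi u u.2 v' v'.2)]
    refine integral_congr_ae ?_
    filter_upwards [hadd' v v'] with z hz
    rw [Submodule.coe_add, hz]
    ring
  · rw [smul_eq_mul, ← integral_const_mul]
    refine integral_congr_ae ?_
    filter_upwards [hsmul' c v] with z hz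
    rw [Submodule.coe_smul, hz, RingHom.id_apply]
    ring
  · let e : Z ≃ᵐ Z := ⟨⟨J, J, hJJ, hJJ⟩, hJ.measurable, hJ.measurable⟩
    change (starRingEnd ℂ) (∫ z, (starRingEnd ℂ) (a u z) * a v (J z) * (w z : ℂ) ∂μ) =
      ∫ z, (starRingEnd ℂ) (a v z) * a u (J z) * (w z : ℂ) ∂μ
    rw [← integral_conj, ← hJ.integral_comp e.measurableEmbedding]
    refine integral_congr_ae (Eventually.of_forall fun z => ?_)
    simp only [map_mul, Complex.conj_conj, Complex.conj_ofReal, hJJ, hw]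
    ring

lemma isHermitianForm_weight {w : Z → ℝ}
    (hadd : ∀ u v, a (u + v) =ᵐ[μ] fun z => a u z + a v z)
    (hsmul : ∀ (c : ℂ) u, a (c • u) =ᵐ[μ] fun z => c * a u z)
    (ha : ∀ u, AEStronglyMeasurable (a u) μ) (hw : AEStronglyMeasurable w μ)
    (hi : ∀ u ∈ D, Integrable (fun z => w z * ‖a u z‖ ^ 2) μ) :
    IsHermitianForm D (fun u => ((∫ z, w z * ‖a u z‖ ^ 2 ∂μ : ℝ) : ℂ)) := by
  have hi' : ∀ u ∈ D, ∀ v ∈ D,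
      Integrable (fun z => (starRingEnd ℂ) (a u z) * a v z * (w z : ℂ)) μ := by
    intro u hu v hv
    refine ((hi u hu).norm.add (hi v hv).norm).mono'
      (((Complex.continuous_conj.comp_aestronglyMeasurable (ha u)).mul (ha v)).mul
        (Complex.continuous_ofReal.comp_aestronglyMeasurable hw)) (Eventually.of_forall fun z => ?_)
    simp only [norm_mul, norm_pow, norm_norm, RCLike.norm_conj, Complex.norm_real, Pi.add_apply]
    nlinarith [mul_nonneg (norm_nonneg (w z)) (sq_nonneg (‖a u z‖ - ‖a v z‖)),
      mul_nonneg (norm_nonneg (w z)) (sq_nonneg (‖a u z‖)),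
      mul_nonneg (norm_nonneg (w z)) (sq_nonneg (‖a v z‖))]
  refine (isHermitianForm_integral (D := D) (J := id) hadd hsmul (MeasurePreserving.id μ)
    (fun _ => rfl) (fun _ => rfl) hi').congr fun u _ => ?_
  rw [← integral_complex_ofReal]
  refine integral_congr_ae (Eventually.of_forall fun z => ?_)
  simp only [id, Complex.ofReal_mul, Complex.ofReal_pow, Complex.conj_mul']
  ring

end Hermitian

/-! ### The kinetic energy -/

section Kinetic

variable {n : ℕ}

lemma integrable_sqrt_kinetic_add {ξ : L2 n} (hξ : SobolevHalf ξ) {lam : ℝ} (hl : 0 ≤ lam) :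
    Integrable fun p => √(kinetic p + lam) * ‖hat ξ p‖ ^ 2 := by
  refine (hξ.const_mul √(1 + lam)).mono' (Measurable.aestronglyMeasurable ?_)
    (Eventually.of_forall fun p => ?_)
  · exact ((measurable_kinetic.add_const lam).sqrt).mul ((measurable_hat ξ).norm.pow_const 2)
  · rw [Real.norm_of_nonneg (by positivity), ← mul_assoc, ← Real.sqrt_mul (by linarith)]
    gcongr
    nlinarith [kinetic_le p, mul_nonneg hl (sq_nonneg ‖p‖)]

lemma integrable_sqrt_kinetic {ξ : L2 n} (hξ : SobolevHalf ξ) :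
    Integrable fun p => √(kinetic p) * ‖hat ξ p‖ ^ 2 := by
  simpa only [add_zero] using integrable_sqrt_kinetic_add hξ le_rfl

/-- The kinetic energy `∫ √(p² / 2 + P²) |ξ̂|²`. -/
noncomputable def kineticEnergy (ξ : L2 n) : ℝ := ∫ p, √(kinetic p) * ‖hat ξ p‖ ^ 2

lemma kineticEnergy_nonneg (ξ : L2 n) : 0 ≤ kineticEnergy ξ :=
  integral_nonneg fun _ => by positivity

lemma kineticEnergy_le {ξ : L2 n} (hξ : SobolevHalf ξ) : kineticEnergy ξ ≤ sobolevNormSq ξ := by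
  refine integral_mono (integrable_sqrt_kinetic hξ) hξ fun p => ?_
  dsimp only
  gcongr
  linarith [kinetic_le p]

end Kinetic

/-! ### Off-diagonal pairings in fibred coordinates -/

section Pairing

variable {n : ℕ} {Y : Type*} [MeasurableSpace Y] {ν : Measure Y} {Ψ : Y × E3 → Config n}
  {σ : Y → Y} {m : Y → ℝ} {β c : ℝ} {ξ η : L2 n}

lemma integral_norm_mul_fibre_le (hξ : SobolevHalf ξ)
    (hΨ : MeasurePreserving Ψ (ν.prod volume) volume) (hc : 0 ≤ c)
    (hu : ∀ z : Y × E3, ‖z.2‖ ≤ c * √(kinetic (Ψ z))) :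
    ∫ z : Y × E3, ‖z.2‖ * ‖hat ξ (Ψ z)‖ ^ 2 ∂ν.prod volume ≤ c * kineticEnergy ξ := by
  have h1 : Measurable fun p : Config n => √(kinetic p) * ‖hat ξ p‖ ^ 2 :=
    measurable_kinetic.sqrt.mul ((measurable_hat ξ).norm.pow_const 2)
  have h2 : kineticEnergy ξ = ∫ z, √(kinetic (Ψ z)) * ‖hat ξ (Ψ z)‖ ^ 2 ∂ν.prod volume := by
    rw [kineticEnergy, ← hΨ.map_eq, integral_map hΨ.measurable.aemeasurable
      h1.aestronglyMeasurable]
  rw [h2, ← integral_const_mul]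
  refine integral_mono (integrable_norm_mul_fibre hξ hΨ hc hu)
    ((hΨ.integrable_comp_of_integrable (integrable_sqrt_kinetic hξ)).const_mul c) fun z => ?_
  rw [← mul_assoc]
  gcongr
  exact hu z

/-- The integrand of an off-diagonal term, in fibred coordinates. -/
noncomputable def pairing (Ψ : Y × E3 → Config n) (σ : Y → Y) (m : Y → ℝ) (β : ℝ) (ξ η : L2 n)
    (z : Y × (E3 × E3)) : ℂ :=
  (starRingEnd ℂ) (hat ξ (Ψ (z.1, z.2.1))) * hat η (Ψ (σ z.1, z.2.2)) *
    (pairKernel 0 (1 / 2) β (m z.1) z.2 : ℂ)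

lemma pairKernel_swap (α d β m : ℝ) (z : E3 × E3) :
    pairKernel α d β m z.swap = pairKernel α d β m z := by
  unfold pairKernel
  rw [Prod.fst_swap, Prod.snd_swap, norm_sub_rev, real_inner_comm, add_comm (‖z.2‖ ^ 2)]

variable (hΨ : MeasurePreserving Ψ (ν.prod volume) volume) (hm : Measurable m)
  (hm0 : ∀ y, 0 ≤ m y) (hβ : |β| ≤ 1) (hc : 0 ≤ c)
  (hu : ∀ z : Y × E3, ‖z.2‖ ≤ c * √(kinetic (Ψ z))) (hξ : SobolevHalf ξ) (hη : SobolevHalf η)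

lemma quasiMeasurePreserving_left [SFinite ν] :
    Measure.QuasiMeasurePreserving (fun z : Y × (E3 × E3) => (z.1, z.2.1))
      (ν.prod volume) (ν.prod volume) :=
  (Measure.quasiMeasurePreserving_fst (μ := ν.prod (volume : Measure E3))
    (ν := (volume : Measure E3))).comp
    (measurePreserving_assoc_symm (μ := ν) (ν := (volume : Measure E3))
      (ρ := (volume : Measure E3))).quasiMeasurePreserving

include hΨ in
lemma measurePreserving_comp_base [SFinite ν] (hσ : MeasurePreserving σ ν ν) :
    MeasurePreserving (fun z : Y × E3 => Ψ (σ z.1, z.2)) (ν.prod volume) volume :=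
  hΨ.comp (hσ.prod (MeasurePreserving.id volume))

include hΨ hm hm0 hβ hc hu hξ hη in
-- The kernel is at most 2/|u - v|², so Kato's inequality gives both the convergence and the
-- constant.
lemma integrable_pairing [SFinite ν] (hσ : MeasurePreserving σ ν ν) :
    Integrable (pairing Ψ σ m β ξ η) (ν.prod volume) ∧
      ‖∫ z, pairing Ψ σ m β ξ η z ∂ν.prod volume‖ ≤
        π ^ 3 * c * (kineticEnergy ξ + kineticEnergy η) := by
  have hΨ' := measurePreserving_comp_base hΨ hσ
  have hu' : ∀ z : Y × E3, ‖z.2‖ ≤ c * √(kinetic (Ψ (σ z.1, z.2))) := fun z => hu (σ z.1, z.2)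
  obtain ⟨h1, h2⟩ := integrable_kato_fibred (ν := ν) (a := fun z => hat ξ (Ψ z))
    (b := fun z => hat η (Ψ (σ z.1, z.2))) ((measurable_hat ξ).comp hΨ.measurable)
    ((measurable_hat η).comp hΨ'.measurable)
    (w := fun z => pairKernel 0 (1 / 2) β (m z.1) z.2) (measurable_pairKernel hm 0 (1 / 2) β)
    (C := |(0 : ℝ)| + 4 * |(1 / 2 : ℝ)|) (by positivity)
    (fun z => abs_pairKernel_le hβ (hm0 z.1) z.2)
    (integrable_norm_mul_fibre hξ hΨ hc hu) (integrable_norm_mul_fibre hη hΨ' hc hu')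
  refine ⟨h1, h2.trans ?_⟩
  have h3 := integral_norm_mul_fibre_le hξ hΨ hc hu
  have h4 := integral_norm_mul_fibre_le hη hΨ' hc hu'
  rw [abs_zero, abs_of_pos (by norm_num : (0 : ℝ) < 1 / 2)]
  calc _ ≤ (0 + 4 * (1 / 2)) * (π ^ 3 / 2) * (c * kineticEnergy ξ + c * kineticEnergy η) := by
        gcongr
    _ = _ := by ring

include hΨ hm hm0 hβ hc hu in
lemma isHermitianForm_pairing [SFinite ν] (hσ : MeasurePreserving σ ν ν) (hσσ : ∀ y, σ (σ y) = y)
    (hmσ : ∀ y, m (σ y) = m y) :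
    IsHermitianForm (formDomain n)
      (fun ξ => ∫ z, pairing Ψ σ m β (ξ : L2 n) (ξ : L2 n) z ∂ν.prod volume) := by
  have hq : Measure.QuasiMeasurePreserving (fun z : Y × (E3 × E3) => Ψ (z.1, z.2.1))
      (ν.prod volume) volume := hΨ.quasiMeasurePreserving.comp quasiMeasurePreserving_left
  exact isHermitianForm_integral
    (a := fun (ξ : chargeSpace n) (z : Y × (E3 × E3)) => hat (ξ : L2 n) (Ψ (z.1, z.2.1)))
    (J := fun z => (σ z.1, z.2.swap)) (w := fun z => pairKernel 0 (1 / 2) β (m z.1) z.2)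
    (fun ξ η => hq.ae_eq_comp (hat_add (ξ : L2 n) η))
    (fun a ξ => hq.ae_eq_comp (hat_smul a (ξ : L2 n)))
    (hσ.prod Measure.measurePreserving_swap)
    (fun z => by rw [hσσ, Prod.swap_swap])
    (fun z => by rw [pairKernel_swap, hmσ])
    (fun ξ hξ η hη => (integrable_pairing hΨ hm hm0 hβ hc hu ((mem_formDomain_iff ξ).1 hξ)
      ((mem_formDomain_iff η).1 hη) hσ).1)

/-- The energy of the singular potential `1 / |L x|`. -/
noncomputable def singularEnergy (L : Config n →ₗ[ℝ] E3) (ξ : L2 n) : ℝ :=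
  ∫ x, 1 / ‖L x‖ * ‖ξ x‖ ^ 2

lemma singularEnergy_nonneg (L : Config n →ₗ[ℝ] E3) (ξ : L2 n) : 0 ≤ singularEnergy L ξ :=
  integral_nonneg fun _ => by positivity

variable {ι : E3 → Config n} (hιm : Measurable ι) {L : Config n →ₗ[ℝ] E3}
    (hL : Function.Surjective L) (hLm : Measurable L)
    (hLι : ∀ x k, (inner ℝ x (ι k) : ℝ) = inner ℝ (L x) k)
    (hι : ∀ y u v, Ψ (y, v) = Ψ (y, u) - ι (u - v))

include hΨ hc hu hξ hιm hL hLm hLι hι in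
lemma singularEnergy_le [SFinite ν] :
    Integrable (fun x => 1 / ‖L x‖ * ‖ξ x‖ ^ 2) ∧
      singularEnergy L ξ ≤ π / 2 * c * kineticEnergy ξ := by
  obtain ⟨h1, -, h3⟩ := singular_potential_fibred hιm hL hLm hLι hΨ hι
    (integrable_norm_mul_fibre hξ hΨ hc hu)
  refine ⟨h1, h3.trans ?_⟩
  rw [mul_assoc]
  gcongr
  exact integral_norm_mul_fibre_le hξ hΨ hc hu

include hΨ hm hm0 hβ hc hu hξ hιm hL hLm hLι hι in
-- The kernel 1/2 · (1/|u - v|² - 1/(u² + v² + β u·v + m)) is positive definite because 2ᵏ ≥ 1 ≥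
-- c(-β)ᵏ for 0 < c ≤ 1. Its first half integrates to π² times the singular energy.
theorem re_integral_pairing_self_le [SFinite ν] :
    (∫ z, pairing Ψ id m β ξ ξ z ∂ν.prod volume).re ≤ π ^ 2 * singularEnergy L ξ := by
  have ha : Measurable fun z => hat ξ (Ψ z) := (measurable_hat ξ).comp hΨ.measurable
  have hi := integrable_norm_mul_fibre hξ hΨ hc hu
  have hi0 := hΨ.integrable_comp_of_integrable (integrable_norm_sq_hat ξ)
  obtain ⟨-, h2, -⟩ := singular_potential_fibred hιm hL hLm hLι hΨ hι hi
  have h3 := re_integral_pairKernel_fibred_nonneg ha hi0 hi (α := 1 / 2) (d := -(1 / 2)) (β := β)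
    hm hm0 hβ (fun c hc0 hc1 k => by
      have e1 : (-β) ^ k ≤ 1 := (le_abs_self _).trans (by
        rw [abs_pow, abs_neg]; exact pow_le_one₀ (abs_nonneg _) hβ)
      have e2 : (1 : ℝ) ≤ 2 ^ k := one_le_pow₀ (by norm_num)
      nlinarith)
  obtain ⟨hk, -⟩ := integrable_kato_fibred (ν := ν) ha ha
    (w := fun z : Y × (E3 × E3) => 1 / ‖z.2.1 - z.2.2‖ ^ 2) (by fun_prop) zero_le_one
    (fun z => Or.inl (by rw [abs_of_nonneg (by positivity), one_mul])) hi hi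
  have hp := (integrable_pairing hΨ hm hm0 hβ hc hu hξ hξ (MeasurePreserving.id ν)).1
  have h4 : ∫ z : Y × (E3 × E3), (starRingEnd ℂ) (hat ξ (Ψ (z.1, z.2.1))) *
      hat ξ (Ψ (z.1, z.2.2)) * (pairKernel (1 / 2) (-(1 / 2)) β (m z.1) z.2 : ℂ) ∂ν.prod volume =
      (1 / 2 : ℂ) * (∫ z : Y × (E3 × E3), (starRingEnd ℂ) (hat ξ (Ψ (z.1, z.2.1))) *
        hat ξ (Ψ (z.1, z.2.2)) * ((1 / ‖z.2.1 - z.2.2‖ ^ 2 : ℝ) : ℂ) ∂ν.prod volume) -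
      ∫ z, pairing Ψ id m β ξ ξ z ∂ν.prod volume := by
    rw [← integral_const_mul, ← integral_sub (hk.const_mul _) hp]
    refine integral_congr_ae (Eventually.of_forall fun z => ?_)
    simp only [pairing, pairKernel, id]
    push_cast
    ring
  have h5 : (∫ z : Y × (E3 × E3), (starRingEnd ℂ) (hat ξ (Ψ (z.1, z.2.1))) *
        hat ξ (Ψ (z.1, z.2.2)) * ((1 / ‖z.2.1 - z.2.2‖ ^ 2 : ℝ) : ℂ) ∂ν.prod volume) =
      ((2 * π ^ 2 * singularEnergy L ξ : ℝ) : ℂ) := by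
    have hpi : (π : ℂ) ≠ 0 := Complex.ofReal_ne_zero.2 pi_ne_zero
    rw [Complex.ofReal_mul, singularEnergy, h2]
    push_cast
    field_simp
  rw [h4, h5, Complex.sub_re] at h3
  have e : ((1 / 2 : ℂ) * ((2 * π ^ 2 * singularEnergy L ξ : ℝ) : ℂ)).re =
      π ^ 2 * singularEnergy L ξ := by
    rw [show (1 / 2 : ℂ) = ((1 / 2 : ℝ) : ℂ) by push_cast; rfl, ← Complex.ofReal_mul,
      Complex.ofReal_re]
    ring
  linarith

include hΨ hm hm0 hβ hc hu hξ in
-- For β ≤ 0 the kernel itself is positive definite, so its form is nonnegative on the difference of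
-- ξ̂ and its σ-image. As σ is a measure-preserving involution that keeps the mass, the expansion is
-- twice the difference of the two sides.
theorem re_integral_pairing_le_self [SFinite ν] (hσ : MeasurePreserving σ ν ν)
    (hσσ : ∀ y, σ (σ y) = y) (hmσ : ∀ y, m (σ y) = m y) (hβ0 : β ≤ 0) :
    (∫ z, pairing Ψ σ m β ξ ξ z ∂ν.prod volume).re ≤
      (∫ z, pairing Ψ id m β ξ ξ z ∂ν.prod volume).re := by
  have hΨ' := measurePreserving_comp_base hΨ hσ
  have hu' : ∀ z : Y × E3, ‖z.2‖ ≤ c * √(kinetic (Ψ (σ z.1, z.2))) := fun z => hu (σ z.1, z.2)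
  have ha : Measurable fun z => hat ξ (Ψ z) := (measurable_hat ξ).comp hΨ.measurable
  have hb : Measurable fun z : Y × E3 => hat ξ (Ψ (σ z.1, z.2)) :=
    (measurable_hat ξ).comp hΨ'.measurable
  have hai := integrable_norm_mul_fibre hξ hΨ hc hu
  have hbi := integrable_norm_mul_fibre hξ hΨ' hc hu'
  have hai0 := hΨ.integrable_comp_of_integrable (integrable_norm_sq_hat ξ)
  have hbi0 := hΨ'.integrable_comp_of_integrable (integrable_norm_sq_hat ξ)
  have hd : Measurable fun z : Y × E3 => hat ξ (Ψ z) - hat ξ (Ψ (σ z.1, z.2)) := ha.sub hb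
  have hdle : ∀ z : Y × E3, ‖hat ξ (Ψ z) - hat ξ (Ψ (σ z.1, z.2))‖ ^ 2 ≤
      2 * (‖hat ξ (Ψ z)‖ ^ 2 + ‖hat ξ (Ψ (σ z.1, z.2))‖ ^ 2) := fun z => by
    have := norm_sub_le (hat ξ (Ψ z)) (hat ξ (Ψ (σ z.1, z.2)))
    nlinarith [norm_nonneg (hat ξ (Ψ z) - hat ξ (Ψ (σ z.1, z.2))),
      sq_nonneg (‖hat ξ (Ψ z)‖ - ‖hat ξ (Ψ (σ z.1, z.2))‖)]
  have hdi0 : Integrable (fun z : Y × E3 => ‖hat ξ (Ψ z) - hat ξ (Ψ (σ z.1, z.2))‖ ^ 2)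
      (ν.prod volume) := by
    refine ((hai0.add hbi0).const_mul 2).mono' (hd.norm.pow_const 2).aestronglyMeasurable
      (Eventually.of_forall fun z => ?_)
    rw [Real.norm_of_nonneg (by positivity)]
    exact hdle z
  have hdi : Integrable (fun z : Y × E3 => ‖z.2‖ * ‖hat ξ (Ψ z) - hat ξ (Ψ (σ z.1, z.2))‖ ^ 2)
      (ν.prod volume) := by
    refine ((hai.add hbi).const_mul 2).mono'
      (measurable_snd.norm.mul (hd.norm.pow_const 2)).aestronglyMeasurable
      (Eventually.of_forall fun z => ?_)
    rw [Real.norm_of_nonneg (by positivity)]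
    refine (mul_le_mul_of_nonneg_left (hdle z) (norm_nonneg z.2)).trans (le_of_eq ?_)
    simp only [Pi.add_apply]
    ring
  have h0 := re_integral_pairKernel_fibred_nonneg hd hdi0 hdi (α := 0) (d := 1 / 2) (β := β)
    hm hm0 hβ (fun c hc0 hc1 k => by
      have := pow_nonneg (neg_nonneg.2 hβ0) k
      positivity)
  have haa := (integrable_pairing hΨ hm hm0 hβ hc hu hξ hξ (MeasurePreserving.id ν)).1
  have hab := (integrable_pairing hΨ hm hm0 hβ hc hu hξ hξ hσ).1
  have hs : MeasurePreserving (fun z : Y × (E3 × E3) => (σ z.1, z.2)) (ν.prod volume)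
      (ν.prod volume) := hσ.prod (MeasurePreserving.id volume)
  have hse : MeasurableEmbedding (fun z : Y × (E3 × E3) => (σ z.1, z.2)) :=
    let e : Y × (E3 × E3) ≃ᵐ Y × (E3 × E3) := ⟨⟨fun z => (σ z.1, z.2), fun z => (σ z.1, z.2),
      fun z => by simp only [hσσ], fun z => by simp only [hσσ]⟩, hs.measurable, hs.measurable⟩
    e.measurableEmbedding
  have hbb := hs.integrable_comp_of_integrable haa
  have hba := hs.integrable_comp_of_integrable hab
  have hbbI : ∫ z, (pairing Ψ id m β ξ ξ ∘ fun z => (σ z.1, z.2)) z ∂ν.prod volume =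
      ∫ z, pairing Ψ id m β ξ ξ z ∂ν.prod volume := hs.integral_comp hse _
  have hbaI : ∫ z, (pairing Ψ σ m β ξ ξ ∘ fun z => (σ z.1, z.2)) z ∂ν.prod volume =
      ∫ z, pairing Ψ σ m β ξ ξ z ∂ν.prod volume := hs.integral_comp hse _
  have h1 : ∫ z : Y × (E3 × E3), (starRingEnd ℂ) (hat ξ (Ψ (z.1, z.2.1)) -
      hat ξ (Ψ (σ z.1, z.2.1))) * (hat ξ (Ψ (z.1, z.2.2)) - hat ξ (Ψ (σ z.1, z.2.2))) *
      (pairKernel 0 (1 / 2) β (m z.1) z.2 : ℂ) ∂ν.prod volume =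
      ((∫ z, pairing Ψ id m β ξ ξ z ∂ν.prod volume) +
        ∫ z, pairing Ψ id m β ξ ξ z ∂ν.prod volume) -
      ((∫ z, pairing Ψ σ m β ξ ξ z ∂ν.prod volume) +
        ∫ z, pairing Ψ σ m β ξ ξ z ∂ν.prod volume) := by
    nth_rewrite 2 [← hbbI]
    nth_rewrite 2 [← hbaI]
    rw [← integral_add' haa hbb, ← integral_add' hab hba,
      ← integral_sub' (haa.add hbb) (hab.add hba)]
    refine integral_congr_ae (Eventually.of_forall fun z => ?_)
    simp only [pairing, id, Function.comp, Pi.add_apply, Pi.sub_apply, hσσ, hmσ, map_sub]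
    ring
  rw [h1, Complex.sub_re, Complex.add_re, Complex.add_re] at h0
  linarith

end Pairing

/-! ### The three-body terms -/

section ThreeBody

variable {n : ℕ} {lam : ℝ} {ξ : L2 n}

/-- The mass in the three-body kernel. -/
noncomputable def mass₁ (lam : ℝ) (y : Base₁ n) : ℝ :=
  (1 / 3 * ‖y.1‖ ^ 2 + (∑ i, ‖y.2 i‖ ^ 2) + lam) / 2

lemma measurable_mass₁ (lam : ℝ) : Measurable (mass₁ lam : Base₁ n → ℝ) := by
  unfold mass₁; fun_prop

lemma mass₁_nonneg (hl : 0 ≤ lam) (y : Base₁ n) : 0 ≤ mass₁ lam y := by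
  unfold mass₁; positivity

lemma norm_le_kinetic_fib₁ (z : Base₁ n × E3) : ‖z.2‖ ≤ √(2 / 3) * √(kinetic (fib₁ z)) := by
  rw [← Real.sqrt_mul (by norm_num), kinetic_fib₁]
  refine Real.le_sqrt_of_sq_le ?_
  have : 0 ≤ ∑ i, ‖z.1.2 i‖ ^ 2 := Finset.sum_nonneg fun _ _ => by positivity
  nlinarith [sq_nonneg ‖z.1.1‖]

/-- The energy denominator is 2(u² + v² + u·v + m), whence β = 1 and the factor 1/2 in `pairing`. -/
lemma off1Integrand_pts₁ (z : Base₁ n × (E3 × E3)) :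
    off1Integrand lam ξ (pts₁ z) = pairing fib₁ id (mass₁ lam) 1 ξ ξ z := by
  obtain ⟨⟨K, P⟩, u, v⟩ := z
  have e1 : ((1 / 3 : ℝ) • K - u - v) + (v + (1 / 3 : ℝ) • K) = (2 / 3 : ℝ) • K - u := by module
  have e2 : ((1 / 3 : ℝ) • K - u - v) + (u + (1 / 3 : ℝ) • K) = (2 / 3 : ℝ) • K - v := by module
  have e3 : ‖(1 / 3 : ℝ) • K - u - v‖ ^ 2 + ‖v + (1 / 3 : ℝ) • K‖ ^ 2 + ‖u + (1 / 3 : ℝ) • K‖ ^ 2 +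
      (∑ i, ‖P i‖ ^ 2) + lam =
      2 * (‖u‖ ^ 2 + ‖v‖ ^ 2 + 1 * inner ℝ u v + mass₁ lam (K, P)) := by
    simp only [mass₁, norm_sub_sq_real, norm_add_sq_real, norm_smul, inner_sub_left,
      inner_smul_left, inner_smul_right, real_inner_comm K u, real_inner_comm K v]
    simp
    ring
  simp only [off1Integrand, pts₁, pairing, pairKernel, fib₁, id]
  rw [e1, e2, e3]
  push_cast
  rw [div_eq_mul_inv, mul_inv]
  ring

lemma measurable_hat_cfg₁ {X : Type*} [MeasurableSpace X] (ξ : L2 n) {f g : X → E3}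
    {h : X → Fin n → E3} (hf : Measurable f) (hg : Measurable g) (hh : Measurable h) :
    Measurable fun x => hat ξ (cfg₁ (f x) (g x) (h x)) := by
  have h1 : Measurable fun x => (cfg₁ (f x) (g x) (h x) : Config n) :=
    (measurePreserving_cfg₁ n).measurable.comp (hf.prodMk (hg.prodMk hh))
  exact (measurable_hat ξ).comp h1

lemma measurable_off1Integrand : Measurable (off1Integrand lam ξ) := by
  have h1 := measurable_hat_cfg₁ ξ
    (f := fun p : E3 × E3 × E3 × (Fin n → E3) => p.1 + p.2.1) (g := fun p => p.2.2.1)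
    (h := fun p => p.2.2.2) (by fun_prop) (by fun_prop) (by fun_prop)
  have h2 := measurable_hat_cfg₁ ξ
    (f := fun p : E3 × E3 × E3 × (Fin n → E3) => p.1 + p.2.2.1) (g := fun p => p.2.1)
    (h := fun p => p.2.2.2) (by fun_prop) (by fun_prop) (by fun_prop)
  have h3 : Measurable fun p : E3 × E3 × E3 × (Fin n → E3) =>
      ‖p.1‖ ^ 2 + ‖p.2.1‖ ^ 2 + ‖p.2.2.1‖ ^ 2 + (∑ i, ‖p.2.2.2 i‖ ^ 2) + lam := by fun_prop
  exact ((Complex.continuous_conj.measurable.comp h1).mul h2).div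
    (Complex.measurable_ofReal.comp h3)

lemma integral_off1Integrand (lam : ℝ) (ξ : L2 n) : ∫ p, off1Integrand lam ξ p =
    ∫ z : Base₁ n × (E3 × E3), pairing fib₁ id (mass₁ lam) 1 ξ ξ z := by
  have hT := measurePreserving_pts₁ n
  rw [← hT.map_eq, integral_map hT.measurable.aemeasurable
    measurable_off1Integrand.aestronglyMeasurable]
  exact integral_congr_ae (Eventually.of_forall off1Integrand_pts₁)

lemma integrable_off1Integrand (hl : 0 ≤ lam) (hξ : SobolevHalf ξ) :
    Integrable (off1Integrand lam ξ) ∧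
      ‖∫ p, off1Integrand lam ξ p‖ ≤ π ^ 3 * √(2 / 3) * (kineticEnergy ξ + kineticEnergy ξ) := by
  obtain ⟨h1, h2⟩ := integrable_pairing (measurePreserving_fib₁ n) (measurable_mass₁ lam)
    (mass₁_nonneg hl) (β := 1) (by simp) (Real.sqrt_nonneg _) norm_le_kinetic_fib₁ hξ hξ
    (MeasurePreserving.id volume)
  refine ⟨?_, by rw [integral_off1Integrand]; exact h2⟩
  rw [← (measurePreserving_pts₁ n).integrable_comp measurable_off1Integrand.aestronglyMeasurable]
  exact h1.congr (Eventually.of_forall fun z => (off1Integrand_pts₁ z).symm)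

lemma isHermitianForm_off1 (hl : 0 ≤ lam) :
    IsHermitianForm (formDomain n) (fun ξ => formOff1 lam (ξ : L2 n)) := by
  have h := isHermitianForm_pairing (measurePreserving_fib₁ n) (measurable_mass₁ lam)
    (mass₁_nonneg hl) (β := 1) (by simp) (Real.sqrt_nonneg _) norm_le_kinetic_fib₁
    (MeasurePreserving.id volume) (fun _ => rfl) (fun _ => rfl)
  refine (h.const_mul (-(2 * ((n : ℝ) + 1) / π ^ 2))).congr fun ξ _ => ?_
  rw [formOff1, integral_off1Integrand]
  rfl

lemma singularEnergy_rel₁_le (hξ : SobolevHalf ξ) :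
    Integrable (fun x => 1 / ‖rel₁ x‖ * ‖ξ x‖ ^ 2) ∧
      singularEnergy rel₁ ξ ≤ π / 2 * √(2 / 3) * kineticEnergy ξ :=
  singularEnergy_le (measurePreserving_fib₁ n) (Real.sqrt_nonneg _) norm_le_kinetic_fib₁ hξ
    measurable_dir₁ rel₁_surjective measurable_rel₁ inner_dir₁ fib₁_sub

lemma re_off1_ge (hl : 0 ≤ lam) (hξ : SobolevHalf ξ) :
    -(2 * ((n : ℝ) + 1) * singularEnergy rel₁ ξ) ≤ (formOff1 lam ξ).re := by
  have h := re_integral_pairing_self_le (measurePreserving_fib₁ n) (measurable_mass₁ lam)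
    (mass₁_nonneg hl) (β := 1) (by simp) (Real.sqrt_nonneg _) norm_le_kinetic_fib₁ hξ
    measurable_dir₁ rel₁_surjective measurable_rel₁ inner_dir₁ fib₁_sub
  rw [formOff1, Complex.re_ofReal_mul, integral_off1Integrand, neg_mul, neg_le_neg_iff]
  calc _ ≤ 2 * ((n : ℝ) + 1) / π ^ 2 * (π ^ 2 * singularEnergy rel₁ ξ) := by
        gcongr; exact h
    _ = _ := by field_simp

end ThreeBody

/-! ### The four-body terms -/

section FourBody

variable {m : ℕ} {lam : ℝ} {ξ : L2 (m + 1)}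

/-- The mass in the four-body kernel. -/
noncomputable def mass₂ (lam : ℝ) (y : Base₂ m) : ℝ :=
  (1 / 2 * ‖y.1‖ ^ 2 + 1 / 2 * ‖y.2.1‖ ^ 2 + (∑ i, ‖y.2.2 i‖ ^ 2) + lam) / 2

/-- The exchange of the two pairs. -/
def exchange (y : Base₂ m) : Base₂ m := (y.2.1, y.1, y.2.2)

lemma measurable_mass₂ (lam : ℝ) : Measurable (mass₂ lam : Base₂ m → ℝ) := by
  unfold mass₂; fun_prop

lemma mass₂_nonneg (hl : 0 ≤ lam) (y : Base₂ m) : 0 ≤ mass₂ lam y := by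
  unfold mass₂; positivity

lemma mass₂_exchange (y : Base₂ m) : mass₂ lam (exchange y) = mass₂ lam y := by
  simp only [mass₂, exchange]; ring

lemma measurePreserving_exchange : MeasurePreserving (exchange : Base₂ m → Base₂ m) := by
  have h1 := measurePreserving_assoc_symm (μ := (volume : Measure E3)) (ν := (volume : Measure E3))
    (ρ := (volume : Measure (Fin m → E3)))
  have h2 := (Measure.measurePreserving_swap (μ := (volume : Measure E3))
    (ν := (volume : Measure E3))).prod (MeasurePreserving.id (volume : Measure (Fin m → E3)))
  have h3 := measurePreserving_assoc (μ := (volume : Measure E3)) (ν := (volume : Measure E3))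
    (ρ := (volume : Measure (Fin m → E3)))
  exact h3.comp (h2.comp h1)

lemma norm_le_kinetic_fib₂ (z : Base₂ m × E3) : ‖z.2‖ ≤ √(1 / 2) * √(kinetic (fib₂ z)) := by
  rw [← Real.sqrt_mul (by norm_num), kinetic_fib₂]
  refine Real.le_sqrt_of_sq_le ?_
  have : 0 ≤ ∑ i, ‖z.1.2.2 i‖ ^ 2 := Finset.sum_nonneg fun _ _ => by positivity
  nlinarith [sq_nonneg ‖z.1.1‖, sq_nonneg ‖z.1.2.1‖]

/-- The half sums leave no cross term in the denominator, so β = 0. One factor sees the pair momenta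
(Q, R) and the other (R, Q), whence `exchange`. -/
lemma off0Integrand_pts₂ (z : Base₂ m × (E3 × E3)) :
    off0Integrand lam ξ (pts₂ z) = pairing fib₂ exchange (mass₂ lam) 0 ξ ξ z := by
  obtain ⟨⟨Q, R, P⟩, k, l⟩ := z
  have e1 : ((1 / 2 : ℝ) • Q + l) + ((1 / 2 : ℝ) • Q - l) = Q := by module
  have e2 : ((1 / 2 : ℝ) • R + k) + ((1 / 2 : ℝ) • R - k) = R := by module
  have e3 : ‖(1 / 2 : ℝ) • R + k‖ ^ 2 + ‖(1 / 2 : ℝ) • R - k‖ ^ 2 + ‖(1 / 2 : ℝ) • Q + l‖ ^ 2 +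
      ‖(1 / 2 : ℝ) • Q - l‖ ^ 2 + (∑ i, ‖P i‖ ^ 2) + lam =
      2 * (‖k‖ ^ 2 + ‖l‖ ^ 2 + 0 * inner ℝ k l + mass₂ lam (Q, R, P)) := by
    simp only [mass₂, norm_sub_sq_real, norm_add_sq_real, norm_smul]
    simp
    ring
  simp only [off0Integrand, pts₂, pairing, pairKernel, fib₂, exchange]
  rw [e1, e2, e3]
  push_cast
  rw [div_eq_mul_inv, mul_inv]
  ring

lemma measurable_hat_cfg₂ {X : Type*} [MeasurableSpace X] (ξ : L2 (m + 1)) {f g g' : X → E3}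
    {h : X → Fin m → E3} (hf : Measurable f) (hg : Measurable g) (hg' : Measurable g')
    (hh : Measurable h) : Measurable fun x => hat ξ (cfg₂ (f x) (g x) (g' x) (h x)) := by
  have h1 : Measurable fun x => (cfg₂ (f x) (g x) (g' x) (h x) : Config (m + 1)) :=
    (measurePreserving_cfg₂ m).measurable.comp (hf.prodMk (hg.prodMk (hg'.prodMk hh)))
  exact (measurable_hat ξ).comp h1

lemma measurable_off0Integrand : Measurable (off0Integrand lam ξ) := by
  have h1 := measurable_hat_cfg₂ ξ
    (f := fun p : E3 × E3 × E3 × E3 × (Fin m → E3) => p.2.2.1 + p.2.2.2.1) (g := fun p => p.1)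
    (g' := fun p => p.2.1) (h := fun p => p.2.2.2.2) (by fun_prop) (by fun_prop) (by fun_prop)
    (by fun_prop)
  have h2 := measurable_hat_cfg₂ ξ
    (f := fun p : E3 × E3 × E3 × E3 × (Fin m → E3) => p.1 + p.2.1) (g := fun p => p.2.2.1)
    (g' := fun p => p.2.2.2.1) (h := fun p => p.2.2.2.2) (by fun_prop) (by fun_prop) (by fun_prop)
    (by fun_prop)
  have h3 : Measurable fun p : E3 × E3 × E3 × E3 × (Fin m → E3) =>
      ‖p.1‖ ^ 2 + ‖p.2.1‖ ^ 2 + ‖p.2.2.1‖ ^ 2 + ‖p.2.2.2.1‖ ^ 2 +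
        (∑ i, ‖p.2.2.2.2 i‖ ^ 2) + lam := by fun_prop
  exact ((Complex.continuous_conj.measurable.comp h1).mul h2).div
    (Complex.measurable_ofReal.comp h3)

lemma integral_off0Integrand (lam : ℝ) (ξ : L2 (m + 1)) : ∫ p, off0Integrand lam ξ p =
    ∫ z : Base₂ m × (E3 × E3), pairing fib₂ exchange (mass₂ lam) 0 ξ ξ z := by
  have hT := measurePreserving_pts₂ m
  rw [← hT.map_eq, integral_map hT.measurable.aemeasurable
    measurable_off0Integrand.aestronglyMeasurable]
  exact integral_congr_ae (Eventually.of_forall off0Integrand_pts₂)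

lemma integrable_off0Integrand (hl : 0 ≤ lam) (hξ : SobolevHalf ξ) :
    Integrable (off0Integrand lam ξ) ∧
      ‖∫ p, off0Integrand lam ξ p‖ ≤ π ^ 3 * √(1 / 2) * (kineticEnergy ξ + kineticEnergy ξ) := by
  obtain ⟨h1, h2⟩ := integrable_pairing (measurePreserving_fib₂ m) (measurable_mass₂ lam)
    (mass₂_nonneg hl) (β := 0) (by simp) (Real.sqrt_nonneg _) norm_le_kinetic_fib₂ hξ hξ
    measurePreserving_exchange
  refine ⟨?_, by rw [integral_off0Integrand]; exact h2⟩
  rw [← (measurePreserving_pts₂ m).integrable_comp measurable_off0Integrand.aestronglyMeasurable]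
  exact h1.congr (Eventually.of_forall fun z => (off0Integrand_pts₂ z).symm)

lemma isHermitianForm_off0 {n : ℕ} (hl : 0 ≤ lam) :
    IsHermitianForm (formDomain n) (fun ξ => formOff0 lam (ξ : L2 n)) := by
  cases n with
  | zero => exact isHermitianForm_zero
  | succ m =>
    have h := isHermitianForm_pairing (measurePreserving_fib₂ m) (measurable_mass₂ lam)
      (mass₂_nonneg hl) (β := 0) (by simp) (Real.sqrt_nonneg _) norm_le_kinetic_fib₂
      measurePreserving_exchange (fun _ => rfl) mass₂_exchange
    refine (h.const_mul (-(((m : ℝ) + 2) * ((m : ℝ) + 1) / (2 * π ^ 2)))).congr fun ξ _ => ?_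
    rw [formOff0, integral_off0Integrand]
    rfl

lemma singularEnergy_rel₂_le (hξ : SobolevHalf ξ) :
    Integrable (fun x => 1 / ‖rel₂ x‖ * ‖ξ x‖ ^ 2) ∧
      singularEnergy rel₂ ξ ≤ π / 2 * √(1 / 2) * kineticEnergy ξ :=
  singularEnergy_le (measurePreserving_fib₂ m) (Real.sqrt_nonneg _) norm_le_kinetic_fib₂ hξ
    measurable_dir₂ rel₂_surjective measurable_rel₂ inner_dir₂ fib₂_sub

lemma re_off0_ge (hl : 0 ≤ lam) (hξ : SobolevHalf ξ) :
    -(((m : ℝ) + 2) * ((m : ℝ) + 1) / 2 * singularEnergy rel₂ ξ) ≤ (formOff0 lam ξ).re := by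
  have h := re_integral_pairing_self_le (measurePreserving_fib₂ m) (measurable_mass₂ lam)
    (mass₂_nonneg hl) (β := 0) (by simp) (Real.sqrt_nonneg _) norm_le_kinetic_fib₂ hξ
    measurable_dir₂ rel₂_surjective measurable_rel₂ inner_dir₂ fib₂_sub
  have h' := re_integral_pairing_le_self (measurePreserving_fib₂ m) (measurable_mass₂ lam)
    (mass₂_nonneg hl) (β := 0) (by simp) (Real.sqrt_nonneg _) norm_le_kinetic_fib₂ hξ
    measurePreserving_exchange (fun _ => rfl) mass₂_exchange le_rfl
  rw [formOff0, Complex.re_ofReal_mul, integral_off0Integrand, neg_mul, neg_le_neg_iff]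
  calc _ ≤ ((m : ℝ) + 2) * ((m : ℝ) + 1) / (2 * π ^ 2) * (π ^ 2 * singularEnergy rel₂ ξ) := by
        gcongr; exact h'.trans h
    _ = _ := by field_simp

end FourBody

/-! ### The regularizing terms -/

section Radial

variable {n : ℕ} {θ : ℝ → ℝ} {b : ℝ} {L : Config n →ₗ[ℝ] E3}

lemma ae_radial_bounds (hL : Function.Surjective L)
    (hθb : ∀ᵐ r ∂(volume.restrict (Ioi (0 : ℝ))), 1 - r / b ≤ θ r ∧ θ r ≤ 1 + r / b) :
    ∀ᵐ x : Config n, 1 / ‖L x‖ - 1 / b ≤ θ ‖L x‖ / ‖L x‖ ∧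
      θ ‖L x‖ / ‖L x‖ ≤ 1 / ‖L x‖ + 1 / b := by
  have h : ∀ᵐ r ∂(volume.restrict (Ioi (0 : ℝ))),
      1 / r - 1 / b ≤ θ r / r ∧ θ r / r ≤ 1 / r + 1 / b := by
    filter_upwards [hθb, ae_restrict_mem measurableSet_Ioi] with r hr hr0
    have hr0 : 0 < r := hr0
    have e1 : 1 / r - 1 / b = (1 - r / b) / r := by field_simp
    have e2 : 1 / r + 1 / b = (1 + r / b) / r := by field_simp
    rw [e1, e2]
    exact ⟨by gcongr; exact hr.1, by gcongr; exact hr.2⟩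
  exact ae_norm_linear_of_ae_Ioi (p := fun r => 1 / r - 1 / b ≤ θ r / r ∧ θ r / r ≤ 1 / r + 1 / b)
    hL h

lemma aestronglyMeasurable_radial (hL : Function.Surjective L) (hLm : Measurable L)
    (hθ : AEStronglyMeasurable θ (volume.restrict (Ioi (0 : ℝ)))) :
    AEStronglyMeasurable (fun x : Config n => θ ‖L x‖ / ‖L x‖) volume := by
  refine ⟨fun x => hθ.mk θ ‖L x‖ / ‖L x‖, ?_, ?_⟩
  · exact ((hθ.stronglyMeasurable_mk.measurable.comp hLm.norm).div hLm.norm).stronglyMeasurable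
  · filter_upwards [ae_norm_linear_of_ae_Ioi (p := fun r => θ r = hθ.mk θ r) hL hθ.ae_eq_mk]
      with x hx
    rw [hx]

variable (hL : Function.Surjective L) (hLm : Measurable L) (hθ : AEStronglyMeasurable θ (volume.restrict (Ioi (0 : ℝ))))
  (hθb : ∀ᵐ r ∂(volume.restrict (Ioi (0 : ℝ))), 1 - r / b ≤ θ r ∧ θ r ≤ 1 + r / b)

include hL hLm hθ hθb

theorem integrable_radial {ξ : L2 n} (hi : Integrable fun x => 1 / ‖L x‖ * ‖ξ x‖ ^ 2) :
    Integrable (fun x => θ ‖L x‖ / ‖L x‖ * ‖ξ x‖ ^ 2) ∧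
      singularEnergy L ξ - ‖ξ‖ ^ 2 / b ≤ ∫ x, θ ‖L x‖ / ‖L x‖ * ‖ξ x‖ ^ 2 ∧
      ∫ x, θ ‖L x‖ / ‖L x‖ * ‖ξ x‖ ^ 2 ≤ singularEnergy L ξ + ‖ξ‖ ^ 2 / b := by
  have hξ := (integrable_norm_sq_Lp ξ).const_mul (1 / b)
  have hbd := ae_radial_bounds hL hθb
  have hI : Integrable (fun x => θ ‖L x‖ / ‖L x‖ * ‖ξ x‖ ^ 2) := by
    refine (hi.add hξ).mono' ((aestronglyMeasurable_radial hL hLm hθ).mul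
      ((Lp.aestronglyMeasurable ξ).norm.pow 2)) ?_
    filter_upwards [hbd] with x hx
    rw [norm_mul, Real.norm_of_nonneg (sq_nonneg ‖ξ x‖), Real.norm_eq_abs, Pi.add_apply, ← add_mul]
    gcongr
    rw [abs_le]
    have h1 : 0 ≤ 1 / ‖L x‖ := by positivity
    constructor <;> linarith [hx.1, hx.2]
  have e : ∫ x, 1 / b * ‖ξ x‖ ^ 2 = ‖ξ‖ ^ 2 / b := by
    rw [integral_const_mul, integral_norm_sq_Lp]; ring
  refine ⟨hI, ?_, ?_⟩
  · rw [singularEnergy, ← e, ← integral_sub hi hξ]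
    refine integral_mono_ae (hi.sub hξ) hI ?_
    filter_upwards [hbd] with x hx
    rw [← sub_mul]
    gcongr
    exact hx.1
  · rw [singularEnergy, ← e, ← integral_add hi hξ]
    refine integral_mono_ae hI (hi.add hξ) ?_
    filter_upwards [hbd] with x hx
    rw [← add_mul]
    gcongr
    exact hx.2

theorem isHermitianForm_radial
    (hi : ∀ ξ ∈ formDomain n, Integrable fun x => 1 / ‖L x‖ * ‖(ξ : L2 n) x‖ ^ 2) :
    IsHermitianForm (formDomain n)
      (fun ξ => ((∫ x, θ ‖L x‖ / ‖L x‖ * ‖(ξ : L2 n) x‖ ^ 2 : ℝ) : ℂ)) :=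
  isHermitianForm_weight (a := fun (ξ : chargeSpace n) x => (ξ : L2 n) x)
    (fun ξ η => Lp.coeFn_add (ξ : L2 n) η) (fun c ξ => Lp.coeFn_smul c (ξ : L2 n))
    (fun ξ => Lp.aestronglyMeasurable (ξ : L2 n)) (aestronglyMeasurable_radial hL hLm hθ)
    (fun ξ hξ => (integrable_radial hL hLm hθ hθb (hi ξ hξ)).1)

end Radial

section Regularization

variable {n : ℕ} {θ : ℝ → ℝ} {b γ : ℝ}

lemma reg3Integrand_eq (ξ : L2 n) :
    reg3Integrand θ ξ = fun x => θ ‖rel₁ x‖ / ‖rel₁ x‖ * ‖ξ x‖ ^ 2 := by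
  funext x
  have : ‖x 0 - x 1‖ = ‖rel₁ x‖ := norm_sub_rev _ _
  rw [reg3Integrand, this]

lemma reg4Integrand_eq {m : ℕ} (ξ : L2 (m + 1)) :
    reg4Integrand θ ξ = fun x => θ ‖rel₂ x‖ / ‖rel₂ x‖ * ‖ξ x‖ ^ 2 := rfl

/-- The energy of the singular potential of the entries `1` and `2`; it is absent for `N = 3`. -/
noncomputable def singularEnergy₂ : {n : ℕ} → L2 n → ℝ
  | 0, _ => 0
  | _ + 1, ξ => singularEnergy rel₂ ξ

lemma singularEnergy₂_nonneg (ξ : L2 n) : 0 ≤ singularEnergy₂ ξ := by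
  cases n with
  | zero => exact le_rfl
  | succ m => exact singularEnergy_nonneg _ _

lemma singularEnergy₂_le {ξ : L2 n} (hξ : SobolevHalf ξ) :
    singularEnergy₂ ξ ≤ π / 2 * √(1 / 2) * kineticEnergy ξ := by
  cases n with
  | zero =>
    have := kineticEnergy_nonneg ξ
    change 0 ≤ _
    positivity
  | succ m => exact (singularEnergy_rel₂_le hξ).2

/-- The coefficient vanishes at n = 0, so the case N = 3 needs no separate treatment afterwards. -/
lemma re_formOff0_ge {lam : ℝ} (hl : 0 ≤ lam) {ξ : L2 n} (hξ : SobolevHalf ξ) :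
    -(((n : ℝ) + 1) * n / 2 * singularEnergy₂ ξ) ≤ (formOff0 lam ξ).re := by
  cases n with
  | zero => simp [singularEnergy₂, formOff0]
  | succ m =>
    refine le_trans (le_of_eq ?_) (re_off0_ge hl hξ)
    rw [singularEnergy₂]
    push_cast
    ring

variable (hθ : AEStronglyMeasurable θ (volume.restrict (Ioi (0 : ℝ))))
  (hθb : ∀ᵐ r ∂(volume.restrict (Ioi (0 : ℝ))), 1 - r / b ≤ θ r ∧ θ r ≤ 1 + r / b)

include hθ hθb

lemma integrable_reg3Integrand {ξ : L2 n} (hξ : SobolevHalf ξ) :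
    Integrable (reg3Integrand θ ξ) ∧
      singularEnergy rel₁ ξ - ‖ξ‖ ^ 2 / b ≤ ∫ x, reg3Integrand θ ξ x ∧
      ∫ x, reg3Integrand θ ξ x ≤ singularEnergy rel₁ ξ + ‖ξ‖ ^ 2 / b := by
  rw [reg3Integrand_eq]
  exact integrable_radial rel₁_surjective measurable_rel₁ hθ hθb (singularEnergy_rel₁_le hξ).1

lemma integrable_reg4Integrand {m : ℕ} {ξ : L2 (m + 1)} (hξ : SobolevHalf ξ) :
    Integrable (reg4Integrand θ ξ) ∧
      singularEnergy rel₂ ξ - ‖ξ‖ ^ 2 / b ≤ ∫ x, reg4Integrand θ ξ x ∧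
      ∫ x, reg4Integrand θ ξ x ≤ singularEnergy rel₂ ξ + ‖ξ‖ ^ 2 / b :=
  integrable_radial rel₂_surjective measurable_rel₂ hθ hθb (singularEnergy_rel₂_le hξ).1

lemma formIntegrable {lam : ℝ} (hl : 0 ≤ lam) {ξ : L2 n} (hξ : SobolevHalf ξ) :
    FormIntegrable θ lam ξ := by
  refine ⟨integrable_sqrt_kinetic_add hξ hl, (integrable_off1Integrand hl hξ).1,
    (integrable_reg3Integrand hθ hθb hξ).1, ?_⟩
  cases n with
  | zero => trivial
  | succ m => exact ⟨(integrable_off0Integrand hl hξ).1, (integrable_reg4Integrand hθ hθb hξ).1⟩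

lemma isHermitianForm_reg3 (γ : ℝ) :
    IsHermitianForm (formDomain n) (fun ξ => (formReg3 γ θ (ξ : L2 n) : ℂ)) := by
  refine ((isHermitianForm_radial rel₁_surjective measurable_rel₁ hθ hθb fun ξ hξ =>
    (singularEnergy_rel₁_le ((mem_formDomain_iff ξ).1 hξ)).1).const_mul
    (((n : ℝ) + 1) * γ)).congr fun ξ _ => ?_
  rw [formReg3, reg3Integrand_eq, Complex.ofReal_mul]

lemma isHermitianForm_reg4 (γ : ℝ) :
    IsHermitianForm (formDomain n) (fun ξ => (formReg4 γ θ (ξ : L2 n) : ℂ)) := by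
  cases n with
  | zero => exact isHermitianForm_zero.congr fun ξ _ => by simp [formReg4]
  | succ m =>
    refine ((isHermitianForm_radial rel₂_surjective measurable_rel₂ hθ hθb fun ξ hξ =>
      (singularEnergy_rel₂_le ((mem_formDomain_iff ξ).1 hξ)).1).const_mul
      (((m : ℝ) + 2) * ((m : ℝ) + 1) / 4 * γ)).congr fun ξ _ => ?_
    rw [formReg4, reg4Integrand_eq, Complex.ofReal_mul]

lemma formReg3_ge (hγ : 0 ≤ γ) {ξ : L2 n} (hξ : SobolevHalf ξ) :
    ((n : ℝ) + 1) * γ * (singularEnergy rel₁ ξ - ‖ξ‖ ^ 2 / b) ≤ formReg3 γ θ ξ := by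
  rw [formReg3]
  gcongr
  exact (integrable_reg3Integrand hθ hθb hξ).2.1

lemma formReg4_ge (hγ : 0 ≤ γ) {ξ : L2 n} (hξ : SobolevHalf ξ) :
    ((n : ℝ) + 1) * n / 4 * γ * (singularEnergy₂ ξ - ‖ξ‖ ^ 2 / b) ≤ formReg4 γ θ ξ := by
  cases n with
  | zero => simp [formReg4]
  | succ m =>
    rw [formReg4, singularEnergy₂]
    push_cast
    rw [show (m : ℝ) + 1 + 1 = m + 2 by ring]
    gcongr
    exact (integrable_reg4Integrand hθ hθb hξ).2.1

lemma isHermitianForm_chargeForm {lam : ℝ} (hl : 0 ≤ lam) (α₀ γ : ℝ) :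
    IsHermitianForm (formDomain n) (chargeForm n α₀ γ θ lam) := by
  have hadd := fun ξ η : chargeSpace n => hat_add (ξ : L2 n) η
  have hsmul := fun (c : ℂ) (ξ : chargeSpace n) => hat_smul c (ξ : L2 n)
  have hm := fun ξ : chargeSpace n => (measurable_hat (ξ : L2 n)).aestronglyMeasurable (μ := volume)
  have h1 := (isHermitianForm_weight (D := formDomain n) hadd hsmul hm
    ((measurable_kinetic.add_const lam).sqrt.aestronglyMeasurable) fun ξ hξ =>
    integrable_sqrt_kinetic_add ((mem_formDomain_iff ξ).1 hξ) hl).const_mul (1 / √2)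
  have h2 := isHermitianForm_weight (D := formDomain n) (w := fun _ => α₀) hadd hsmul hm
    aestronglyMeasurable_const fun ξ _ => (integrable_norm_sq_hat (ξ : L2 n)).const_mul α₀
  refine ((((h1.add (isHermitianForm_off0 hl)).add (isHermitianForm_off1 hl)).add
    ((h2.add (isHermitianForm_reg3 hθ hθb γ)).add
      (isHermitianForm_reg4 hθ hθb γ))).const_mul
    (4 * π * ((n : ℝ) + 3) * ((n : ℝ) + 2))).congr fun ξ _ => ?_
  rw [integral_const_mul α₀, integral_norm_sq_hat]
  simp only [chargeForm, formReg, formDiag, Complex.ofReal_mul, Complex.ofReal_add]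
  rfl

end Regularization

/-! ### The constants -/

section Constants

variable (n : ℕ) (γ : ℝ)

/-- With X = (N-2)π(1/√3 + (N-3)/8) one has γ_c = 2 - 1/X, hence 1 - X(γ - γ_c) = X(2 - γ). -/
lemma LambdaN_eq : LambdaN (n + 3) γ =
    max 0 ((2 - γ) * (((n : ℝ) + 1) * π * (1 / √3 + n / 8))) := by
  have h3 : 0 < 1 / √3 + (n : ℝ) / 8 := by positivity
  have hX : 0 < π * ((n : ℝ) + 1) * (1 / √3 + n / 8) := by positivity
  rw [LambdaN, gammaC]
  congr 1
  push_cast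
  rw [show (n : ℝ) + 3 - 2 = n + 1 by ring, show (n : ℝ) + 3 - 3 = n by ring]
  set s := 1 / √3 + (n : ℝ) / 8
  field_simp
  ring

/-- With X as in `LambdaN_eq`, X ≥ 3/2 > 1/2. Positivity of γ is needed to use the lower bound on θ
inside the regularizing terms. -/
lemma gammaC_pos : 0 < gammaC (n + 3) := by
  rw [gammaC]
  push_cast
  rw [show (n : ℝ) + 3 - 2 = n + 1 by ring, show (n : ℝ) + 3 - 3 = n by ring, sub_pos,
    div_lt_iff₀ (by positivity)]
  have h1 : 1 / 2 ≤ 1 / √3 := by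
    gcongr
    rw [Real.sqrt_le_left (by norm_num)]; norm_num
  have h2 : 1 / 2 ≤ 1 / √3 + (n : ℝ) / 8 := by
    have : (0 : ℝ) ≤ n := n.cast_nonneg
    linarith
  have h3 : 3 * 1 ≤ π * ((n : ℝ) + 1) := by
    gcongr
    · exact pi_gt_three.le
    · linarith [n.cast_nonneg (α := ℝ)]
  nlinarith

variable {n γ}

lemma LambdaN_mem (hγ : gammaC (n + 3) < γ) : LambdaN (n + 3) γ ∈ Ico (0 : ℝ) 1 := by
  refine ⟨le_max_left _ _, max_lt one_pos ?_⟩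
  have h : 0 < (((n + 3 : ℕ) : ℝ) - 2) * π * (1 / √3 + (((n + 3 : ℕ) : ℝ) - 3) / 8) *
      (γ - gammaC (n + 3)) := by
    refine mul_pos ?_ (sub_pos.2 hγ)
    push_cast
    rw [show (n : ℝ) + 3 - 2 = n + 1 by ring, show (n : ℝ) + 3 - 3 = n by ring]
    positivity
  linarith

/-- Cauchy-Schwarz for the vectors (Λ, √(1 - Λ²)) and (√A, √λ), the first of norm 1. -/
lemma add_mul_sqrt_le {A lam Λ : ℝ} (hA : 0 ≤ A) (hl : 0 ≤ lam) (h0 : 0 ≤ Λ) (h1 : Λ ≤ 1) :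
    Λ * √A + √lam * √(1 - Λ ^ 2) ≤ √(A + lam) := by
  refine Real.le_sqrt_of_sq_le ?_
  have e1 := Real.sq_sqrt hA
  have e2 := Real.sq_sqrt hl
  have e3 := Real.sq_sqrt (show 0 ≤ 1 - Λ ^ 2 by nlinarith)
  nlinarith [sq_nonneg (√A * √(1 - Λ ^ 2) - Λ * √lam)]

end Constants

/-! ### Bounds for the form -/

section Bounds

variable {n : ℕ} {θ : ℝ → ℝ} {b γ lam : ℝ} {ξ : L2 n}

lemma formDiag_eq (lam : ℝ) (ξ : L2 n) :
    formDiag lam ξ = 1 / √2 * ∫ p, √(kinetic p + lam) * ‖hat ξ p‖ ^ 2 := rfl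

lemma formDiag_ge (hξ : SobolevHalf ξ) (hl : 0 ≤ lam) {Λ : ℝ} (h0 : 0 ≤ Λ) (h1 : Λ ≤ 1) :
    √(lam / 2) * √(1 - Λ ^ 2) * ‖ξ‖ ^ 2 ≤ formDiag lam ξ - Λ * (1 / √2 * kineticEnergy ξ) := by
  have hk := integrable_sqrt_kinetic hξ
  have hk' := integrable_sqrt_kinetic_add hξ hl
  have h : ∫ p, (Λ * (√(kinetic p) * ‖hat ξ p‖ ^ 2) + √lam * √(1 - Λ ^ 2) * ‖hat ξ p‖ ^ 2) ≤
      ∫ p, √(kinetic p + lam) * ‖hat ξ p‖ ^ 2 := by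
    refine integral_mono ((hk.const_mul Λ).add ((integrable_norm_sq_hat ξ).const_mul _)) hk'
      fun p => ?_
    dsimp only
    rw [← mul_assoc, ← add_mul]
    gcongr
    exact add_mul_sqrt_le (kinetic_nonneg p) hl h0 h1
  rw [integral_add (hk.const_mul Λ) ((integrable_norm_sq_hat ξ).const_mul _), integral_const_mul,
    integral_const_mul, integral_norm_sq_hat, ← kineticEnergy] at h
  rw [formDiag_eq, Real.sqrt_div hl]
  have h2 := mul_le_mul_of_nonneg_left h (show 0 ≤ 1 / √2 by positivity)
  linear_combination h2

lemma kineticEnergy_le_formDiag (hξ : SobolevHalf ξ) (hl : 0 ≤ lam) :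
    1 / √2 * kineticEnergy ξ ≤ formDiag lam ξ := by
  have := formDiag_ge hξ hl zero_le_one le_rfl
  simp only [one_pow, sub_self, Real.sqrt_zero, mul_zero, zero_mul, one_mul] at this
  linarith

lemma sobolevNormSq_le_formDiag (hξ : SobolevHalf ξ) (hl : 0 ≤ lam) :
    1 / √2 * √(min (1 / 2) lam) * sobolevNormSq ξ ≤ formDiag lam ξ := by
  rw [formDiag_eq, mul_assoc, sobolevNormSq, ← integral_const_mul (√(min (1 / 2) lam))]
  refine mul_le_mul_of_nonneg_left ?_ (by positivity)
  refine integral_mono (hξ.const_mul _) (integrable_sqrt_kinetic_add hξ hl) fun p => ?_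
  dsimp only
  rw [← mul_assoc, ← Real.sqrt_mul (le_min (by norm_num) hl)]
  gcongr
  have h1 := min_le_left (1 / 2) lam
  have h2 := min_le_right (1 / 2) lam
  nlinarith [le_kinetic p, sq_nonneg ‖p‖]

lemma formDiag_le (hξ : SobolevHalf ξ) (hl : 0 ≤ lam) :
    formDiag lam ξ ≤ 1 / √2 * √(1 + lam) * sobolevNormSq ξ := by
  rw [formDiag_eq, mul_assoc, sobolevNormSq, ← integral_const_mul (√(1 + lam))]
  refine mul_le_mul_of_nonneg_left ?_ (by positivity)
  refine integral_mono (integrable_sqrt_kinetic_add hξ hl) (hξ.const_mul _) fun p => ?_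
  dsimp only
  rw [← mul_assoc, ← Real.sqrt_mul (by linarith)]
  gcongr
  nlinarith [kinetic_le p, mul_nonneg hl (sq_nonneg ‖p‖)]

lemma norm_sq_le_sobolevNormSq (hξ : SobolevHalf ξ) : ‖ξ‖ ^ 2 ≤ sobolevNormSq ξ := by
  rw [← integral_norm_sq_hat]
  refine integral_mono (integrable_norm_sq_hat ξ) hξ fun p => ?_
  have : 1 ≤ √(1 + ‖p‖ ^ 2) := Real.one_le_sqrt.2 (by nlinarith [sq_nonneg ‖p‖])
  exact le_mul_of_one_le_left (by positivity) this

/-- The expression in brackets in the definition of the form. -/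
noncomputable def reducedForm (α₀ γ : ℝ) (θ : ℝ → ℝ) (lam : ℝ) (ξ : L2 n) : ℂ :=
  (formDiag lam ξ : ℂ) + formOff0 lam ξ + formOff1 lam ξ + (formReg α₀ γ θ ξ : ℂ)

variable (hθ : AEStronglyMeasurable θ (volume.restrict (Ioi (0 : ℝ))))
  (hθb : ∀ᵐ r ∂(volume.restrict (Ioi (0 : ℝ))), 1 - r / b ≤ θ r ∧ θ r ≤ 1 + r / b)

include hθ hθb

/-- The diagonal term is kept whole, since both the L² bound and the Gårding inequality start from
here. -/
theorem re_reducedForm_ge (hl : 0 ≤ lam) (hγ : gammaC (n + 3) < γ) (α₀ : ℝ)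
    (hξ : SobolevHalf ξ) :
    formDiag lam ξ - LambdaN (n + 3) γ * (1 / √2 * kineticEnergy ξ) +
      (α₀ - ((n : ℝ) + 4) * (n + 1) * γ / (4 * b)) * ‖ξ‖ ^ 2 ≤ (reducedForm α₀ γ θ lam ξ).re := by
  have hγ0 : 0 ≤ γ := ((gammaC_pos n).trans hγ).le
  have h0 := re_formOff0_ge hl hξ
  have h1 := re_off1_ge hl hξ
  have h3 := formReg3_ge hθ hθb hγ0 hξ
  have h4 := formReg4_ge hθ hθb hγ0 hξ
  have hR1 := (singularEnergy_rel₁_le hξ).2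
  have hR2 := singularEnergy₂_le hξ
  have hR1' := singularEnergy_nonneg rel₁ ξ
  have hR2' := singularEnergy₂_nonneg ξ
  have hK := kineticEnergy_nonneg ξ
  -- Brings the Kato constant into the form occurring in γ_c: (π/2)√(2/3) = (π/√3)/√2.
  have hc1 : √(2 / 3) = 2 * (1 / √3) * (1 / √2) := by
    rw [Real.sqrt_div (by norm_num)]
    have := Real.mul_self_sqrt (show (0 : ℝ) ≤ 2 by norm_num)
    field_simp
    linarith
  have hc2 : √(1 / 2) = 1 / √2 := by rw [Real.sqrt_div (by norm_num), Real.sqrt_one]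
  rw [hc1] at hR1
  rw [hc2] at hR2
  set R₁ := singularEnergy rel₁ ξ
  set R₂ := singularEnergy₂ ξ
  set T := 1 / √2 * kineticEnergy ξ with hT
  have hT0 : 0 ≤ T := by positivity
  have hR : R₁ + n / 4 * R₂ ≤ π * (1 / √3 + n / 8) * T := by
    have : (n : ℝ) / 4 * R₂ ≤ n / 4 * (π / 2 * (1 / √2) * kineticEnergy ξ) := by gcongr
    rw [hT]
    linear_combination hR1 + this
  have hΛ : (2 - γ) * ((n : ℝ) + 1) * (R₁ + n / 4 * R₂) ≤ LambdaN (n + 3) γ * T := by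
    rw [LambdaN_eq]
    -- For γ ≥ 2 the regularization outweighs the off-diagonal terms; this is the maximum with 0 in
    -- Λ_N.
    rcases le_total 0 (2 - γ) with h | h
    · calc _ ≤ (2 - γ) * ((n : ℝ) + 1) * (π * (1 / √3 + n / 8) * T) := by gcongr
        _ = (2 - γ) * (((n : ℝ) + 1) * π * (1 / √3 + n / 8)) * T := by ring
        _ ≤ _ := by gcongr; exact le_max_right _ _
    · calc _ ≤ (0 : ℝ) := mul_nonpos_of_nonpos_of_nonneg
            (mul_nonpos_of_nonpos_of_nonneg h (by positivity)) (by positivity)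
        _ ≤ _ := mul_nonneg (le_max_left _ _) hT0
  simp only [reducedForm, formReg, Complex.add_re, Complex.ofReal_re]
  -- (N-2) + (N-2)(N-3)/4 = (N+1)(N-2)/4.
  have e : ((n : ℝ) + 4) * (n + 1) * γ / (4 * b) * ‖ξ‖ ^ 2 =
      ((n : ℝ) + 1) * γ * (‖ξ‖ ^ 2 / b) + ((n : ℝ) + 1) * n / 4 * γ * (‖ξ‖ ^ 2 / b) := by
    rw [mul_comm 4 b, ← div_div]; ring
  linear_combination h0 + h1 + h3 + h4 + hΛ - e

theorem exists_norm_reducedForm_le (hl : 0 ≤ lam) (hb : 0 < b) (α₀ γ : ℝ) :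
    ∃ C, 0 ≤ C ∧ ∀ ξ : L2 n, SobolevHalf ξ →
      ‖reducedForm α₀ γ θ lam ξ‖ ≤ C * sobolevNormSq ξ := by
  have hoff1 : ∃ C, 0 ≤ C ∧ ∀ ξ : L2 n, SobolevHalf ξ →
      ‖formOff1 lam ξ‖ ≤ C * sobolevNormSq ξ := by
    refine ⟨2 * ((n : ℝ) + 1) / π ^ 2 * (π ^ 3 * √(2 / 3) * 2), by positivity, fun ξ hξ => ?_⟩
    rw [formOff1, norm_mul, Complex.norm_real, norm_neg, Real.norm_of_nonneg (by positivity),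
      mul_assoc]
    gcongr
    refine (integrable_off1Integrand hl hξ).2.trans ?_
    rw [mul_assoc (π ^ 3 * √(2 / 3))]
    gcongr
    linarith [kineticEnergy_le hξ]
  have hoff0 : ∃ C, 0 ≤ C ∧ ∀ ξ : L2 n, SobolevHalf ξ →
      ‖formOff0 lam ξ‖ ≤ C * sobolevNormSq ξ := by
    cases n with
    | zero => exact ⟨0, le_rfl, fun ξ _ => by simp [formOff0]⟩
    | succ m =>
      refine ⟨((m : ℝ) + 2) * ((m : ℝ) + 1) / (2 * π ^ 2) * (π ^ 3 * √(1 / 2) * 2),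
        by positivity, fun ξ hξ => ?_⟩
      rw [formOff0, norm_mul, Complex.norm_real, norm_neg, Real.norm_of_nonneg (by positivity),
        mul_assoc]
      gcongr
      refine (integrable_off0Integrand hl hξ).2.trans ?_
      rw [mul_assoc (π ^ 3 * √(1 / 2))]
      gcongr
      linarith [kineticEnergy_le hξ]
  have habs : ∀ {I R N K S : ℝ} {c : ℝ}, R - N / b ≤ I → I ≤ R + N / b → 0 ≤ R →
      R ≤ c * K → 0 ≤ c → K ≤ S → N ≤ S → |I| ≤ (c + 1 / b) * S := by
    intro I R N K S c h1 h2 h3 h4 h5 h6 h7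
    have e1 : N / b ≤ 1 / b * S := by rw [div_eq_mul_one_div, mul_comm]; gcongr
    have e2 : c * K ≤ c * S := by gcongr
    rw [abs_le]
    constructor <;> linarith
  have hreg3 : ∃ C, 0 ≤ C ∧ ∀ ξ : L2 n, SobolevHalf ξ →
      |formReg3 γ θ ξ| ≤ C * sobolevNormSq ξ := by
    refine ⟨((n : ℝ) + 1) * |γ| * (π / 2 * √(2 / 3) + 1 / b), by positivity, fun ξ hξ => ?_⟩
    obtain ⟨-, h1, h2⟩ := integrable_reg3Integrand hθ hθb hξ
    rw [formReg3, abs_mul, abs_mul, abs_of_nonneg (show 0 ≤ (n : ℝ) + 1 by positivity),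
      mul_assoc (((n : ℝ) + 1) * |γ|)]
    gcongr
    exact habs h1 h2 (singularEnergy_nonneg _ _) (singularEnergy_rel₁_le hξ).2 (by positivity)
      (kineticEnergy_le hξ) (norm_sq_le_sobolevNormSq hξ)
  have hreg4 : ∃ C, 0 ≤ C ∧ ∀ ξ : L2 n, SobolevHalf ξ →
      |formReg4 γ θ ξ| ≤ C * sobolevNormSq ξ := by
    cases n with
    | zero => exact ⟨0, le_rfl, fun ξ _ => by simp [formReg4]⟩
    | succ m =>
      refine ⟨((m : ℝ) + 2) * ((m : ℝ) + 1) / 4 * |γ| * (π / 2 * √(1 / 2) + 1 / b),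
        by positivity, fun ξ hξ => ?_⟩
      obtain ⟨-, h1, h2⟩ := integrable_reg4Integrand hθ hθb hξ
      rw [formReg4, abs_mul, abs_mul,
        abs_of_nonneg (show 0 ≤ ((m : ℝ) + 2) * ((m : ℝ) + 1) / 4 by positivity),
        mul_assoc (((m : ℝ) + 2) * ((m : ℝ) + 1) / 4 * |γ|)]
      gcongr
      exact habs h1 h2 (singularEnergy_nonneg _ _) (singularEnergy_rel₂_le hξ).2 (by positivity)
        (kineticEnergy_le hξ) (norm_sq_le_sobolevNormSq hξ)
  obtain ⟨C₀, h0, h0'⟩ := hoff0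
  obtain ⟨C₁, h1, h1'⟩ := hoff1
  obtain ⟨C₃, h3, h3'⟩ := hreg3
  obtain ⟨C₄, h4, h4'⟩ := hreg4
  refine ⟨1 / √2 * √(1 + lam) + C₀ + C₁ + (|α₀| + C₃ + C₄), by positivity, fun ξ hξ => ?_⟩
  have hd : ‖(formDiag lam ξ : ℂ)‖ ≤ 1 / √2 * √(1 + lam) * sobolevNormSq ξ := by
    rw [Complex.norm_real, Real.norm_of_nonneg]
    · exact formDiag_le hξ hl
    · exact (mul_nonneg (by positivity) (kineticEnergy_nonneg ξ)).trans
        (kineticEnergy_le_formDiag hξ hl)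
  have hr : ‖(formReg α₀ γ θ ξ : ℂ)‖ ≤ (|α₀| + C₃ + C₄) * sobolevNormSq ξ := by
    rw [Complex.norm_real, formReg, Real.norm_eq_abs]
    refine (abs_add_three _ _ _).trans ?_
    rw [abs_mul, abs_of_nonneg (sq_nonneg ‖ξ‖), add_mul, add_mul]
    gcongr
    · exact norm_sq_le_sobolevNormSq hξ
    · exact h3' ξ hξ
    · exact h4' ξ hξ
  rw [reducedForm]
  refine (norm_add_le _ _).trans ?_
  refine (add_le_add_left (norm_add₃_le) _).trans ?_
  linear_combination hd + h0' ξ hξ + h1' ξ hξ + hr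

end Bounds

/-! ### Closedness -/

section Closed

variable {n : ℕ}

lemma exists_seq_tendsto_hat {u : ℕ → L2 n} {ψ : L2 n} (hu : Tendsto u atTop (𝓝 ψ)) :
    ∃ ns : ℕ → ℕ, StrictMono ns ∧
      ∀ᵐ p, Tendsto (fun i => hat (u (ns i)) p) atTop (𝓝 (hat ψ p)) := by
  have hF : Tendsto (fun k => (𝓕 (u k) : L2 n)) atTop (𝓝 (𝓕 ψ : L2 n)) :=
    ((Lp.fourierTransformₗᵢ (Config n) ℂ).continuous.tendsto ψ).comp hu
  obtain ⟨ns, hns, hae⟩ := (tendstoInMeasure_of_tendsto_Lp hF).exists_seq_tendsto_ae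
  refine ⟨ns, hns, ?_⟩
  filter_upwards [quasi_smul_Config.ae hae] with p hp
  exact hp.const_mul _

/-- Lower semicontinuity of the H^{1/2} norm under L² convergence, by Fatou's lemma along a
subsequence whose Fourier transforms converge almost everywhere. -/
lemma sobolevNormSq_le_of_tendsto {u : ℕ → L2 n} {ψ : L2 n} (hu : Tendsto u atTop (𝓝 ψ)) {ε : ℝ}
    (hε : 0 ≤ ε) (h : ∀ᶠ k in atTop, SobolevHalf (u k) ∧ sobolevNormSq (u k) ≤ ε) :
    SobolevHalf ψ ∧ sobolevNormSq ψ ≤ ε := by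
  obtain ⟨ns, hns, hae⟩ := exists_seq_tendsto_hat hu
  set F : L2 n → Config n → ENNReal :=
    fun ξ p => ENNReal.ofReal (√(1 + ‖p‖ ^ 2) * ‖hat ξ p‖ ^ 2) with hF
  have hm : ∀ ξ : L2 n, Measurable fun p => √(1 + ‖p‖ ^ 2) * ‖hat ξ p‖ ^ 2 := fun ξ =>
    (by fun_prop : Measurable fun p : Config n => √(1 + ‖p‖ ^ 2)).mul
      ((measurable_hat ξ).norm.pow_const 2)
  have hnn : ∀ ξ : L2 n, ∀ p, 0 ≤ √(1 + ‖p‖ ^ 2) * ‖hat ξ p‖ ^ 2 := fun ξ p => by positivity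
  have hle : ∫⁻ p, F ψ p ≤ ENNReal.ofReal ε := by
    calc ∫⁻ p, F ψ p = ∫⁻ p, liminf (fun i => F (u (ns i)) p) atTop := by
          refine lintegral_congr_ae ?_
          filter_upwards [hae] with p hp
          have : Tendsto (fun i => F (u (ns i)) p) atTop (𝓝 (F ψ p)) :=
            (ENNReal.continuous_ofReal.tendsto _).comp ((hp.norm.pow 2).const_mul _)
          exact this.liminf_eq.symm
      _ ≤ liminf (fun i => ∫⁻ p, F (u (ns i)) p) atTop :=
          lintegral_liminf_le fun i => (hm _).ennreal_ofReal
      _ ≤ ENNReal.ofReal ε := by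
          refine liminf_le_of_frequently_le' (Eventually.frequently ?_)
          filter_upwards [hns.tendsto_atTop.eventually h] with i hi
          rw [hF, ← ofReal_integral_eq_lintegral_ofReal hi.1 (Eventually.of_forall (hnn _))]
          exact ENNReal.ofReal_le_ofReal hi.2
  have hint : SobolevHalf ψ := by
    refine ⟨(hm ψ).aestronglyMeasurable, ?_⟩
    rw [hasFiniteIntegral_iff_ofReal (Eventually.of_forall (hnn ψ))]
    exact hle.trans_lt ENNReal.ofReal_lt_top
  refine ⟨hint, ?_⟩
  rw [hF, ← ofReal_integral_eq_lintegral_ofReal hint (Eventually.of_forall (hnn ψ))] at hle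
  exact (ENNReal.ofReal_le_ofReal_iff hε).1 hle

/-- By `hlow`, convergence in L² and the Cauchy property for q make the sequence Cauchy in H^{1/2}.
Letting l → ∞ in u k - u l, lower semicontinuity gives convergence to ψ in H^{1/2}, and `hup`
transfers it to q. -/
theorem isClosedForm_of_bounds {q : chargeSpace n → ℂ} {c M C : ℝ} (hc : 0 < c) (hM : 0 ≤ M)
    (hlow : ∀ ξ ∈ formDomain n, c * sobolevNormSq (ξ : L2 n) - M * ‖ξ‖ ^ 2 ≤ (q ξ).re)
    (hup : ∀ ξ ∈ formDomain n, ‖q ξ‖ ≤ C * sobolevNormSq (ξ : L2 n)) :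
    IsClosedForm (formDomain n) q := by
  have hS : ∀ ξ : L2 n, 0 ≤ sobolevNormSq ξ := fun ξ => integral_nonneg fun p => by positivity
  refine ⟨⟨-M, fun ξ hξ => ?_⟩, fun u ψ hu hψ hq => ?_⟩
  · have := hlow ξ hξ
    have := mul_nonneg hc.le (hS ξ)
    linarith
  have hkey : ∀ ε > 0, ∃ k₀ : ℕ, ∀ k ≥ k₀,
      u k - ψ ∈ formDomain n ∧ sobolevNormSq ((u k - ψ : chargeSpace n) : L2 n) ≤ ε := by
    intro ε hε
    -- The form and the term M‖·‖² each get half of c ε; dividing by M + 1 covers the case M = 0.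
    obtain ⟨k₁, hk₁⟩ := hq (c * ε / 2) (by positivity)
    obtain ⟨k₂, hk₂⟩ := Metric.cauchySeq_iff.1 hψ.cauchySeq (√(c * ε / 2 / (M + 1)))
      (by positivity)
    refine ⟨max k₁ k₂, fun k hk => ?_⟩
    have hkl : ∀ l ≥ max k₁ k₂, sobolevNormSq ((u k - u l : chargeSpace n) : L2 n) ≤ ε := by
      intro l hl
      have h1 := hlow (u k - u l) (sub_mem (hu k) (hu l))
      have h2 := hk₁ k ((le_max_left _ _).trans hk) l ((le_max_left _ _).trans hl)
      have h3 := hk₂ k ((le_max_right _ _).trans hk) l ((le_max_right _ _).trans hl)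
      rw [dist_eq_norm] at h3
      have h4 : ‖u k - u l‖ ^ 2 ≤ c * ε / 2 / (M + 1) := by
        rw [← Real.sq_sqrt (show 0 ≤ c * ε / 2 / (M + 1) by positivity)]
        gcongr
      rw [le_div_iff₀ (by positivity)] at h4
      have h5 := Complex.re_le_norm (q (u k - u l))
      nlinarith [sq_nonneg ‖u k - u l‖]
    have ht : Tendsto (fun l => ((u k - u l : chargeSpace n) : L2 n)) atTop
        (𝓝 ((u k - ψ : chargeSpace n) : L2 n)) :=
      (continuous_subtype_val.tendsto _).comp (hψ.const_sub (u k))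
    obtain ⟨h1, h2⟩ := sobolevNormSq_le_of_tendsto ht hε.le
      (eventually_atTop.2 ⟨max k₁ k₂, fun l hl =>
        ⟨(mem_formDomain_iff _).1 (sub_mem (hu k) (hu l)), hkl l hl⟩⟩)
    exact ⟨(mem_formDomain_iff _).2 h1, h2⟩
  refine ⟨?_, ?_⟩
  · obtain ⟨k₀, hk₀⟩ := hkey 1 one_pos
    have := sub_mem (hu k₀) (hk₀ k₀ le_rfl).1
    rwa [sub_sub_cancel] at this
  · rw [Metric.tendsto_atTop]
    intro ε hε
    obtain ⟨k₀, hk₀⟩ := hkey (ε / (|C| + 1)) (by positivity)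
    refine ⟨k₀, fun k hk => ?_⟩
    obtain ⟨h1, h2⟩ := hk₀ k hk
    rw [dist_zero_right]
    calc ‖q (u k - ψ)‖ ≤ C * sobolevNormSq ((u k - ψ : chargeSpace n) : L2 n) := hup _ h1
      _ ≤ |C| * (ε / (|C| + 1)) := mul_le_mul (le_abs_self C) h2 (hS _) (abs_nonneg C)
      _ < (|C| + 1) * (ε / (|C| + 1)) := by gcongr; linarith
      _ = ε := by field_simp

end Closed

/-! ### The lower bound in L² and the Gårding inequality -/

section Coercive

variable {n : ℕ} {θ : ℝ → ℝ} {b γ lam : ℝ}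

lemma chargeForm_re (α₀ : ℝ) (ξ : chargeSpace n) :
    (chargeForm n α₀ γ θ lam ξ).re =
      4 * π * ((n : ℝ) + 3) * ((n : ℝ) + 2) * (reducedForm α₀ γ θ lam (ξ : L2 n)).re :=
  Complex.re_ofReal_mul _ _

variable (hθ : AEStronglyMeasurable θ (volume.restrict (Ioi (0 : ℝ))))
  (hθb : ∀ᵐ r ∂(volume.restrict (Ioi (0 : ℝ))), 1 - r / b ≤ θ r ∧ θ r ≤ 1 + r / b)

include hθ hθb

lemma re_reducedForm_ge_norm_sq (hl : 0 ≤ lam) (hγ : gammaC (n + 3) < γ) (α₀ : ℝ) {ξ : L2 n}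
    (hξ : SobolevHalf ξ) :
    (√(lam / 2) * √(1 - LambdaN (n + 3) γ ^ 2) + α₀ - ((n : ℝ) + 4) * (n + 1) * γ / (4 * b)) *
      ‖ξ‖ ^ 2 ≤ (reducedForm α₀ γ θ lam ξ).re := by
  have hΛ := LambdaN_mem hγ
  have h1 := re_reducedForm_ge hθ hθb hl hγ α₀ hξ
  have h2 := formDiag_ge hξ hl hΛ.1 hΛ.2.le
  linear_combination h1 + h2

/-- The fraction Λ_N of the diagonal term pays for Λ_N T/√2, and the fraction 1 - Λ_N > 0 controls
the H^{1/2} norm because λ > 0. -/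
lemma exists_re_reducedForm_ge (hl : 0 < lam) (hγ : gammaC (n + 3) < γ) (α₀ : ℝ) :
    ∃ c M : ℝ, 0 < c ∧ 0 ≤ M ∧ ∀ ξ : L2 n, SobolevHalf ξ →
      c * sobolevNormSq ξ - M * ‖ξ‖ ^ 2 ≤ (reducedForm α₀ γ θ lam ξ).re := by
  have hΛ := LambdaN_mem hγ
  have hΛ1 : 0 < 1 - LambdaN (n + 3) γ := sub_pos.2 hΛ.2
  have hmin : 0 < min (1 / 2) lam := lt_min (by norm_num) hl
  refine ⟨(1 - LambdaN (n + 3) γ) * (1 / √2 * √(min (1 / 2) lam)),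
    |α₀ - ((n : ℝ) + 4) * (n + 1) * γ / (4 * b)|, by positivity, abs_nonneg _, fun ξ hξ => ?_⟩
  have h1 := re_reducedForm_ge hθ hθb hl.le hγ α₀ hξ
  have h2 := mul_le_mul_of_nonneg_left (kineticEnergy_le_formDiag hξ hl.le) hΛ.1
  have h3 := mul_le_mul_of_nonneg_left (sobolevNormSq_le_formDiag hξ hl.le) hΛ1.le
  have h4 := mul_le_mul_of_nonneg_right
    (neg_abs_le (α₀ - ((n : ℝ) + 4) * (n + 1) * γ / (4 * b))) (sq_nonneg ‖ξ‖)
  linear_combination h1 + h2 + h3 + h4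

end Coercive

/-- The threshold is the λ with √(λ/2) √(1 - Λ²) = max(0, y); it is nonnegative, so λ is
automatically positive. -/
lemma coercivity_constant_pos {Λ lam y : ℝ} (hΛ : Λ ∈ Ico (0 : ℝ) 1)
    (h : 2 * (max 0 y) ^ 2 / (1 - Λ ^ 2) < lam) : 0 < lam ∧ y < √(lam / 2) * √(1 - Λ ^ 2) := by
  have h1 : 0 < 1 - Λ ^ 2 := by nlinarith [hΛ.1, hΛ.2]
  have hl : 0 < lam := lt_of_le_of_lt (by positivity) h
  refine ⟨hl, (le_max_right 0 y).trans_lt ?_⟩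
  rw [← Real.sqrt_mul (by positivity)]
  refine Real.lt_sqrt_of_sq_lt ?_
  rw [div_lt_iff₀ h1] at h
  linarith

end ZeroRangeBose

/-! ### Assembly of the theorem -/

open ZeroRangeBose
theorem proposition1 (N n : ℕ) (hN : N = n + 3) (α₀ γ b : ℝ) (hb : 0 < b) (θ : ℝ → ℝ)
    (hθ : MemLp θ ⊤ (volume.restrict (Set.Ioi (0 : ℝ))))
    (hθb : ∀ᵐ r ∂(volume.restrict (Set.Ioi (0 : ℝ))), 1 - r / b ≤ θ r ∧ θ r ≤ 1 + r / b)
    (hγ : gammaC N < γ) :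
    (∀ lam : ℝ, 0 < lam →
      (∀ ξ ∈ formDomain n, FormIntegrable θ lam (ξ : L2 n)) ∧
      IsHermitianForm (formDomain n) (chargeForm n α₀ γ θ lam) ∧
      IsClosedForm (formDomain n) (chargeForm n α₀ γ θ lam) ∧
      ∀ ξ ∈ formDomain n,
        4 * Real.pi * (N : ℝ) * ((N : ℝ) - 1) *
            (Real.sqrt (lam / 2) * Real.sqrt (1 - LambdaN N γ ^ 2) + α₀ -
              ((N : ℝ) + 1) * ((N : ℝ) - 2) * γ / (4 * b)) * ‖ξ‖ ^ 2
          ≤ (chargeForm n α₀ γ θ lam ξ).re) ∧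
    LambdaN N γ ∈ Set.Ico (0 : ℝ) 1 ∧
    ∀ lam : ℝ, lambdaZero N α₀ γ b < lam →
      IsCoerciveForm (formDomain n) (fun ξ => ‖ξ‖ ^ 2) (chargeForm n α₀ γ θ lam) ∧
      IsCoerciveForm (formDomain n) (fun ξ => sobolevNormSq (ξ : L2 n))
        (chargeForm n α₀ γ θ lam) := by
  subst hN
  have hθm := hθ.aestronglyMeasurable
  have hΛ := LambdaN_mem hγ
  have hp : 0 < 4 * Real.pi * ((n : ℝ) + 3) * ((n : ℝ) + 2) := by positivity
  have hcast : ((n + 3 : ℕ) : ℝ) = n + 3 := by push_cast; rfl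
  refine ⟨fun lam hl => ⟨fun ξ hξ => formIntegrable hθm hθb hl.le ((mem_formDomain_iff ξ).1 hξ),
    isHermitianForm_chargeForm hθm hθb hl.le α₀ γ, ?_, fun ξ hξ => ?_⟩, hΛ, fun lam hlam => ?_⟩
  · obtain ⟨c, M, hc, hM, hlow⟩ := exists_re_reducedForm_ge (n := n) hθm hθb hl hγ α₀
    obtain ⟨C, -, hup⟩ := exists_norm_reducedForm_le (n := n) hθm hθb hl.le hb α₀ γ
    refine isClosedForm_of_bounds (mul_pos hp hc) (mul_nonneg hp.le hM)
      (C := 4 * Real.pi * ((n : ℝ) + 3) * ((n : ℝ) + 2) * C) (fun ξ hξ => ?_) fun ξ hξ => ?_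
    · rw [chargeForm_re, mul_assoc, mul_assoc _ M, ← mul_sub]
      exact mul_le_mul_of_nonneg_left (hlow ξ ((mem_formDomain_iff ξ).1 hξ)) hp.le
    · have h := hup ξ ((mem_formDomain_iff ξ).1 hξ)
      rw [chargeForm, norm_mul, Complex.norm_real, Real.norm_of_nonneg hp.le, mul_assoc _ C]
      exact mul_le_mul_of_nonneg_left h hp.le
  · rw [chargeForm_re, hcast, show (n : ℝ) + 3 - 1 = n + 2 by ring,
      show (n : ℝ) + 3 + 1 = n + 4 by ring, show (n : ℝ) + 3 - 2 = n + 1 by ring, mul_assoc]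
    exact mul_le_mul_of_nonneg_left
      (re_reducedForm_ge_norm_sq hθm hθb hl.le hγ α₀ ((mem_formDomain_iff ξ).1 hξ)) hp.le
  · rw [lambdaZero, hcast, show (n : ℝ) + 3 + 1 = n + 4 by ring,
      show (n : ℝ) + 3 - 2 = n + 1 by ring] at hlam
    obtain ⟨hl, hκ⟩ := coercivity_constant_pos hΛ hlam
    set κ := Real.sqrt (lam / 2) * Real.sqrt (1 - LambdaN (n + 3) γ ^ 2) + α₀ -
      ((n : ℝ) + 4) * (n + 1) * γ / (4 * b) with hκ_def
    have hκ0 : 0 < κ := by linarith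
    have hL2 := fun ξ (hξ : ξ ∈ formDomain n) =>
      re_reducedForm_ge_norm_sq hθm hθb hl.le hγ α₀ ((mem_formDomain_iff ξ).1 hξ)
    obtain ⟨c, M, hc, hM, hlow⟩ := exists_re_reducedForm_ge (n := n) hθm hθb hl hγ α₀
    -- With S the squared H^{1/2} norm and Re the real part of the reduced form, c S ≤ Re + M‖ξ‖² ≤
    -- (1 + M/κ) Re, which gives the constant c/(1 + M/κ).
    refine ⟨⟨_, mul_pos hp hκ0, fun ξ hξ => ?_⟩,
      ⟨4 * Real.pi * ((n : ℝ) + 3) * ((n : ℝ) + 2) * (c / (1 + M / κ)), by positivity,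
        fun ξ hξ => ?_⟩⟩
    · rw [chargeForm_re, mul_assoc]
      exact mul_le_mul_of_nonneg_left (hL2 ξ hξ) hp.le
    · rw [chargeForm_re, mul_assoc]
      refine mul_le_mul_of_nonneg_left ?_ hp.le
      rw [div_mul_eq_mul_div, div_le_iff₀ (by positivity)]
      have h1 := hlow ξ ((mem_formDomain_iff ξ).1 hξ)
      have h2 : M / κ * (κ * ‖(ξ : L2 n)‖ ^ 2) ≤ M / κ * (reducedForm α₀ γ θ lam (ξ : L2 n)).re :=
        mul_le_mul_of_nonneg_left (hL2 ξ hξ) (by positivity)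
      have h3 : M / κ * (κ * ‖(ξ : L2 n)‖ ^ 2) = M * ‖(ξ : L2 n)‖ ^ 2 := by field_simp
      linarith
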